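/- Let $n\ge 2$, let $\Omega\subset\mathbb R^n$ be a bounded convex domain (open set), let $P\in\partial\Omega$, and let $0<\alpha<1$. For $Q\in\Omega$ put $r=|Q-P|$, $\mathbf e=(Q-P)/r$, $T=P+\mathbf e t$, and let $d=d(\mathbf e)$ be the length of the part inside $\Omega$ of the ray from $P$ in the direction $\mathbf e$. The Kipriyanov fractional derivative is $$(\mathfrak D^\alpha f)(Q)=\frac{\alpha}{\Gamma(1-\alpha)}\int_0^r\frac{f(Q)-f(T)}{(r-t)^{\alpha+1}}\Big(\frac tr\Big)^{n-1}dt+\frac{(n-1)!}{\Gamma(n-\alpha)}f(Q)\,r^{-\alpha},$$ and $\mathfrak D^\alpha_{d-}f$ is the limit in $L_2(\Omega)$, as $\varepsilon\to0+$, of $$\frac{1}{\Gamma(1-\alpha)}f(Q)(d-r)^{-\alpha}+\frac{\alpha}{\Gamma(1-\alpha)}(\psi^-_\varepsilon f)(Q),$$ where $(\psi^-_\varepsilon f)(Q)=\int_{r+\varepsilon}^d\frac{f(Q)-f(T)}{(t-r)^{\alpha+1}}dt$ if $r\le d-\varepsilon$ and $(\psi^-_\varepsilon f)(Q)=\frac{f(Q)}{\alpha}\big(\varepsilon^{-\alpha}-(d-r)^{-\alpha}\big)$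 if $r>d-\varepsilon$. Let $a^{ij}\in C^1(\overline\Omega)$, $i,j=1,\dots,n$, be real functions (not necessarily symmetric in $i,j$) with $a^{ij}(Q)\xi_i\xi_j\ge a_0|\xi|^2$ for all $Q\in\Omega$, $\xi\in\mathbb R^n$ and some $a_0>0$ (summation over repeated indices). Let $\rho$ be a real function, positive on $\Omega$, with $|\rho(Q)-\rho(Q')|\le M|Q-Q'|^\lambda$ for $Q,Q'\in\overline\Omega$, where $\alpha<\lambda\le1$. In the complex space $L_2(\Omega)$, with weak derivatives $D_i$, consider the operators $$Lu=-D_j(a^{ij}D_iu)+\rho\,\mathfrak D^\alpha u,\qquad L^+u=-D_i(a^{ij}D_ju)+\mathfrak D^\alpha_{d-}(\rho u),\qquad H=\tfrac12(L+L^+),$$ all with the domain $H^2(\Omega)\cap H^1_0(\Omega)$, and the forms $$t[u,v]=\int_\Omega a^{ij}D_iu\,\overline{D_jv}\,dQ+\int_\Omega\rho\,\mathfrak D^\alpha u\,\bar v\,dQ,\qquad h[u,v]=\tfrac12\big(t[u,v]+\overline{t[v,u]}\big),\qquad u,v\in H^1_0(\Omega).$$ Then these objects are well defined: for $u\in H_0^1(\Omega)$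 the integral defining $\mathfrak D^\alpha u$ converges absolutely almost everywhere and $\mathfrak D^\alpha u\in L_2(\Omega)$; $L$ and $L^+$ are linear operators in $L_2(\Omega)$; the integrals in $t$ converge, and $t$ is sesquilinear. Moreover: 1. The form $t$ is sectorial, i.e. its numerical range $\{t[u,u]:\|u\|_{L_2(\Omega)}=1\}$ lies in a sector $\{\zeta:|\arg(\zeta-\gamma)|\le\theta\}$ with $\gamma\in\mathbb R$, $0\le\theta<\pi/2$. The form $t$ is closed, i.e. if $u_k\in H^1_0(\Omega)$, $u_k\to u$ in $L_2(\Omega)$ and $t[u_k-u_m,u_k-u_m]\to0$ as $k,m\to\infty$, then $u\in H_0^1(\Omega)$ and $t[u_k-u,u_k-u]\to0$. The operator $L$ is closable, and, $\tilde L$ being its closure, the form $\mathfrak f[u,v]=(\tilde Lu,v)_{L_2(\Omega)}$, $u,v\in D(\tilde L)$, is closable, and its closure is $t$. 2. The form $h$ is symmetric, sectorial and closed. The operator $H$ is closable, and, $\tilde H$ being its closure, the form $\mathfrak k[u,v]=(\tilde Hu,v)_{L_2(\Omega)}$, $u,v\in D(\tilde H)$, is closable, and its closure is $h$. Here a form is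 closable if it has a closed sectorial extension. The closure of a closable form $\mathfrak f$ is the form whose domain consists of all limits $u$ in $L_2(\Omega)$ of sequences $u_k\in D(\mathfrak f)$ with $\mathfrak f[u_k-u_m,u_k-u_m]\to0$ as $k,m\to\infty$, and whose value at $(u,v)$ is $\lim\mathfrak f[u_k,v_k]$ for any such sequences $u_k\to u$, $v_k\to v$. -/

import Mathlib

open MeasureTheory Filter Topology
open scoped ContDiff ComplexConjugate InnerProductSpace

namespace Kipriyanov

/-! ### Sesquilinear forms in a complex Hilbert space -/

section Forms

variable {H : Type*} [NormedAddCommGroup H] [InnerProductSpace ℂ H]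

/-- A sesquilinear form in `H`, defined on a linear subspace: linear in the first argument and
conjugate-linear in the second one. -/
structure SesqForm (H : Type*) [NormedAddCommGroup H] [InnerProductSpace ℂ H] where
  domain : Submodule ℂ H
  toFun : domain →ₗ[ℂ] domain →ₗ⋆[ℂ] ℂ

namespace SesqForm

/-- The form is sectorial: its numerical range `{t[u,u] : ‖u‖ = 1}` lies in a sector
`|arg (ζ - γ)| ≤ θ` with real vertex `γ` and semi-angle `0 ≤ θ < π / 2`. -/
def IsSectorial (t : SesqForm H) : Prop :=
  ∃ γ θ : ℝ, 0 ≤ θ ∧ θ < Real.pi / 2 ∧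
    ∀ u : t.domain, ‖(u : H)‖ = 1 → |Complex.arg (t.toFun u u - (γ : ℂ))| ≤ θ

/-- The form is symmetric. -/
def IsSymmetric (t : SesqForm H) : Prop :=
  ∀ u v : t.domain, t.toFun u v = conj (t.toFun v u)

/-- `t`-convergence of a sequence in the domain of `t` to a vector `u` of the Hilbert space (which
need not belong to the domain): `uₖ → u` in `H` and `t[uₖ - uₘ, uₖ - uₘ] → 0` as `k, m → ∞`. -/
def ConvergesTo (t : SesqForm H) (s : ℕ → t.domain) (u : H) : Prop :=
  Tendsto (fun k => (s k : H)) atTop (𝓝 u) ∧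
    Tendsto (fun p : ℕ × ℕ => t.toFun (s p.1 - s p.2) (s p.1 - s p.2)) atTop (𝓝 0)

/-- The form is closed: if `uₖ` is `t`-convergent to `u`, then `u` belongs to the domain and
`t[uₖ - u, uₖ - u] → 0`. -/
def IsClosed (t : SesqForm H) : Prop :=
  ∀ (s : ℕ → t.domain) (u : H), t.ConvergesTo s u →
    ∃ hu : u ∈ t.domain,
      Tendsto (fun k => t.toFun (s k - ⟨u, hu⟩) (s k - ⟨u, hu⟩)) atTop (𝓝 0)

/-- The form `s` is an extension of the form `f`. -/
def Extends (s f : SesqForm H) : Prop :=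
  ∃ h : f.domain ≤ s.domain, ∀ u v : f.domain,
    s.toFun (Submodule.inclusion h u) (Submodule.inclusion h v) = f.toFun u v

/-- The form is closable: it has a closed sectorial extension. -/
def IsClosable (f : SesqForm H) : Prop :=
  ∃ s : SesqForm H, s.IsSectorial ∧ s.IsClosed ∧ s.Extends f

/-- `t` is the closure of the closable form `f`: the domain of `t` consists of the limits of all
`f`-convergent sequences, and `t[u,v] = lim f[uₖ,vₖ]` whenever `uₖ`, `vₖ` are `f`-convergent to
`u`, `v`. -/
structure IsClosureOf (t f : SesqForm H) : Prop where
  closable : f.IsClosable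
  mem_domain : ∀ u : H, u ∈ t.domain ↔ ∃ s : ℕ → f.domain, f.ConvergesTo s u
  tendsto : ∀ (u v : t.domain) (s s' : ℕ → f.domain),
    f.ConvergesTo s u → f.ConvergesTo s' v →
      Tendsto (fun k => f.toFun (s k) (s' k)) atTop (𝓝 (t.toFun u v))

/-- The real part `½ (t + t*)` of a form, where `t*[u,v]` is the complex conjugate of `t[v,u]`. -/
noncomputable def realPart (t : SesqForm H) : SesqForm H where
  domain := t.domain
  toFun := LinearMap.mk₂'ₛₗ (RingHom.id ℂ) (starRingEnd ℂ)
    (fun u v => (1 / 2 : ℂ) * (t.toFun u v + conj (t.toFun v u)))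
    (by intro u u' v; simp; ring)
    (by intro c u v; simp; ring)
    (by intro u v v'; simp; ring)
    (by intro c u v; simp; ring)

end SesqForm

/-- The form `(T u, v)` on the domain of a linear operator `T`; the inner product `(x, y)` is linear
in `x`, so it is `⟪y, x⟫_ℂ` in the convention of the library. -/
noncomputable def operatorForm (T : H →ₗ.[ℂ] H) : SesqForm H where
  domain := T.domain
  toFun := LinearMap.mk₂'ₛₗ (RingHom.id ℂ) (starRingEnd ℂ)
    (fun u v => ⟪(v : H), T u⟫_ℂ)
    (by intro u u' v; rw [T.map_add, inner_add_right])
    (by intro c u v; rw [T.map_smul, inner_smul_right]; rfl)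
    (by intro u v v'; rw [Submodule.coe_add, inner_add_left])
    (by intro c u v; rw [Submodule.coe_smul, inner_smul_left]; rfl)

end Forms

/-! ### Sobolev spaces -/

section Sobolev

variable {n : ℕ}

/-- The complex space `L₂(Ω)`. -/
noncomputable abbrev L2 (Ω : Set (EuclideanSpace ℝ (Fin n))) :=
  Lp ℂ 2 (volume.restrict Ω)

/-- The functions of class `C₀^∞(Ω)`. -/
def IsTestFunction (Ω : Set (EuclideanSpace ℝ (Fin n))) (φ : EuclideanSpace ℝ (Fin n) → ℂ) :
    Prop :=
  ContDiff ℝ ∞ φ ∧ HasCompactSupport φ ∧ tsupport φ ⊆ Ω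

/-- The classical partial derivative with respect to the `i`-th coordinate. -/
noncomputable def partialDeriv (i : Fin n) (φ : EuclideanSpace ℝ (Fin n) → ℂ)
    (x : EuclideanSpace ℝ (Fin n)) : ℂ :=
  fderiv ℝ φ x (EuclideanSpace.single i 1)

/-- `g` is the weak derivative of `f` in `Ω` with respect to the `i`-th coordinate (used for square
integrable `f` and `g`). -/
def HasWeakDeriv (Ω : Set (EuclideanSpace ℝ (Fin n))) (i : Fin n)
    (f g : EuclideanSpace ℝ (Fin n) → ℂ) : Prop :=
  ∀ φ : EuclideanSpace ℝ (Fin n) → ℂ, IsTestFunction Ω φ →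
    ∫ x in Ω, f x * partialDeriv i φ x = -∫ x in Ω, g x * φ x

open Classical in
/-- The weak derivative `D_i f`, as an element of `L₂(Ω)`; it is only used for `f` that have a
square integrable weak derivative. -/
noncomputable def weakDeriv (Ω : Set (EuclideanSpace ℝ (Fin n))) (i : Fin n)
    (f : EuclideanSpace ℝ (Fin n) → ℂ) : L2 Ω :=
  if h : ∃ g : L2 Ω, HasWeakDeriv Ω i f g then h.choose else 0

/-- The Sobolev space `H¹(Ω)`. -/
def sobolevH1 (Ω : Set (EuclideanSpace ℝ (Fin n))) : Set (L2 Ω) :=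
  {u | ∀ i, ∃ g : L2 Ω, HasWeakDeriv Ω i u g}

/-- The Sobolev space `H²(Ω)`. -/
def sobolevH2 (Ω : Set (EuclideanSpace ℝ (Fin n))) : Set (L2 Ω) :=
  {u | ∀ i, ∃ g : L2 Ω, HasWeakDeriv Ω i u g ∧ ∀ j, ∃ k : L2 Ω, HasWeakDeriv Ω j g k}

/-- The Sobolev space `H₀¹(Ω)`: the closure of `C₀^∞(Ω)` in `H¹(Ω)`. -/
def sobolevH10 (Ω : Set (EuclideanSpace ℝ (Fin n))) : Set (L2 Ω) :=
  {u | u ∈ sobolevH1 Ω ∧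
    ∃ φ : ℕ → EuclideanSpace ℝ (Fin n) → ℂ, (∀ k, IsTestFunction Ω (φ k)) ∧
      Tendsto (fun k => eLpNorm (fun x => φ k x - u x) 2 (volume.restrict Ω)) atTop (𝓝 0) ∧
      ∀ i, Tendsto (fun k => eLpNorm (fun x => partialDeriv i (φ k) x - weakDeriv Ω i u x) 2
        (volume.restrict Ω)) atTop (𝓝 0)}

/-- Real functions of class `C¹` on the closure of `Ω`: continuous on the closure, differentiable
in `Ω`, with a derivative that extends continuously to the closure. -/
def IsC1Closure (Ω : Set (EuclideanSpace ℝ (Fin n))) (f : EuclideanSpace ℝ (Fin n) → ℝ) : Prop :=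
  ContinuousOn f (closure Ω) ∧
    ∃ f' : EuclideanSpace ℝ (Fin n) → EuclideanSpace ℝ (Fin n) →L[ℝ] ℝ,
      ContinuousOn f' (closure Ω) ∧ ∀ x ∈ Ω, HasFDerivAt f (f' x) x

end Sobolev

/-! ### Fractional derivatives along the rays that start from `P` -/

section Fractional

variable {n : ℕ}

/-- The point `T = P + t e` on the ray from `P` through `Q`, at distance `t` from `P`, where
`e = (Q - P) / |Q - P|`. -/
noncomputable def rayPoint (P Q : EuclideanSpace ℝ (Fin n)) (t : ℝ) : EuclideanSpace ℝ (Fin n) :=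
  P + t • (‖Q - P‖⁻¹ • (Q - P))

/-- The length `d(e)` of the part inside `Ω` of the ray from `P` through `Q`. -/
noncomputable def rayLength (Ω : Set (EuclideanSpace ℝ (Fin n)))
    (P Q : EuclideanSpace ℝ (Fin n)) : ℝ :=
  sSup {t : ℝ | 0 ≤ t ∧ rayPoint P Q t ∈ Ω}

/-- The integrand of the Kipriyanov fractional derivative. -/
noncomputable def kipriyanovIntegrand (P : EuclideanSpace ℝ (Fin n)) (α : ℝ)
    (f : EuclideanSpace ℝ (Fin n) → ℂ) (Q : EuclideanSpace ℝ (Fin n)) (t : ℝ) : ℂ :=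
  (f Q - f (rayPoint P Q t)) *
    (((t / ‖Q - P‖) ^ (n - 1) / (‖Q - P‖ - t) ^ (α + 1) : ℝ) : ℂ)

/-- The Kipriyanov fractional derivative of order `α` of `f` at the point `Q`. -/
noncomputable def kipriyanov (P : EuclideanSpace ℝ (Fin n)) (α : ℝ)
    (f : EuclideanSpace ℝ (Fin n) → ℂ) (Q : EuclideanSpace ℝ (Fin n)) : ℂ :=
  ((α / Real.Gamma (1 - α) : ℝ) : ℂ) *
      (∫ t in (0 : ℝ)..‖Q - P‖, kipriyanovIntegrand P α f Q t) +
    ((((n - 1).factorial : ℝ) / Real.Gamma (n - α) * ‖Q - P‖ ^ (-α) : ℝ) : ℂ) * f Q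

open Classical in
/-- The truncated difference integral `ψ_ε⁻ f` for the right-side derivative. -/
noncomputable def psiMinus (Ω : Set (EuclideanSpace ℝ (Fin n))) (P : EuclideanSpace ℝ (Fin n))
    (α ε : ℝ) (f : EuclideanSpace ℝ (Fin n) → ℂ) (Q : EuclideanSpace ℝ (Fin n)) : ℂ :=
  if ‖Q - P‖ ≤ rayLength Ω P Q - ε then
    ∫ t in (‖Q - P‖ + ε)..(rayLength Ω P Q),
      (f Q - f (rayPoint P Q t)) / (((t - ‖Q - P‖) ^ (α + 1) : ℝ) : ℂ)
  else
    f Q * ((1 / α * (1 / ε ^ α - 1 / (rayLength Ω P Q - ‖Q - P‖) ^ α) : ℝ) : ℂ)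

/-- The truncated right-side directional fractional derivative of order `α`. -/
noncomputable def rightDerivTrunc (Ω : Set (EuclideanSpace ℝ (Fin n)))
    (P : EuclideanSpace ℝ (Fin n)) (α ε : ℝ) (f : EuclideanSpace ℝ (Fin n) → ℂ)
    (Q : EuclideanSpace ℝ (Fin n)) : ℂ :=
  ((1 / Real.Gamma (1 - α) * (rayLength Ω P Q - ‖Q - P‖) ^ (-α) : ℝ) : ℂ) * f Q +
    ((α / Real.Gamma (1 - α) : ℝ) : ℂ) * psiMinus Ω P α ε f Q

/-- `g` is the right-side directional fractional derivative of order `α` of `f`: the limit in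
`L₂(Ω)` of the truncated derivatives as `ε → 0+`. -/
def HasRightDeriv (Ω : Set (EuclideanSpace ℝ (Fin n))) (P : EuclideanSpace ℝ (Fin n)) (α : ℝ)
    (f g : EuclideanSpace ℝ (Fin n) → ℂ) : Prop :=
  Tendsto (fun ε : ℝ => eLpNorm (fun Q => rightDerivTrunc Ω P α ε f Q - g Q) 2
    (volume.restrict Ω)) (𝓝[>] 0) (𝓝 0)

end Fractional

/-! ### The operators and the form -/

section Operators

variable {n : ℕ}

/-- The senior term `-∑ D_j (a^{ij} D_i u)`. -/
noncomputable def seniorTerm (Ω : Set (EuclideanSpace ℝ (Fin n)))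
    (a : Fin n → Fin n → EuclideanSpace ℝ (Fin n) → ℝ) (u : EuclideanSpace ℝ (Fin n) → ℂ)
    (x : EuclideanSpace ℝ (Fin n)) : ℂ :=
  -∑ i, ∑ j, weakDeriv Ω j (fun y => (a i j y : ℂ) * weakDeriv Ω i u y) x

/-- `L` is the operator `L u = -D_j (a^{ij} D_i u) + ρ 𝔇^α u` in `L₂(Ω)` with the domain
`H²(Ω) ∩ H₀¹(Ω)`. -/
structure IsOperatorL (Ω : Set (EuclideanSpace ℝ (Fin n))) (P : EuclideanSpace ℝ (Fin n)) (α : ℝ)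
    (a : Fin n → Fin n → EuclideanSpace ℝ (Fin n) → ℝ) (ρ : EuclideanSpace ℝ (Fin n) → ℝ)
    (L : L2 Ω →ₗ.[ℂ] L2 Ω) : Prop where
  domain_eq : (L.domain : Set (L2 Ω)) = sobolevH2 Ω ∩ sobolevH10 Ω
  apply_ae : ∀ u : L.domain, ∀ᵐ x ∂(volume.restrict Ω),
    (L u : L2 Ω) x = seniorTerm Ω a (u : L2 Ω) x + (ρ x : ℂ) * kipriyanov P α (u : L2 Ω) x

/-- `Lplus` is the formal adjoint `L⁺ u = -D_i (a^{ij} D_j u) + 𝔇_{d-}^α (ρ u)` in `L₂(Ω)`, with the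
same domain `H²(Ω) ∩ H₀¹(Ω)`. -/
structure IsOperatorLplus (Ω : Set (EuclideanSpace ℝ (Fin n))) (P : EuclideanSpace ℝ (Fin n))
    (α : ℝ) (a : Fin n → Fin n → EuclideanSpace ℝ (Fin n) → ℝ)
    (ρ : EuclideanSpace ℝ (Fin n) → ℝ) (Lplus : L2 Ω →ₗ.[ℂ] L2 Ω) : Prop where
  domain_eq : (Lplus.domain : Set (L2 Ω)) = sobolevH2 Ω ∩ sobolevH10 Ω
  apply_ae : ∀ u : Lplus.domain, ∃ w : L2 Ω,
    HasRightDeriv Ω P α (fun x => (ρ x : ℂ) * (u : L2 Ω) x) w ∧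
    ∀ᵐ x ∂(volume.restrict Ω),
      (Lplus u : L2 Ω) x = seniorTerm Ω (fun i j => a j i) (u : L2 Ω) x + w x

/-- The integrand `∑ a^{ij} D_i u conj (D_j v)`. -/
noncomputable def gradIntegrand (Ω : Set (EuclideanSpace ℝ (Fin n)))
    (a : Fin n → Fin n → EuclideanSpace ℝ (Fin n) → ℝ) (u v : L2 Ω)
    (x : EuclideanSpace ℝ (Fin n)) : ℂ :=
  ∑ i, ∑ j, (a i j x : ℂ) * weakDeriv Ω i u x * conj (weakDeriv Ω j v x)

/-- The integrand `ρ 𝔇^α u conj v`. -/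
noncomputable def fracIntegrand (Ω : Set (EuclideanSpace ℝ (Fin n)))
    (P : EuclideanSpace ℝ (Fin n)) (α : ℝ) (ρ : EuclideanSpace ℝ (Fin n) → ℝ) (u v : L2 Ω)
    (x : EuclideanSpace ℝ (Fin n)) : ℂ :=
  (ρ x : ℂ) * kipriyanov P α u x * conj (v x)

/-- `t` is the form `t[u,v] = ∫ a^{ij} D_i u conj (D_j v) + ∫ ρ 𝔇^α u conj v` with the domain
`H₀¹(Ω)`; the integrals are required to exist. -/
structure IsFormT (Ω : Set (EuclideanSpace ℝ (Fin n))) (P : EuclideanSpace ℝ (Fin n)) (α : ℝ)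
    (a : Fin n → Fin n → EuclideanSpace ℝ (Fin n) → ℝ) (ρ : EuclideanSpace ℝ (Fin n) → ℝ)
    (t : SesqForm (L2 Ω)) : Prop where
  domain_eq : (t.domain : Set (L2 Ω)) = sobolevH10 Ω
  integrable_grad : ∀ u v : t.domain,
    Integrable (gradIntegrand Ω a (u : L2 Ω) (v : L2 Ω)) (volume.restrict Ω)
  integrable_frac : ∀ u v : t.domain,
    Integrable (fracIntegrand Ω P α ρ (u : L2 Ω) (v : L2 Ω)) (volume.restrict Ω)
  apply_eq : ∀ u v : t.domain, t.toFun u v =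
    (∫ x in Ω, gradIntegrand Ω a (u : L2 Ω) (v : L2 Ω) x) +
      ∫ x in Ω, fracIntegrand Ω P α ρ (u : L2 Ω) (v : L2 Ω) x

end Operators

end Kipriyanov

/-! Everything rests on a functional-analytic principle applied to the norm `N` of `H₀¹(Ω)`
(`energyNorm`). Suppose that a form `t` is bounded with respect to `N`, that `Re t[u,u] + b ‖u‖² ≥ c
N(u)²` with `c > 0`, and that its domain is complete for `N`. Then `t` is sectorial and closed, and
so is its real part (`SesqForm.IsEnergy`). If an operator `T` satisfies `(T u, v) = t[u, v]` on a
subspace that is `N`-dense in the domain, then convergence in the graph of `T` forces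
`t`-convergence; therefore `T` is closable and the closure of the form of the closed operator is `t`
(`SesqForm.IsRepresentedOn`). Test functions lie in `H² ∩ H₀¹` and are `N`-dense in `H₀¹`, so no
boundary regularity for elliptic equations enters.

For `t` the only serious estimate is `‖𝔇^α u‖ ≤ C N(u)`. Extend `u` by zero and put `t = |Q - P| τ`.
The integral becomes `∫₀¹ τ^(n-1) (1-τ)^(-α-1) |Q-P|^(-α) (u(Q) - u(P + τ(Q-P))) dτ`, a
superposition of weighted differences between `u` and its dilations about `P`. By the integral
Minkowski inequality it suffices to bound each difference in `L₂`. For a ratio `σ ≥ 1`, integration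
of the radial derivative gives the bound `R^(1-α) (σ-1) ‖∇u‖`; ratios below one follow by a change
of variables. The weighted norm `‖ |Q-P|^(-α) u ‖` is controlled by a Hardy inequality: dilation by
`2` multiplies it by `2^(α-n/2) < 1`, because `α < 1 ≤ n/2`, so `u = (u - u∘dil) + u∘dil` can be
solved for it. What remains is a convergent Beta integral. Ellipticity then gives coercivity, since
the fractional term is at most `C N(u) ‖u‖` and Young's inequality absorbs it.

For `h` one needs in addition that `𝔇^α_{d-}(ρ ·)` exists on `H₀¹` and is adjoint to `ρ 𝔇^α`. With
`t = |Q - P| / τ` the truncated right-side derivative, boundary terms included, is exactly a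
truncated integral over dilation ratios of the zero extension (`rightDerivTrunc_eq`); it converges
in `L₂` because `ρ u` has differences of order `(σ-1)^λ` with `λ > α`. The adjoint relation
(`RadialHolder.integral_mul_leftIntegral`) comes from the change of variables `x ↦ P + τ(x-P)` for
each `τ`: the two kernels do not match on the diagonal, and the integral of their difference is
precisely the one that produces the constant `(n-1)!/Γ(n-α)` (`setIntegral_compensated`). -/

namespace Kipriyanov

/-! ### Bounded coercive forms -/

section AbstractForms

variable {H : Type*} [NormedAddCommGroup H] [InnerProductSpace ℂ H]

/-- The seminorm `N` on the domain of the form `t` dominates the norm of the Hilbert space, is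
complete, and `t` is bounded and, up to a multiple of the norm of the Hilbert space, coercive with
respect to `N`. -/
structure SesqForm.IsEnergy (t : SesqForm H) (N : Seminorm ℂ t.domain) : Prop where
  norm_le : ∀ u : t.domain, ‖(u : H)‖ ≤ N u
  bound : ∃ C : ℝ, 0 ≤ C ∧ ∀ u v : t.domain, ‖t.toFun u v‖ ≤ C * N u * N v
  coercive : ∃ c b : ℝ, 0 < c ∧ 0 ≤ b ∧
    ∀ u : t.domain, c * N u ^ 2 ≤ (t.toFun u u).re + b * ‖(u : H)‖ ^ 2
  complete : ∀ (s : ℕ → t.domain) (u : H), Tendsto (fun k => (s k : H)) atTop (𝓝 u) →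
    Tendsto (fun p : ℕ × ℕ => N (s p.1 - s p.2)) atTop (𝓝 0) →
    ∃ hu : u ∈ t.domain, Tendsto (fun k => N (s k - ⟨u, hu⟩)) atTop (𝓝 0)

namespace SesqForm.IsEnergy

variable {t : SesqForm H} {N : Seminorm ℂ t.domain}

theorem isSectorial (h : t.IsEnergy N) : t.IsSectorial := by
  obtain ⟨C, hC0, hC⟩ := h.bound
  obtain ⟨c, b, hc, hb, hco⟩ := h.coercive
  -- On unit vectors `Re t[u,u] + b ≥ c N(u)²` and `|Im t[u,u]| ≤ C N(u)²`, so with vertex `-b` the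
  -- tangent of the argument is at most `C / c`.
  refine ⟨-b, Real.arctan (C / c), Real.arctan_nonneg.2 (by positivity),
    Real.arctan_lt_pi_div_two _, fun u hu => ?_⟩
  set z : ℂ := t.toFun u u - ((-b : ℝ) : ℂ) with hz
  have hN : 0 < N u := by
    have := h.norm_le u
    rw [hu] at this
    linarith
  have hre : c * N u ^ 2 ≤ z.re := by
    have := hco u
    rw [hu] at this
    simp only [hz, Complex.sub_re, Complex.ofReal_re]
    linarith
  have him : |z.im| ≤ C * N u ^ 2 := by
    have h1 : z.im = (t.toFun u u).im := by simp [hz]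
    rw [h1]
    refine (Complex.abs_im_le_norm _).trans ((hC u u).trans (le_of_eq (by ring)))
  have hpos : 0 < z.re := lt_of_lt_of_le (by positivity) hre
  have h2 : |z.im / z.re| ≤ C / c := by
    rw [abs_div, abs_of_pos hpos, div_le_div_iff₀ hpos hc]
    calc |z.im| * c ≤ C * N u ^ 2 * c := by gcongr
      _ = C * (c * N u ^ 2) := by ring
      _ ≤ C * z.re := by gcongr
  have h3 : Complex.arg z = Real.arctan (z.im / z.re) := by
    have ha := Complex.tan_arg z
    rw [← ha, Real.arctan_tan]
    · exact (Complex.abs_arg_lt_pi_div_two_iff.2 (Or.inl hpos) |> abs_lt.1).1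
    · exact (Complex.abs_arg_lt_pi_div_two_iff.2 (Or.inl hpos) |> abs_lt.1).2
  rw [h3, abs_le, ← Real.arctan_neg]
  exact ⟨Real.arctan_mono (abs_le.1 h2).1, Real.arctan_mono (abs_le.1 h2).2⟩

/-- Coercivity in action: convergence of the form together with convergence in `H` is convergence in
`N`. It reduces every statement on `t`-convergence to one on the complete norm `N`. -/
theorem tendsto_seminorm (h : t.IsEnergy N) {ι : Type*} {l : Filter ι} {s : ι → t.domain}
    (h1 : Tendsto (fun k => (s k : H)) l (𝓝 0))
    (h2 : Tendsto (fun k => t.toFun (s k) (s k)) l (𝓝 0)) :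
    Tendsto (fun k => N (s k)) l (𝓝 0) := by
  obtain ⟨c, b, hc, hb, hco⟩ := h.coercive
  have h3 : Tendsto (fun k => c⁻¹ * ((t.toFun (s k) (s k)).re + b * ‖(s k : H)‖ ^ 2)) l
      (𝓝 0) := by
    have h4 := ((Complex.continuous_re.tendsto _).comp h2).add ((h1.norm.pow 2).const_mul b)
    simpa using h4.const_mul c⁻¹
  have h5 : Tendsto (fun k => N (s k) ^ 2) l (𝓝 0) := by
    refine squeeze_zero (fun k => by positivity) (fun k => ?_) h3
    rw [← div_eq_inv_mul, le_div_iff₀ hc, mul_comm]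
    exact hco (s k)
  have h6 := h5.sqrt
  simpa [Real.sqrt_sq (apply_nonneg N _)] using h6

theorem tendsto_form (h : t.IsEnergy N) {ι : Type*} {l : Filter ι} {s s' : ι → t.domain}
    {u v : t.domain} (hs : Tendsto (fun k => N (s k - u)) l (𝓝 0))
    (hs' : Tendsto (fun k => N (s' k - v)) l (𝓝 0)) :
    Tendsto (fun k => t.toFun (s k) (s' k)) l (𝓝 (t.toFun u v)) := by
  obtain ⟨C, hC0, hC⟩ := h.bound
  rw [tendsto_iff_norm_sub_tendsto_zero]
  have h1 : Tendsto (fun k => C * N (s k - u) * (N (s' k - v) + N v) + C * N u * N (s' k - v)) l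
      (𝓝 0) := by
    have := (hs.const_mul C).mul (hs'.add_const (N v)) |>.add (hs'.const_mul (C * N u))
    simpa using this
  refine squeeze_zero (fun k => norm_nonneg _) (fun k => ?_) h1
  have h2 : t.toFun (s k) (s' k) - t.toFun u v =
      t.toFun (s k - u) (s' k) + t.toFun u (s' k - v) := by
    simp
  have h3 : N (s' k) ≤ N (s' k - v) + N v := by
    simpa using map_add_le_add N (s' k - v) v
  rw [h2]
  refine (norm_add_le _ _).trans (add_le_add ((hC _ _).trans ?_) (hC _ _))
  gcongr

theorem exists_tendsto (h : t.IsEnergy N) {s : ℕ → t.domain} {u : H} (hs : t.ConvergesTo s u) :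
    ∃ hu : u ∈ t.domain, Tendsto (fun k => N (s k - ⟨u, hu⟩)) atTop (𝓝 0) := by
  refine h.complete s u hs.1 (h.tendsto_seminorm ?_ hs.2)
  have h1 := (hs.1.comp tendsto_fst).sub (hs.1.comp tendsto_snd)
  rw [prod_atTop_atTop_eq] at h1
  simpa using h1

theorem tendsto_form_self (h : t.IsEnergy N) {ι : Type*} {l : Filter ι} {s : ι → t.domain}
    (hs : Tendsto (fun k => N (s k)) l (𝓝 0)) :
    Tendsto (fun k => t.toFun (s k) (s k)) l (𝓝 0) := by
  have := h.tendsto_form (s := s) (s' := s) (u := 0) (v := 0) (by simpa using hs)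
    (by simpa using hs)
  simpa using this

theorem isClosed (h : t.IsEnergy N) : t.IsClosed := by
  intro s u hs
  obtain ⟨hu, h1⟩ := h.exists_tendsto hs
  exact ⟨hu, h.tendsto_form_self h1⟩

/-- The real part has the same domain and the same `Re t[u,u]`, and the bound is symmetric in its
two arguments. Hence `h` needs no estimates of its own. -/
theorem realPart (h : t.IsEnergy N) : t.realPart.IsEnergy (N : Seminorm ℂ t.domain) where
  norm_le := h.norm_le
  bound := by
    obtain ⟨C, hC0, hC⟩ := h.bound
    refine ⟨C, hC0, fun u v => ?_⟩
    have h1 : t.realPart.toFun u v =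
      (1 / 2 : ℂ) * (t.toFun u v + conj (t.toFun v u)) := rfl
    rw [h1, norm_mul]
    have h2 := norm_add_le (t.toFun u v) (conj (t.toFun v u))
    rw [RCLike.norm_conj] at h2
    have h3 := hC u v
    have h4 := hC v u
    have h5 : ‖(1 / 2 : ℂ)‖ = 1 / 2 := by simp
    rw [h5]
    have h6 : C * N v * N u = C * N u * N v := by ring
    have h7 : ‖t.toFun u v + conj (t.toFun v u)‖ ≤ 2 * (C * N u * N v) := by linarith
    refine (mul_le_mul_of_nonneg_left h7 (by norm_num)).trans (le_of_eq ?_)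
    rw [← mul_assoc]
    norm_num
    rfl
  coercive := by
    obtain ⟨c, b, hc, hb, hco⟩ := h.coercive
    refine ⟨c, b, hc, hb, fun u => ?_⟩
    have h1 : t.realPart.toFun u u =
      (1 / 2 : ℂ) * (t.toFun u u + conj (t.toFun u u)) := rfl
    have h2 : (t.realPart.toFun u u).re = (t.toFun u u).re := by
      rw [h1, Complex.add_conj]
      simp
    rw [h2]
    exact hco u
  complete := h.complete

theorem _root_.Kipriyanov.SesqForm.realPart_isSymmetric (t : SesqForm H) :
    t.realPart.IsSymmetric := by
  intro u v
  change (1 / 2 : ℂ) * (t.toFun u v + conj (t.toFun v u)) =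
    conj ((1 / 2 : ℂ) * (t.toFun v u + conj (t.toFun u v)))
  simp [add_comm, Complex.conj_ofNat]

end SesqForm.IsEnergy

/-- The operator `T` represents the form `t` on a part of the domain of `t` that is a core with
respect to the seminorm `N`. -/
structure SesqForm.IsRepresentedOn (t : SesqForm H) (N : Seminorm ℂ t.domain) (T : H →ₗ.[ℂ] H) :
    Prop where
  domain_le : T.domain ≤ t.domain
  inner_eq : ∀ (u : T.domain) (v : t.domain),
    ⟪(v : H), T u⟫_ℂ = t.toFun (Submodule.inclusion domain_le u) v
  core : ∀ v : t.domain, ∃ s : ℕ → T.domain,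
    Tendsto (fun k => N (Submodule.inclusion domain_le (s k) - v)) atTop (𝓝 0)

namespace SesqForm.IsRepresentedOn

variable {t : SesqForm H} {N : Seminorm ℂ t.domain} {T : H →ₗ.[ℂ] H}

/-- If `uₖ` and `T uₖ` both converge, then `t[uₖ-uₘ, uₖ-uₘ] = (T(uₖ-uₘ), uₖ-uₘ)` tends to zero. So
graph limits stay in the form domain, and the representation passes to the limit. -/
theorem of_mem_closure_graph (hN : t.IsEnergy N) (h : t.IsRepresentedOn N T) {p : H × H}
    (hp : p ∈ T.graph.topologicalClosure) :
    ∃ hu : p.1 ∈ t.domain, ∀ v : t.domain, ⟪(v : H), p.2⟫_ℂ = t.toFun ⟨p.1, hu⟩ v := by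
  rw [← SetLike.mem_coe, Submodule.topologicalClosure_coe, mem_closure_iff_seq_limit] at hp
  obtain ⟨q, hq, hqp⟩ := hp
  have hq' : ∀ k, ∃ u : T.domain, (u : H) = (q k).1 ∧ T u = (q k).2 := fun k =>
    (LinearPMap.mem_graph_iff T).1 (hq k)
  choose u hu1 hu2 using hq'
  have h1 : Tendsto (fun k => (u k : H)) atTop (𝓝 p.1) := by
    simp_rw [hu1]; exact (continuous_fst.tendsto p).comp hqp
  have h2 : Tendsto (fun k => T (u k)) atTop (𝓝 p.2) := by
    simp_rw [hu2]; exact (continuous_snd.tendsto p).comp hqp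
  have h3 : t.ConvergesTo (fun k => Submodule.inclusion h.domain_le (u k)) p.1 := by
    refine ⟨h1, ?_⟩
    have h4 := (h1.comp tendsto_fst).sub (h1.comp tendsto_snd)
    have h5 := (h2.comp tendsto_fst).sub (h2.comp tendsto_snd)
    rw [prod_atTop_atTop_eq] at h4 h5
    have h6 := Filter.Tendsto.inner (𝕜 := ℂ) h4 h5
    simp only [sub_self, inner_zero_left] at h6
    refine h6.congr fun r => ?_
    have := h.inner_eq (u r.1 - u r.2) (Submodule.inclusion h.domain_le (u r.1 - u r.2))
    rw [map_sub, LinearPMap.map_sub] at this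
    exact this
  obtain ⟨hu, h4⟩ := hN.exists_tendsto h3
  refine ⟨hu, fun v => ?_⟩
  have h5 := hN.tendsto_form (s' := fun _ => v) (v := v) h4 (by simp)
  have h6 := Filter.Tendsto.inner (𝕜 := ℂ) (tendsto_const_nhds (x := (v : H))) h2
  refine tendsto_nhds_unique h6 (h5.congr fun k => ?_)
  exact (h.inner_eq (u k) v).symm

/-- A graph limit `(0, w)` satisfies `(w, v) = t[0, v] = 0` for every `v` in the form domain; the
hypothesis `hd` expresses the density of that domain. -/
theorem isClosable (hN : t.IsEnergy N) (h : t.IsRepresentedOn N T)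
    (hd : ∀ w : H, (∀ v : t.domain, ⟪(v : H), w⟫_ℂ = 0) → w = 0) : T.IsClosable := by
  refine ⟨T.graph.topologicalClosure.toLinearPMap, (Submodule.toLinearPMap_graph_eq _ ?_).symm⟩
  rintro ⟨x, w⟩ hp hx
  obtain ⟨hu, h1⟩ := h.of_mem_closure_graph hN hp
  refine hd w fun v => ?_
  rw [h1 v]
  have : (⟨(x, w).1, hu⟩ : t.domain) = 0 := Subtype.ext hx
  rw [this]
  simp

theorem closure_inner_eq (hN : t.IsEnergy N) (h : t.IsRepresentedOn N T) (hT : T.IsClosable)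
    (u : T.closure.domain) :
    ∃ hu : (u : H) ∈ t.domain, ∀ v : t.domain, ⟪(v : H), T.closure u⟫_ℂ = t.toFun ⟨u, hu⟩ v := by
  have h1 : ((u : H), T.closure u) ∈ T.graph.topologicalClosure := by
    rw [hT.graph_closure_eq_closure_graph]
    exact LinearPMap.mem_graph _ u
  exact h.of_mem_closure_graph hN h1

theorem isClosureOf (hN : t.IsEnergy N) (h : t.IsRepresentedOn N T) (hT : T.IsClosable) :
    t.IsClosureOf (operatorForm T.closure) := by
  have hle : (operatorForm T.closure).domain ≤ t.domain := fun u hu =>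
    (h.closure_inner_eq hN hT ⟨u, hu⟩).1
  have heq : ∀ u v : (operatorForm T.closure).domain,
      t.toFun (Submodule.inclusion hle u) (Submodule.inclusion hle v) =
        (operatorForm T.closure).toFun u v := fun u v =>
    ((h.closure_inner_eq hN hT u).2 (Submodule.inclusion hle v)).symm
  have hconv : ∀ (s : ℕ → (operatorForm T.closure).domain) (u : H),
      (operatorForm T.closure).ConvergesTo s u →
        t.ConvergesTo (fun k => Submodule.inclusion hle (s k)) u := by
    intro s u hs
    refine ⟨hs.1, hs.2.congr fun p => ?_⟩
    rw [← heq, map_sub]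
  -- The required closed sectorial extension is `t` itself. The core of `T` lies in the domain of
  -- its closure, so it approximates every vector of the form domain; in the other direction `t` is
  -- closed.
  refine ⟨⟨t, hN.isSectorial, hN.isClosed, hle, heq⟩, fun u => ⟨fun hu => ?_, ?_⟩, ?_⟩
  · obtain ⟨s, hs⟩ := h.core ⟨u, hu⟩
    have hdom : T.domain ≤ T.closure.domain := T.le_closure.1
    refine ⟨fun k => Submodule.inclusion hdom (s k), ?_, ?_⟩
    · rw [tendsto_iff_norm_sub_tendsto_zero]
      refine squeeze_zero (fun k => norm_nonneg _) (fun k => ?_) hs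
      exact hN.norm_le (Submodule.inclusion h.domain_le (s k) - ⟨u, hu⟩)
    · have h1 : Tendsto (fun p : ℕ × ℕ => N (Submodule.inclusion h.domain_le (s p.1) -
          Submodule.inclusion h.domain_le (s p.2))) atTop (𝓝 0) := by
        have h2 := (hs.comp tendsto_fst).add (hs.comp tendsto_snd)
        rw [prod_atTop_atTop_eq] at h2
        rw [add_zero] at h2
        refine squeeze_zero (fun k => apply_nonneg N _) (fun p => ?_) h2
        have h3 := map_add_le_add N (Submodule.inclusion h.domain_le (s p.1) - ⟨u, hu⟩)
          (⟨u, hu⟩ - Submodule.inclusion h.domain_le (s p.2))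
        rw [sub_add_sub_cancel] at h3
        rwa [map_sub_rev N ⟨u, hu⟩] at h3
      refine (hN.tendsto_form_self h1).congr fun p => ?_
      rw [← heq]
      rfl
  · rintro ⟨s, hs⟩
    exact (hN.exists_tendsto (hconv s u hs)).1
  · intro u v s s' hs hs'
    obtain ⟨hu, h1⟩ := hN.exists_tendsto (hconv s u hs)
    obtain ⟨hv, h2⟩ := hN.exists_tendsto (hconv s' v hs')
    exact (hN.tendsto_form h1 h2).congr fun k => heq _ _

end SesqForm.IsRepresentedOn

end AbstractForms

/-! ### Beta integrals -/

section Beta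

theorem betaIntegrand_ofReal {a b τ : ℝ} (h : τ ∈ Set.Ioo (0 : ℝ) 1) :
    ((τ : ℂ) ^ ((a : ℂ) - 1) * (1 - (τ : ℂ)) ^ ((b : ℂ) - 1)) =
      ((τ ^ (a - 1) * (1 - τ) ^ (b - 1) : ℝ) : ℂ) := by
  rw [Complex.ofReal_mul, Complex.ofReal_cpow h.1.le, Complex.ofReal_cpow (by linarith [h.2])]
  push_cast
  rfl

theorem integrableOn_beta {a b : ℝ} (ha : 0 < a) (hb : 0 < b) :
    IntegrableOn (fun τ : ℝ => τ ^ (a - 1) * (1 - τ) ^ (b - 1)) (Set.Ioo 0 1) := by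
  have h := Complex.betaIntegral_convergent (u := (a : ℂ)) (v := (b : ℂ)) (by simpa) (by simpa)
  rw [intervalIntegrable_iff_integrableOn_Ioo_of_le zero_le_one] at h
  refine (h.re).congr ?_
  filter_upwards [ae_restrict_mem measurableSet_Ioo] with τ hτ
  rw [betaIntegrand_ofReal hτ]
  simp

theorem setIntegral_beta {a b : ℝ} (ha : 0 < a) (hb : 0 < b) :
    ∫ τ in Set.Ioo (0 : ℝ) 1, τ ^ (a - 1) * (1 - τ) ^ (b - 1) =
      Real.Gamma a * Real.Gamma b / Real.Gamma (a + b) := by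
  have h := ProbabilityTheory.beta_eq_betaIntegralReal a b ha hb
  rw [ProbabilityTheory.beta] at h
  rw [h, Complex.betaIntegral, intervalIntegral.integral_of_le zero_le_one,
    integral_Ioc_eq_integral_Ioo, setIntegral_congr_fun (g := fun τ : ℝ =>
      ((τ ^ (a - 1) * (1 - τ) ^ (b - 1) : ℝ) : ℂ)) measurableSet_Ioo
      fun τ hτ => betaIntegrand_ofReal hτ, integral_complex_ofReal, Complex.ofReal_re]

theorem rpow_sub_pow_eq {α : ℝ} {m : ℕ} {τ : ℝ} (h : 0 < τ) :
    τ ^ (α - 1) - τ ^ m = τ ^ (α - 1) * (1 - τ ^ ((m : ℝ) + 1 - α)) := by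
  rw [mul_sub, mul_one, ← Real.rpow_add h]
  congr 1
  rw [← Real.rpow_natCast]
  congr 1
  ring

theorem one_sub_rpow_nonneg_le {p τ : ℝ} (hp : 1 ≤ p) (h : τ ∈ Set.Ioo (0 : ℝ) 1) :
    0 ≤ 1 - τ ^ p ∧ 1 - τ ^ p ≤ p * (1 - τ) := by
  have h1 := one_add_mul_self_le_rpow_one_add (s := τ - 1) (by linarith [h.1]) hp
  have h2 := Real.rpow_le_one h.1.le h.2.le (by linarith : 0 ≤ p)
  rw [add_sub_cancel] at h1
  constructor <;> linarith

theorem rpow_neg_sub_one {α x : ℝ} (h : 0 < x) : x ^ (-α - 1) * x = x ^ (-α) := by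
  conv_lhs => rw [← Real.rpow_one x]
  rw [Real.rpow_one, ← Real.rpow_add_one h.ne']
  congr 1; ring

/-- Neither power alone is integrable against `(1-τ)^(-α-1)` at `τ = 1`. Their difference vanishes
there to first order, by Bernoulli's inequality, and a Beta integrand with parameters `α` and `1 -
α` dominates. -/
theorem integrableOn_compensated {α : ℝ} (hα0 : 0 < α) (hα1 : α < 1) {m : ℕ} (hm : 1 ≤ m) :
    IntegrableOn (fun τ : ℝ => (τ ^ (α - 1) - τ ^ m) * (1 - τ) ^ (-α - 1)) (Set.Ioo 0 1) := by
  have h := (integrableOn_beta hα0 (sub_pos.2 hα1)).const_mul ((m : ℝ) + 1 - α)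
  refine Integrable.mono' h ?_ ?_
  · refine ContinuousOn.aestronglyMeasurable (fun τ hτ => ContinuousAt.continuousWithinAt ?_)
      measurableSet_Ioo
    have h1 : τ ≠ 0 := hτ.1.ne'
    have h2 : 1 - τ ≠ 0 := (sub_pos.2 hτ.2).ne'
    fun_prop (disch := simp [h1, h2])
  · filter_upwards [ae_restrict_mem measurableSet_Ioo] with τ hτ
    have hm' : (1 : ℝ) ≤ m := by exact_mod_cast hm
    have h3 := one_sub_rpow_nonneg_le (p := (m : ℝ) + 1 - α) (by linarith) hτ
    have h4 : 0 < 1 - τ := sub_pos.2 hτ.2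
    have h5 := hτ.1
    rw [rpow_sub_pow_eq hτ.1, Real.norm_of_nonneg (by have := h3.1; positivity)]
    calc τ ^ (α - 1) * (1 - τ ^ ((m : ℝ) + 1 - α)) * (1 - τ) ^ (-α - 1)
        ≤ τ ^ (α - 1) * (((m : ℝ) + 1 - α) * (1 - τ)) * (1 - τ) ^ (-α - 1) := by
          gcongr; exact h3.2
      _ = ((m : ℝ) + 1 - α) * (τ ^ (α - 1) * (1 - τ) ^ (1 - α - 1)) := by
          have := rpow_neg_sub_one (α := α) h4
          rw [show 1 - α - 1 = -α by ring, ← this]; ring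

/-- Integration by parts, as the two divergent pieces cannot be evaluated separately: it leaves
`m/α` times the Beta integral with parameters `m` and `1 - α`. For `m = n - 1`, after multiplication
by `α/Γ(1-α)`, the value is the coefficient `(n-1)!/Γ(n-α)` of the Kipriyanov derivative. -/
theorem setIntegral_compensated {α : ℝ} (hα0 : 0 < α) (hα1 : α < 1) {m : ℕ} (hm : 1 ≤ m) :
    ∫ τ in Set.Ioo (0 : ℝ) 1, (τ ^ (α - 1) - τ ^ m) * (1 - τ) ^ (-α - 1) =
      Real.Gamma (1 - α) * m.factorial / (α * Real.Gamma ((m : ℝ) + 1 - α)) := by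
  have hm' : (1 : ℝ) ≤ m := by exact_mod_cast hm
  have hm0 : (0 : ℝ) < m := by linarith
  -- The boundary term of the integration by parts: `(1-τ)^(-α)/α` is the primitive of
  -- `(1-τ)^(-α-1)`. It vanishes at both ends.
  set g : ℝ → ℝ := fun τ => (τ ^ α - τ ^ m) * (1 - τ) ^ (-α) / α with hg
  have hI := integrableOn_compensated hα0 hα1 hm
  have hJ := integrableOn_beta hm0 (sub_pos.2 hα1)
  have hderiv : ∀ τ ∈ Set.Ioo (0 : ℝ) 1, HasDerivAt g
      ((τ ^ (α - 1) - τ ^ m) * (1 - τ) ^ (-α - 1) -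
        m / α * (τ ^ ((m : ℝ) - 1) * (1 - τ) ^ (1 - α - 1))) τ := by
    intro τ hτ
    have h0 : τ ≠ 0 := hτ.1.ne'
    have h1 : 0 < 1 - τ := sub_pos.2 hτ.2
    have d1 : HasDerivAt (fun τ : ℝ => τ ^ α) (α * τ ^ (α - 1)) τ :=
      Real.hasDerivAt_rpow_const (Or.inl h0)
    have d2 : HasDerivAt (fun τ : ℝ => τ ^ m) (m * τ ^ (m - 1)) τ := hasDerivAt_pow m τ
    have d3 : HasDerivAt (fun τ : ℝ => (1 - τ) ^ (-α)) (-1 * (-α) * (1 - τ) ^ (-α - 1)) τ :=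
      ((hasDerivAt_id τ).const_sub 1).rpow_const (Or.inl h1.ne')
    have d4 := ((d1.sub d2).mul d3).div_const α
    refine HasDerivAt.congr_deriv (f := g) d4 ?_
    have e1 : τ ^ ((m : ℝ) - 1) = τ ^ (m - 1) := by
      rw [← Real.rpow_natCast, Nat.cast_sub hm, Nat.cast_one]
    have e2 : τ ^ m = τ ^ (m - 1) * τ := by
      rw [← pow_succ, Nat.sub_add_cancel hm]
    have e3 : τ ^ α = τ ^ (α - 1) * τ := by
      rw [← Real.rpow_add_one h0]; congr 1; ring
    have e4 : (1 - τ) ^ (1 - α - 1) = (1 - τ) ^ (-α - 1) * (1 - τ) := by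
      rw [rpow_neg_sub_one h1]; congr 1; ring
    have e5 : (1 - τ) ^ (-α) = (1 - τ) ^ (-α - 1) * (1 - τ) := (rpow_neg_sub_one h1).symm
    simp only [Pi.sub_apply]
    rw [e1, e4, e5, e3]
    rw [show τ ^ m = τ ^ (m - 1) * τ from e2]
    field_simp
    ring
  have hlim0 : Tendsto g (𝓝[>] 0) (𝓝 0) := by
    have hc : ContinuousAt g 0 := by
      have h1 : (1 : ℝ) - 0 ≠ 0 := by norm_num
      refine ContinuousAt.div_const (ContinuousAt.mul ?_ ?_) _
      · exact ((Real.continuousAt_rpow_const _ _ (Or.inr hα0.le))).sub (continuousAt_id.pow m)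
      · exact (continuousAt_const.sub continuousAt_id).rpow_const (Or.inl h1)
    have h2 : g 0 = 0 := by
      have hm1 : m ≠ 0 := by omega
      simp [hg, Real.zero_rpow hα0.ne', hm1]
    have h3 := hc.tendsto
    rw [h2] at h3
    exact h3.mono_left nhdsWithin_le_nhds
  have hlim1 : Tendsto g (𝓝[<] 1) (𝓝 0) := by
    have h1 : Tendsto (fun τ : ℝ => τ ^ (α - 1) * τ * (((m : ℝ) + 1 - α) * (1 - τ) ^ (1 - α)) / α)
        (𝓝[<] 1) (𝓝 0) := by
      have hc : ContinuousAt (fun τ : ℝ =>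
          τ ^ (α - 1) * τ * (((m : ℝ) + 1 - α) * (1 - τ) ^ (1 - α)) / α) 1 := by
        refine ContinuousAt.div_const (ContinuousAt.mul (ContinuousAt.mul ?_ continuousAt_id)
          (continuousAt_const.mul ?_)) _
        · exact Real.continuousAt_rpow_const _ _ (Or.inl one_ne_zero)
        · exact (continuousAt_const.sub continuousAt_id).rpow_const (Or.inr (by linarith))
      have h2 := hc.tendsto
      simp only [sub_self, Real.zero_rpow (sub_pos.2 hα1).ne', mul_zero, zero_div] at h2
      exact h2.mono_left nhdsWithin_le_nhds
    have hev : ∀ᶠ τ in 𝓝[<] (1 : ℝ), τ ∈ Set.Ioo (0 : ℝ) 1 := Ioo_mem_nhdsLT one_pos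
    have hrw : ∀ τ ∈ Set.Ioo (0 : ℝ) 1,
        g τ = τ ^ (α - 1) * τ * (1 - τ ^ ((m : ℝ) - α)) * (1 - τ) ^ (-α) / α := by
      intro τ hτ
      have e3 : τ ^ α = τ ^ (α - 1) * τ := by
        rw [← Real.rpow_add_one hτ.1.ne']; congr 1; ring
      have e4 : τ ^ m = τ ^ α * τ ^ ((m : ℝ) - α) := by
        rw [← Real.rpow_add hτ.1, ← Real.rpow_natCast]; congr 1; ring
      simp only [hg]
      rw [e4, ← e3]
      ring
    -- For `m = 1` the exponent `m - α` is below one and Bernoulli's inequality is not available in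
    -- this direction; comparison with the larger exponent `m + 1 - α` repairs this.
    have hb : ∀ τ ∈ Set.Ioo (0 : ℝ) 1, 0 ≤ 1 - τ ^ ((m : ℝ) - α) ∧
        1 - τ ^ ((m : ℝ) - α) ≤ ((m : ℝ) + 1 - α) * (1 - τ) := by
      intro τ hτ
      have h3 := one_sub_rpow_nonneg_le (p := (m : ℝ) + 1 - α) (by linarith) hτ
      have h4 : τ ^ ((m : ℝ) + 1 - α) ≤ τ ^ ((m : ℝ) - α) :=
        Real.rpow_le_rpow_of_exponent_ge hτ.1 hτ.2.le (by linarith)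
      refine ⟨?_, by linarith [h3.2]⟩
      have := Real.rpow_le_one hτ.1.le hτ.2.le (by linarith : 0 ≤ (m : ℝ) - α)
      linarith
    refine squeeze_zero' ?_ ?_ h1
    · filter_upwards [hev] with τ hτ
      rw [hrw τ hτ]
      have := (hb τ hτ).1
      have h4 : 0 < 1 - τ := sub_pos.2 hτ.2
      have h5 := hτ.1
      positivity
    · filter_upwards [hev] with τ hτ
      rw [hrw τ hτ]
      have h4 : 0 < 1 - τ := sub_pos.2 hτ.2
      have h5 := hτ.1
      have e5 : (1 - τ) ^ (1 - α) = (1 - τ) ^ (-α) * (1 - τ) := by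
        rw [← Real.rpow_add_one h4.ne']; congr 1; ring
      rw [e5]
      calc τ ^ (α - 1) * τ * (1 - τ ^ ((m : ℝ) - α)) * (1 - τ) ^ (-α) / α
          ≤ τ ^ (α - 1) * τ * (((m : ℝ) + 1 - α) * (1 - τ)) * (1 - τ) ^ (-α) / α := by
            gcongr; exact (hb τ hτ).2
        _ = _ := by ring
  have hint : IntegrableOn (fun τ : ℝ => (τ ^ (α - 1) - τ ^ m) * (1 - τ) ^ (-α - 1) -
        m / α * (τ ^ ((m : ℝ) - 1) * (1 - τ) ^ (1 - α - 1))) (Set.Ioo 0 1) :=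
    hI.sub (hJ.const_mul _)
  have hftc := intervalIntegral.integral_eq_sub_of_hasDerivAt_of_tendsto zero_lt_one hderiv
    ((intervalIntegrable_iff_integrableOn_Ioo_of_le zero_le_one).2 hint) hlim0 hlim1
  rw [intervalIntegral.integral_of_le zero_le_one, integral_Ioc_eq_integral_Ioo,
    integral_sub hI (hJ.const_mul _), integral_const_mul, setIntegral_beta hm0 (sub_pos.2 hα1),
    sub_self, sub_eq_zero] at hftc
  rw [hftc, ← Real.Gamma_nat_eq_factorial, Real.Gamma_add_one hm0.ne',
    show (m : ℝ) + (1 - α) = (m : ℝ) + 1 - α by ring]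
  field_simp

end Beta

/-! ### The integral Minkowski inequality -/

section Minkowski

open scoped ENNReal

theorem eLpNorm_two_sq {X ε : Type*} [MeasurableSpace X] [TopologicalSpace ε] [ContinuousENorm ε]
    (μ : Measure X) (f : X → ε) : eLpNorm f 2 μ ^ 2 = ∫⁻ x, ‖f x‖ₑ ^ 2 ∂μ := by
  rw [eLpNorm_eq_lintegral_rpow_enorm_toReal two_ne_zero ENNReal.ofNat_ne_top, ← ENNReal.rpow_natCast,
    ← ENNReal.rpow_mul]
  simp

/-- The integral Minkowski inequality for the exponent `2`. -/
theorem eLpNorm_lintegral_le {X Y : Type*} [MeasurableSpace X] [MeasurableSpace Y]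
    (μ : Measure X) (ν : Measure Y) [SFinite μ] [SFinite ν] {Δ : X → Y → ℝ≥0∞}
    (hΔ : Measurable (Function.uncurry Δ)) :
    eLpNorm (fun x => ∫⁻ y, Δ x y ∂ν) 2 μ ≤ ∫⁻ y, eLpNorm (fun x => Δ x y) 2 μ ∂ν := by
  have hm1 : ∀ x, Measurable (Δ x) := fun x => hΔ.comp measurable_prodMk_left
  have hm2 : ∀ y, Measurable (fun x => Δ x y) := fun y => hΔ.comp measurable_prodMk_right
  have hI : Measurable fun x => ∫⁻ y, Δ x y ∂ν := hΔ.lintegral_prod_right'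
  set N : Y → ℝ≥0∞ := fun y => eLpNorm (fun x => Δ x y) 2 μ with hN
  have hNm : Measurable N := by
    have h1 : N = fun y => (∫⁻ x, Δ x y ^ 2 ∂μ) ^ (1 / 2 : ℝ) := by
      funext y
      simp [hN, eLpNorm_eq_lintegral_rpow_enorm_toReal]
    rw [h1]
    exact ((hΔ.pow_const 2).lintegral_prod_left').pow_const _
  have hCS : ∀ y y', ∫⁻ x, Δ x y * Δ x y' ∂μ ≤ N y * N y' := by
    intro y y'
    have := ENNReal.lintegral_mul_le_Lp_mul_Lq μ Real.HolderConjugate.two_two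
      (hm2 y).aemeasurable (hm2 y').aemeasurable
    refine this.trans (le_of_eq ?_)
    simp [hN, eLpNorm_eq_lintegral_rpow_enorm_toReal]
  -- The square of the inner integral is written as a double integral over `y, y'`, Tonelli brings
  -- the `x` integral inside, and Cauchy-Schwarz applies to each pair. No division by a norm occurs,
  -- so infinite values are harmless.
  have key : ∫⁻ x, (∫⁻ y, Δ x y ∂ν) ^ 2 ∂μ ≤ (∫⁻ y, N y ∂ν) ^ 2 := by
    calc ∫⁻ x, (∫⁻ y, Δ x y ∂ν) ^ 2 ∂μ
        = ∫⁻ x, ∫⁻ y, Δ x y * ∫⁻ y', Δ x y' ∂ν ∂ν ∂μ := by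
          refine lintegral_congr fun x => ?_
          rw [lintegral_mul_const _ (hm1 x), sq]
      _ = ∫⁻ y, ∫⁻ x, Δ x y * ∫⁻ y', Δ x y' ∂ν ∂μ ∂ν := by
          refine lintegral_lintegral_swap (Measurable.aemeasurable ?_)
          exact hΔ.mul (hI.comp measurable_fst)
      _ = ∫⁻ y, ∫⁻ y', ∫⁻ x, Δ x y * Δ x y' ∂μ ∂ν ∂ν := by
          refine lintegral_congr fun y => ?_
          rw [lintegral_lintegral_swap]
          · refine lintegral_congr fun x => ?_
            rw [lintegral_const_mul _ (hm1 x)]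
          · exact (((hm2 y).comp measurable_snd).mul (hΔ.comp measurable_swap)).aemeasurable
      _ ≤ ∫⁻ y, ∫⁻ y', N y * N y' ∂ν ∂ν :=
          lintegral_mono fun y => lintegral_mono fun y' => hCS y y'
      _ = (∫⁻ y, N y ∂ν) ^ 2 := by
          simp_rw [lintegral_const_mul _ hNm]
          rw [lintegral_mul_const _ hNm, sq]
  have h2 := eLpNorm_two_sq μ fun x => ∫⁻ y, Δ x y ∂ν
  simp only [enorm_eq_self] at h2
  rw [← h2] at key
  exact (ENNReal.pow_le_pow_left_iff two_ne_zero).1 key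

end Minkowski

/-! ### Dilations -/

section Dilation

variable {n : ℕ}

/-- The dilation with center `P` and ratio `σ`. -/
noncomputable def dil (P : EuclideanSpace ℝ (Fin n)) (σ : ℝ) (x : EuclideanSpace ℝ (Fin n)) :
    EuclideanSpace ℝ (Fin n) :=
  P + σ • (x - P)

variable (P : EuclideanSpace ℝ (Fin n))

theorem dil_sub (σ : ℝ) (x : EuclideanSpace ℝ (Fin n)) : dil P σ x - P = σ • (x - P) := by
  simp [dil]

theorem norm_dil_sub {σ : ℝ} (hσ : 0 ≤ σ) (x : EuclideanSpace ℝ (Fin n)) :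
    ‖dil P σ x - P‖ = σ * ‖x - P‖ := by
  rw [dil_sub, norm_smul, Real.norm_of_nonneg hσ]

theorem dil_dil (a b : ℝ) (x : EuclideanSpace ℝ (Fin n)) :
    dil P a (dil P b x) = dil P (a * b) x := by
  simp [dil, smul_smul]

@[simp]
theorem dil_one (x : EuclideanSpace ℝ (Fin n)) : dil P 1 x = x := by
  simp [dil]

theorem continuous_dil_uncurry :
    Continuous fun p : EuclideanSpace ℝ (Fin n) × ℝ => dil P p.2 p.1 := by
  unfold dil
  fun_prop

theorem continuous_dil (σ : ℝ) : Continuous (dil P σ) := by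
  unfold dil
  fun_prop

theorem measurableEmbedding_dil {σ : ℝ} (hσ : 0 < σ) : MeasurableEmbedding (dil P σ) := by
  have h1 : dil P σ = (Homeomorph.addLeft P) ∘ (Homeomorph.smulOfNeZero σ hσ.ne') ∘
      (Homeomorph.subRight P) := by
    funext x; simp [dil]
  rw [h1]
  exact (Homeomorph.addLeft P).measurableEmbedding.comp
    ((Homeomorph.smulOfNeZero σ hσ.ne').measurableEmbedding.comp
      (Homeomorph.subRight P).measurableEmbedding)

theorem map_dil {σ : ℝ} (hσ : 0 < σ) :
    Measure.map (dil P σ) volume = ENNReal.ofReal (σ ^ (-(n : ℝ))) • volume := by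
  have h1 : dil P σ = (fun x => P + x) ∘ (fun x => σ • x) ∘ (fun x => x - P) := by
    funext x; simp [dil]
  rw [h1, ← Measure.map_map (by fun_prop) (by fun_prop),
    ← Measure.map_map (by fun_prop) (by fun_prop),
    (measurePreserving_sub_right volume P).map_eq, Measure.map_addHaar_smul volume hσ.ne',
    Measure.map_smul, (measurePreserving_add_left volume P).map_eq]
  congr 2
  rw [finrank_euclideanSpace_fin, abs_of_nonneg (by positivity), Real.rpow_neg hσ.le,
    Real.rpow_natCast]

theorem quasiMeasurePreserving_dil {σ : ℝ} (hσ : 0 < σ) :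
    Measure.QuasiMeasurePreserving (dil P σ) volume volume :=
  ⟨(continuous_dil P σ).measurable, by
    rw [map_dil P hσ]; exact Measure.AbsolutelyContinuous.rfl.smul_left _⟩

theorem integral_comp_dil {F : Type*} [NormedAddCommGroup F] [NormedSpace ℝ F] {σ : ℝ}
    (hσ : 0 < σ) (f : EuclideanSpace ℝ (Fin n) → F) :
    ∫ x, f (dil P σ x) = σ ^ (-(n : ℝ)) • ∫ x, f x := by
  rw [← (measurableEmbedding_dil P hσ).integral_map, map_dil P hσ, integral_smul_measure,
    ENNReal.toReal_ofReal (by positivity)]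

theorem lintegral_comp_dil {σ : ℝ} (hσ : 0 < σ) (f : EuclideanSpace ℝ (Fin n) → ENNReal) :
    ∫⁻ x, f (dil P σ x) = ENNReal.ofReal (σ ^ (-(n : ℝ))) * ∫⁻ x, f x := by
  rw [← (measurableEmbedding_dil P hσ).lintegral_map, map_dil P hσ, lintegral_smul_measure,
    smul_eq_mul]

theorem eLpNorm_comp_dil {ε : Type*} [TopologicalSpace ε] [ContinuousENorm ε] {σ : ℝ}
    (hσ : 0 < σ) (f : EuclideanSpace ℝ (Fin n) → ε) :
    eLpNorm (fun x => f (dil P σ x)) 2 volume =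
      ENNReal.ofReal (σ ^ (-(n : ℝ) / 2)) * eLpNorm f 2 volume := by
  have h : eLpNorm (fun x => f (dil P σ x)) 2 volume ^ 2 =
      (ENNReal.ofReal (σ ^ (-(n : ℝ) / 2)) * eLpNorm f 2 volume) ^ 2 := by
    rw [mul_pow, eLpNorm_two_sq, eLpNorm_two_sq, lintegral_comp_dil P hσ fun x => ‖f x‖ₑ ^ 2,
      ← ENNReal.ofReal_pow (by positivity), ← Real.rpow_mul_natCast hσ.le]
    congr 3
    push_cast
    ring
  exact le_antisymm ((ENNReal.pow_le_pow_left_iff two_ne_zero).1 h.le)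
    ((ENNReal.pow_le_pow_left_iff two_ne_zero).1 h.ge)

/-- A property that holds almost everywhere holds almost everywhere on almost every ray, for
measurable parametrizations of the dilation ratio. -/
theorem ae_ae_dil {p : EuclideanSpace ℝ (Fin n) → Prop} (hp : ∀ᵐ x, p x) {κ : ℝ → ℝ}
    (hκ : Measurable κ) {s : Set ℝ} (hs : MeasurableSet s) (hpos : ∀ τ ∈ s, 0 < κ τ) :
    ∀ᵐ x, ∀ᵐ τ ∂(volume.restrict s), p (dil P (κ τ) x) := by
  -- A measurable null superset makes the exceptional set jointly measurable. Then the quantifiers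
  -- can be exchanged, and for a fixed ratio the dilation preserves null sets.
  obtain ⟨t, htp, ht, htn⟩ := exists_measurable_superset_of_null (ae_iff.1 hp)
  have hmeas : MeasurableSet {q : EuclideanSpace ℝ (Fin n) × ℝ | dil P (κ q.2) q.1 ∈ t} := by
    have h1 : Measurable fun q : EuclideanSpace ℝ (Fin n) × ℝ => dil P (κ q.2) q.1 :=
      (continuous_dil_uncurry P).measurable.comp
        (measurable_fst.prodMk (hκ.comp measurable_snd))
    exact h1 ht
  have h2 : ∀ᵐ x, ∀ᵐ τ ∂(volume.restrict s), dil P (κ τ) x ∉ t := by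
    refine (Measure.ae_ae_comm (p := fun x τ => dil P (κ τ) x ∉ t) hmeas.compl).2 ?_
    filter_upwards [ae_restrict_mem hs] with τ hτ
    exact (quasiMeasurePreserving_dil P (hpos τ hτ)).ae (p := fun y => y ∉ t)
      (measure_eq_zero_iff_ae_notMem.1 htn)
  filter_upwards [h2] with x hx
  filter_upwards [hx] with τ hτ
  by_contra hc
  exact hτ (htp hc)

end Dilation

/-! ### Weighted dilation differences and the Hardy inequality -/

section DilationDifference

open scoped ENNReal

variable {n : ℕ}

/-- The gradient sum `∑ |∂ᵢ φ|`. -/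
noncomputable def gradSum (φ : EuclideanSpace ℝ (Fin n) → ℂ) (x : EuclideanSpace ℝ (Fin n)) : ℝ :=
  ∑ i, ‖partialDeriv i φ x‖

theorem norm_fderiv_apply_le (φ : EuclideanSpace ℝ (Fin n) → ℂ) (x v : EuclideanSpace ℝ (Fin n)) :
    ‖fderiv ℝ φ x v‖ ≤ ‖v‖ * gradSum φ x := by
  have h1 : v = ∑ i, v i • EuclideanSpace.single i (1 : ℝ) := by
    have := (EuclideanSpace.basisFun (Fin n) ℝ).sum_repr v
    simpa using this.symm
  have h2 : fderiv ℝ φ x v = ∑ i, v i • partialDeriv i φ x := by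
    conv_lhs => rw [h1]
    simp [map_sum, partialDeriv]
  rw [h2, gradSum, Finset.mul_sum]
  refine norm_sum_le_of_le _ fun i _ => ?_
  rw [norm_smul]
  gcongr
  exact PiLp.norm_apply_le v i

theorem continuous_partialDeriv {φ : EuclideanSpace ℝ (Fin n) → ℂ} (hφ : ContDiff ℝ ∞ φ)
    (i : Fin n) : Continuous (partialDeriv i φ) := by
  have := hφ.continuous_fderiv (by simp)
  unfold partialDeriv
  fun_prop

theorem continuous_gradSum {φ : EuclideanSpace ℝ (Fin n) → ℂ} (hφ : ContDiff ℝ ∞ φ) :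
    Continuous (gradSum φ) := by
  have := continuous_partialDeriv hφ
  unfold gradSum
  fun_prop

theorem gradSum_nonneg (φ : EuclideanSpace ℝ (Fin n) → ℂ) (x : EuclideanSpace ℝ (Fin n)) :
    0 ≤ gradSum φ x :=
  Finset.sum_nonneg fun _ _ => norm_nonneg _

theorem partialDeriv_eq_zero {φ : EuclideanSpace ℝ (Fin n) → ℂ} {x : EuclideanSpace ℝ (Fin n)}
    (hx : x ∉ tsupport φ) (i : Fin n) : partialDeriv i φ x = 0 := by
  have h : fderiv ℝ φ x = 0 := by
    by_contra hc
    exact hx (support_fderiv_subset ℝ (f := φ) hc)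
  simp [partialDeriv, h]

theorem gradSum_eq_zero {φ : EuclideanSpace ℝ (Fin n) → ℂ} {x : EuclideanSpace ℝ (Fin n)}
    (hx : x ∉ tsupport φ) : gradSum φ x = 0 := by
  simp [gradSum, partialDeriv_eq_zero hx]

variable (P : EuclideanSpace ℝ (Fin n)) (α : ℝ)

/-- The product of a function with the weight `|x - P| ^ (-α)`. -/
noncomputable def weighted (F : EuclideanSpace ℝ (Fin n) → ℂ) (x : EuclideanSpace ℝ (Fin n)) : ℂ :=
  ((‖x - P‖ ^ (-α) : ℝ) : ℂ) * F x

/-- The weighted difference of a function and its dilation. -/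
noncomputable def dilDiff (F : EuclideanSpace ℝ (Fin n) → ℂ) (σ : ℝ)
    (x : EuclideanSpace ℝ (Fin n)) : ℂ :=
  weighted P α (fun y => F y - F (dil P σ y)) x

variable {P α}

theorem norm_weighted (F : EuclideanSpace ℝ (Fin n) → ℂ) (x : EuclideanSpace ℝ (Fin n)) :
    ‖weighted P α F x‖ = ‖x - P‖ ^ (-α) * ‖F x‖ := by
  rw [weighted, norm_mul, Complex.norm_real, Real.norm_of_nonneg (by positivity)]

theorem norm_dilDiff (F : EuclideanSpace ℝ (Fin n) → ℂ) (σ : ℝ) (x : EuclideanSpace ℝ (Fin n)) :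
    ‖dilDiff P α F σ x‖ = ‖x - P‖ ^ (-α) * ‖F x - F (dil P σ x)‖ :=
  norm_weighted _ x

theorem measurable_weight : Measurable fun x : EuclideanSpace ℝ (Fin n) =>
    ((‖x - P‖ ^ (-α) : ℝ) : ℂ) := by
  fun_prop

theorem measurable_weighted {F : EuclideanSpace ℝ (Fin n) → ℂ} (hF : Measurable F) :
    Measurable (weighted P α F) :=
  measurable_weight.mul hF

theorem measurable_dilDiff {F : EuclideanSpace ℝ (Fin n) → ℂ} (hF : Measurable F) (σ : ℝ) :
    Measurable (dilDiff P α F σ) :=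
  measurable_weighted (hF.sub (hF.comp (continuous_dil P σ).measurable))

theorem measurable_dilDiff_uncurry {F : EuclideanSpace ℝ (Fin n) → ℂ} (hF : Measurable F)
    {κ : ℝ → ℝ} (hκ : Measurable κ) :
    Measurable fun q : EuclideanSpace ℝ (Fin n) × ℝ => dilDiff P α F (κ q.2) q.1 := by
  have h1 : Measurable fun q : EuclideanSpace ℝ (Fin n) × ℝ => dil P (κ q.2) q.1 :=
    (continuous_dil_uncurry P).measurable.comp (measurable_fst.prodMk (hκ.comp measurable_snd))
  exact (measurable_weight.comp measurable_fst).mul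
    ((hF.comp measurable_fst).sub (hF.comp h1))

/-- The weight is homogeneous of degree `-α` and the volume scales by `σ^(-n)`. For `n ≥ 2` and `α <
1` the exponent is negative, so outward dilations contract the weighted norm. -/
theorem eLpNorm_weighted_comp_dil {σ : ℝ} (hσ : 0 < σ) (F : EuclideanSpace ℝ (Fin n) → ℂ) :
    eLpNorm (weighted P α fun x => F (dil P σ x)) 2 volume =
      ENNReal.ofReal (σ ^ (α - (n : ℝ) / 2)) * eLpNorm (weighted P α F) 2 volume := by
  have h1 : (weighted P α fun x => F (dil P σ x)) =
      (σ ^ α : ℝ) • fun x => weighted P α F (dil P σ x) := by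
    funext x
    simp only [weighted, Pi.smul_apply, norm_dil_sub P hσ.le, Complex.real_smul]
    rw [Real.mul_rpow hσ.le (norm_nonneg _), ← mul_assoc, ← Complex.ofReal_mul, ← mul_assoc,
      ← Real.rpow_add hσ]
    simp
  rw [h1, eLpNorm_const_smul, eLpNorm_comp_dil P hσ, ← mul_assoc,
    Real.enorm_of_nonneg (by positivity), ← ENNReal.ofReal_mul (by positivity), ← Real.rpow_add hσ]
  congr 4
  ring

theorem eLpNorm_dilDiff_le (hn : 2 ≤ n) (hα1 : α < 1) {σ : ℝ} (hσ : 1 ≤ σ)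
    {F : EuclideanSpace ℝ (Fin n) → ℂ} (hF : Measurable F) :
    eLpNorm (dilDiff P α F σ) 2 volume ≤ 2 * eLpNorm (weighted P α F) 2 volume := by
  have hn' : (2 : ℝ) ≤ n := by exact_mod_cast hn
  have h1 : dilDiff P α F σ = weighted P α F - weighted P α fun x => F (dil P σ x) := by
    funext x
    simp [dilDiff, weighted, mul_sub]
  rw [h1, two_mul]
  refine (eLpNorm_sub_le (measurable_weighted hF).aestronglyMeasurable
    (measurable_weighted (hF.comp (continuous_dil P σ).measurable)).aestronglyMeasurable
    one_le_two).trans (add_le_add le_rfl ?_)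
  change eLpNorm (weighted P α fun x => F (dil P σ x)) 2 volume ≤ _
  rw [eLpNorm_weighted_comp_dil (by linarith)]
  refine mul_le_of_le_one_left zero_le ?_
  rw [← ENNReal.ofReal_one]
  exact ENNReal.ofReal_le_ofReal (Real.rpow_le_one_of_one_le_of_nonpos hσ (by linarith))

/-- The dilation difference for a ratio `τ` in terms of the one for `τ⁻¹`. -/
theorem eLpNorm_dilDiff_inv {τ : ℝ} (hτ : 0 < τ) (F : EuclideanSpace ℝ (Fin n) → ℂ) :
    eLpNorm (dilDiff P α F τ) 2 volume =
      ENNReal.ofReal (τ ^ (α - (n : ℝ) / 2)) * eLpNorm (dilDiff P α F τ⁻¹) 2 volume := by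
  rw [show dilDiff P α F τ⁻¹ = weighted P α fun y => F y - F (dil P τ⁻¹ y) from rfl,
    ← eLpNorm_weighted_comp_dil hτ]
  refine eLpNorm_congr_norm_ae (Eventually.of_forall fun x => ?_)
  simp only [norm_weighted, norm_dilDiff, dil_dil, inv_mul_cancel₀ hτ.ne', dil_one]
  rw [norm_sub_rev (F x)]

/-- Fundamental theorem of calculus in the ratio `τ`: the derivative of `φ(P + τ(x-P))` carries a
factor `|x-P|`, which against the weight leaves `|x-P|^(1-α)`. Where the gradient is nonzero, `|x-P|
≤ τ|x-P| ≤ R` because `τ ≥ 1`; this is why outward ratios are treated. -/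
theorem norm_dilDiff_le_of_contDiff {φ : EuclideanSpace ℝ (Fin n) → ℂ} (hφ : ContDiff ℝ ∞ φ)
    {R : ℝ} (hR : ∀ x ∈ tsupport φ, ‖x - P‖ ≤ R) (hα1 : α < 1) {σ : ℝ} (hσ : 1 ≤ σ)
    (x : EuclideanSpace ℝ (Fin n)) :
    ‖dilDiff P α φ σ x‖ₑ ≤
      ∫⁻ τ in Set.Ioc 1 σ, ‖R ^ (1 - α) * gradSum φ (dil P τ x)‖ₑ := by
  have hd : ∀ τ, HasDerivAt (fun τ => φ (dil P τ x)) (fderiv ℝ φ (dil P τ x) (x - P)) τ := by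
    intro τ
    have h1 : HasDerivAt (fun τ : ℝ => dil P τ x) (x - P) τ := by
      have := ((hasDerivAt_id τ).smul_const (x - P)).const_add P
      simpa [dil] using this
    exact ((hφ.differentiable (by simp)).differentiableAt.hasFDerivAt).comp_hasDerivAt τ h1
  have hc : Continuous fun τ : ℝ => fderiv ℝ φ (dil P τ x) (x - P) := by
    have h1 := hφ.continuous_fderiv (by simp)
    have h2 : Continuous fun τ : ℝ => dil P τ x := by unfold dil; fun_prop
    exact (h1.comp h2).clm_apply continuous_const
  have hftc : ∫ τ in (1 : ℝ)..σ, fderiv ℝ φ (dil P τ x) (x - P) = φ (dil P σ x) - φ x := by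
    rw [intervalIntegral.integral_eq_sub_of_hasDerivAt (fun τ _ => hd τ)
      (hc.intervalIntegrable _ _), dil_one]
  have h3 : dilDiff P α φ σ x = -∫ τ in Set.Ioc 1 σ,
      ((‖x - P‖ ^ (-α) : ℝ) : ℂ) * fderiv ℝ φ (dil P τ x) (x - P) := by
    rw [integral_const_mul, ← intervalIntegral.integral_of_le hσ, hftc]
    simp only [dilDiff, weighted]
    ring
  rw [h3, enorm_neg]
  refine (enorm_integral_le_lintegral_enorm _).trans (setLIntegral_mono' measurableSet_Ioc ?_)
  intro τ hτ
  rw [enorm_le_iff_norm_le, norm_mul, Complex.norm_real, Real.norm_of_nonneg (by positivity)]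
  by_cases hs : dil P τ x ∈ tsupport φ
  · have hr : ‖x - P‖ ≤ R := by
      have h4 := hR _ hs
      rw [norm_dil_sub P (by linarith [hτ.1])] at h4
      nlinarith [norm_nonneg (x - P), hτ.1]
    have hR0 : 0 ≤ R := (norm_nonneg _).trans hr
    have h5 : ‖x - P‖ ^ (-α) * ‖x - P‖ ≤ R ^ (1 - α) := by
      rcases (norm_nonneg (x - P)).eq_or_lt with h0 | h0
      · rw [← h0, mul_zero]; positivity
      · rw [← Real.rpow_add_one h0.ne', neg_add_eq_sub]
        exact Real.rpow_le_rpow h0.le hr (by linarith)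
    have hg := gradSum_nonneg φ (dil P τ x)
    rw [Real.norm_of_nonneg (by positivity)]
    calc ‖x - P‖ ^ (-α) * ‖fderiv ℝ φ (dil P τ x) (x - P)‖
        ≤ ‖x - P‖ ^ (-α) * (‖x - P‖ * gradSum φ (dil P τ x)) := by
          gcongr; exact norm_fderiv_apply_le _ _ _
      _ = (‖x - P‖ ^ (-α) * ‖x - P‖) * gradSum φ (dil P τ x) := by ring
      _ ≤ _ := by gcongr
  · have h6 := norm_fderiv_apply_le φ (dil P τ x) (x - P)
    rw [gradSum_eq_zero hs, mul_zero] at h6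
    rw [le_antisymm h6 (norm_nonneg _), mul_zero]
    exact norm_nonneg _

/-- Minkowski's inequality applied to the pointwise bound; an outward dilation does not increase the
`L₂` norm, so each `τ` contributes the same constant and the interval has length `σ - 1`. -/
theorem eLpNorm_dilDiff_le_of_contDiff {φ : EuclideanSpace ℝ (Fin n) → ℂ} (hφ : ContDiff ℝ ∞ φ)
    {R : ℝ} (hR0 : 0 ≤ R) (hR : ∀ x ∈ tsupport φ, ‖x - P‖ ≤ R) (hα1 : α < 1) {σ : ℝ}
    (hσ : 1 ≤ σ) :
    eLpNorm (dilDiff P α φ σ) 2 volume ≤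
      ENNReal.ofReal (R ^ (1 - α) * (σ - 1)) * eLpNorm (gradSum φ) 2 volume := by
  have hg := continuous_gradSum hφ
  have hm : Measurable (Function.uncurry fun (x : EuclideanSpace ℝ (Fin n)) (τ : ℝ) =>
      ‖R ^ (1 - α) * gradSum φ (dil P τ x)‖ₑ) :=
    (continuous_const.mul (hg.comp (continuous_dil_uncurry P))).measurable.enorm
  calc eLpNorm (dilDiff P α φ σ) 2 volume
      ≤ eLpNorm (fun x => ∫⁻ τ in Set.Ioc 1 σ, ‖R ^ (1 - α) * gradSum φ (dil P τ x)‖ₑ) 2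
          volume := eLpNorm_mono_enorm fun x => by
            rw [enorm_eq_self]; exact norm_dilDiff_le_of_contDiff hφ hR hα1 hσ x
    _ ≤ ∫⁻ τ in Set.Ioc 1 σ, eLpNorm (fun x => ‖R ^ (1 - α) * gradSum φ (dil P τ x)‖ₑ) 2
          volume := eLpNorm_lintegral_le _ _ hm
    _ ≤ ∫⁻ _ in Set.Ioc 1 σ, ENNReal.ofReal (R ^ (1 - α)) * eLpNorm (gradSum φ) 2 volume := by
        refine setLIntegral_mono' measurableSet_Ioc fun τ hτ => ?_
        have hτ0 : 0 < τ := by linarith [hτ.1]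
        rw [eLpNorm_enorm]
        have h1 := eLpNorm_const_smul (R ^ (1 - α)) (fun x => gradSum φ (dil P τ x)) 2 volume
        have h2 : ((R ^ (1 - α)) • fun x => gradSum φ (dil P τ x)) =
          fun x => R ^ (1 - α) * gradSum φ (dil P τ x) := rfl
        rw [h2] at h1
        rw [h1, Real.enorm_of_nonneg (by positivity), eLpNorm_comp_dil P hτ0]
        gcongr
        refine mul_le_of_le_one_left zero_le ?_
        rw [← ENNReal.ofReal_one]
        refine ENNReal.ofReal_le_ofReal (Real.rpow_le_one_of_one_le_of_nonpos hτ.1.le ?_)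
        have : (0 : ℝ) ≤ n := n.cast_nonneg
        linarith
    _ = _ := by
        rw [lintegral_const, Measure.restrict_apply_univ, Real.volume_Ioc,
          ENNReal.ofReal_mul (by positivity)]
        ring

/-- Hardy's inequality by absorption: `F` is its difference with the dilation by `2` plus that
dilation, whose weighted norm is smaller by the factor `2^(α-n/2) < 1`. Moving this term to the left
needs the norm to be finite beforehand. -/
theorem eLpNorm_weighted_le_dilDiff (hn : 2 ≤ n) (hα1 : α < 1)
    {F : EuclideanSpace ℝ (Fin n) → ℂ} (hF : Measurable F)
    (hfin : eLpNorm (weighted P α F) 2 volume ≠ ⊤) :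
    eLpNorm (weighted P α F) 2 volume ≤
      ENNReal.ofReal ((1 - 2 ^ (α - (n : ℝ) / 2))⁻¹) * eLpNorm (dilDiff P α F 2) 2 volume := by
  have hn' : (2 : ℝ) ≤ n := by exact_mod_cast hn
  have h1 : weighted P α F = dilDiff P α F 2 + weighted P α fun x => F (dil P 2 x) := by
    funext x
    simp [dilDiff, weighted, mul_sub]
  have h2 : eLpNorm (weighted P α F) 2 volume ≤ eLpNorm (dilDiff P α F 2) 2 volume +
      ENNReal.ofReal (2 ^ (α - (n : ℝ) / 2)) * eLpNorm (weighted P α F) 2 volume := by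
    conv_lhs => rw [h1]
    rw [← eLpNorm_weighted_comp_dil two_pos]
    exact eLpNorm_add_le (measurable_dilDiff hF 2).aestronglyMeasurable
      (measurable_weighted (hF.comp (continuous_dil P 2).measurable)).aestronglyMeasurable
      one_le_two
  have hq0 : (0 : ℝ) ≤ 2 ^ (α - (n : ℝ) / 2) := by positivity
  have hq1 : (2 : ℝ) ^ (α - (n : ℝ) / 2) < 1 :=
    Real.rpow_lt_one_of_one_lt_of_neg one_lt_two (by linarith)
  have hpos : 0 < 1 - (2 : ℝ) ^ (α - (n : ℝ) / 2) := sub_pos.2 hq1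
  by_cases hD : eLpNorm (dilDiff P α F 2) 2 volume = ⊤
  · rw [hD, ENNReal.mul_top]
    · exact le_top
    · simpa using hpos
  · rw [← ENNReal.ofReal_toReal hfin, ← ENNReal.ofReal_toReal hD,
      ← ENNReal.ofReal_mul (by positivity)] at h2 ⊢
    rw [← ENNReal.ofReal_add (by positivity) (by positivity),
      ENNReal.ofReal_le_ofReal_iff (by positivity)] at h2
    refine ENNReal.ofReal_le_ofReal ?_
    rw [inv_mul_eq_div, le_div_iff₀ hpos]
    linarith

/-- Supplies the finiteness for the absorption: the weight is bounded on a support that stays away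
from `P`. -/
theorem eLpNorm_weighted_ne_top {φ : EuclideanSpace ℝ (Fin n) → ℂ} (hα0 : 0 ≤ α)
    (hφ : Continuous φ) (hc : HasCompactSupport φ) (hP : P ∉ tsupport φ) :
    eLpNorm (weighted P α φ) 2 volume ≠ ⊤ := by
  obtain ⟨δ, hδ, hball⟩ := Metric.isOpen_iff.1 (isClosed_tsupport φ).isOpen_compl P hP
  have h1 : ∀ x, ‖weighted P α φ x‖ ≤ δ ^ (-α) * ‖φ x‖ := by
    intro x
    rw [norm_weighted]
    by_cases hx : φ x = 0
    · simp [hx]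
    · have h2 : δ ≤ ‖x - P‖ := by
        by_contra hlt
        refine hball (mem_ball_iff_norm.2 (not_le.1 hlt)) (subset_tsupport φ hx)
      exact mul_le_mul_of_nonneg_right (Real.rpow_le_rpow_of_nonpos hδ h2 (by linarith))
        (norm_nonneg _)
  have h3 : MemLp φ 2 volume := hφ.memLp_of_hasCompactSupport hc
  refine (lt_of_le_of_lt (eLpNorm_le_mul_eLpNorm_of_ae_le_mul (Eventually.of_forall h1) 2) ?_).ne
  exact ENNReal.mul_lt_top ENNReal.ofReal_lt_top h3.2

end DilationDifference

/-! ### Fractional integrals of functions with Hölder dilation differences -/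

section RadialHolder

open scoped ENNReal

variable {n : ℕ}

/-- A function whose weighted dilation differences are controlled in `L₂` by the power `κ` of the
distance of the ratio to `1`. -/
structure RadialHolder (P : EuclideanSpace ℝ (Fin n)) (α κ : ℝ)
    (F : EuclideanSpace ℝ (Fin n) → ℂ) (C : ℝ≥0∞) : Prop where
  measurable : Measurable F
  weighted_le : eLpNorm (weighted P α F) 2 volume ≤ C
  dilDiff_le : ∀ τ ∈ Set.Ioo (0 : ℝ) 1,
    eLpNorm (dilDiff P α F τ⁻¹) 2 volume ≤ C * ENNReal.ofReal ((1 - τ) ^ κ)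

/-- The kernel of the left-side derivative in terms of the dilation ratio. -/
noncomputable def leftKernel (n : ℕ) (α τ : ℝ) : ℝ := τ ^ (n - 1) * (1 - τ) ^ (-α - 1)

/-- The kernel of the right-side derivative in terms of the inverse dilation ratio. -/
noncomputable def rightKernel (α τ : ℝ) : ℝ := τ ^ (α - 1) * (1 - τ) ^ (-α - 1)

/-- The Kipriyanov integrand after `t = |x-P| τ`. The factor `|x-P|^(-α)` that leaves the kernel is
the weight inside `dilDiff`. -/
noncomputable def leftIntegrand (P : EuclideanSpace ℝ (Fin n)) (α : ℝ)
    (F : EuclideanSpace ℝ (Fin n) → ℂ) (x : EuclideanSpace ℝ (Fin n)) (τ : ℝ) : ℂ :=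
  (leftKernel n α τ : ℂ) * dilDiff P α F τ x

/-- The right-side integrand after `t = |x-P| / τ`: the kernel contributes `τ^(α+1)` and the
Jacobian `τ^(-2)`, whence the power `α - 1`. Both derivatives are thereby integrals over `0 < τ <
1`. -/
noncomputable def rightIntegrand (P : EuclideanSpace ℝ (Fin n)) (α : ℝ)
    (F : EuclideanSpace ℝ (Fin n) → ℂ) (x : EuclideanSpace ℝ (Fin n)) (τ : ℝ) : ℂ :=
  (rightKernel α τ : ℂ) * dilDiff P α F τ⁻¹ x

noncomputable def leftIntegral (P : EuclideanSpace ℝ (Fin n)) (α : ℝ)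
    (F : EuclideanSpace ℝ (Fin n) → ℂ) (x : EuclideanSpace ℝ (Fin n)) : ℂ :=
  ∫ τ in Set.Ioo 0 1, leftIntegrand P α F x τ

noncomputable def rightIntegral (P : EuclideanSpace ℝ (Fin n)) (α : ℝ)
    (F : EuclideanSpace ℝ (Fin n) → ℂ) (x : EuclideanSpace ℝ (Fin n)) : ℂ :=
  ∫ τ in Set.Ioo 0 1, rightIntegrand P α F x τ

/-- The Beta integral that bounds the left-side and right-side integrals. -/
noncomputable def betaConst (α κ : ℝ) : ℝ≥0∞ :=
  ∫⁻ τ in Set.Ioo (0 : ℝ) 1, ENNReal.ofReal (τ ^ (α - 1) * (1 - τ) ^ (κ - α - 1))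

theorem betaConst_ne_top {α κ : ℝ} (hα : 0 < α) (hκ : α < κ) : betaConst α κ ≠ ⊤ :=
  (integrableOn_beta hα (sub_pos.2 hκ)).lintegral_lt_top.ne

theorem measurable_leftKernel (n : ℕ) (α : ℝ) : Measurable (leftKernel n α) := by
  unfold leftKernel; fun_prop

theorem measurable_rightKernel (α : ℝ) : Measurable (rightKernel α) := by
  unfold rightKernel; fun_prop

theorem leftKernel_nonneg {n : ℕ} {α τ : ℝ} (h : τ ∈ Set.Ioo (0 : ℝ) 1) : 0 ≤ leftKernel n α τ := by
  have h1 : 0 < 1 - τ := sub_pos.2 h.2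
  have h2 := h.1
  unfold leftKernel; positivity

theorem rightKernel_nonneg {α τ : ℝ} (h : τ ∈ Set.Ioo (0 : ℝ) 1) : 0 ≤ rightKernel α τ := by
  have h1 : 0 < 1 - τ := sub_pos.2 h.2
  have h2 := h.1
  unfold rightKernel; positivity

section Kernel

variable {Δ : EuclideanSpace ℝ (Fin n) → ℝ → ℂ} {K : ℝ≥0∞}

theorem ae_integrableOn_of_eLpNorm_lintegral (hΔ : Measurable (Function.uncurry Δ))
    (hK : K ≠ ⊤) (h : eLpNorm (fun x => ∫⁻ τ in Set.Ioo 0 1, ‖Δ x τ‖ₑ) 2 volume ≤ K) :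
    ∀ᵐ x, IntegrableOn (Δ x) (Set.Ioo 0 1) := by
  have hm : Measurable fun x => ∫⁻ τ in Set.Ioo 0 1, ‖Δ x τ‖ₑ := hΔ.enorm.lintegral_prod_right'
  have h1 : eLpNorm (fun x => ∫⁻ τ in Set.Ioo 0 1, ‖Δ x τ‖ₑ) 2 volume ^ 2 ≠ ⊤ :=
    ENNReal.pow_ne_top (ne_top_of_le_ne_top hK h)
  rw [eLpNorm_two_sq] at h1
  filter_upwards [ae_lt_top (by fun_prop) h1] with x hx
  rw [enorm_eq_self] at hx
  refine ⟨(hΔ.comp measurable_prodMk_left).aestronglyMeasurable, ?_⟩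
  rw [HasFiniteIntegral]
  by_contra hc
  rw [not_lt, top_le_iff] at hc
  simp [hc] at hx

theorem memLp_integral_of_eLpNorm_lintegral (hΔ : Measurable (Function.uncurry Δ))
    (hK : K ≠ ⊤) (h : eLpNorm (fun x => ∫⁻ τ in Set.Ioo 0 1, ‖Δ x τ‖ₑ) 2 volume ≤ K) :
    MemLp (fun x => ∫ τ in Set.Ioo 0 1, Δ x τ) 2 volume ∧
      eLpNorm (fun x => ∫ τ in Set.Ioo 0 1, Δ x τ) 2 volume ≤ K := by
  have h1 : eLpNorm (fun x => ∫ τ in Set.Ioo 0 1, Δ x τ) 2 volume ≤ K := by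
    refine le_trans (eLpNorm_mono_enorm fun x => ?_) h
    rw [enorm_eq_self]
    exact enorm_integral_le_lintegral_enorm _
  exact ⟨⟨hΔ.stronglyMeasurable.integral_prod_right.aestronglyMeasurable,
    lt_of_le_of_lt h1 hK.lt_top⟩, h1⟩

/-- Cauchy-Schwarz in `x` after integrating absolute values in `τ`. It justifies Fubini's theorem in
the fractional integration by parts. -/
theorem integrable_mul_of_eLpNorm_lintegral (hΔ : Measurable (Function.uncurry Δ))
    (hK : K ≠ ⊤) (h : eLpNorm (fun x => ∫⁻ τ in Set.Ioo 0 1, ‖Δ x τ‖ₑ) 2 volume ≤ K)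
    {g : EuclideanSpace ℝ (Fin n) → ℂ} (hg : Measurable g) (hg2 : MemLp g 2 volume) :
    Integrable (Function.uncurry fun x τ => g x * Δ x τ)
      ((volume : Measure (EuclideanSpace ℝ (Fin n))).prod (volume.restrict (Set.Ioo 0 1))) := by
  have hm : Measurable fun x => ∫⁻ τ in Set.Ioo 0 1, ‖Δ x τ‖ₑ := hΔ.enorm.lintegral_prod_right'
  have hmeas : Measurable (Function.uncurry fun x τ => g x * Δ x τ) :=
    (hg.comp measurable_fst).mul hΔ
  refine ⟨hmeas.aestronglyMeasurable, ?_⟩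
  rw [HasFiniteIntegral, lintegral_prod _ hmeas.enorm.aemeasurable]
  have h1 : ∀ x, ∫⁻ τ in Set.Ioo 0 1, ‖Function.uncurry (fun x τ => g x * Δ x τ) (x, τ)‖ₑ =
      ‖g x‖ₑ * ∫⁻ τ in Set.Ioo 0 1, ‖Δ x τ‖ₑ := by
    intro x
    simp only [Function.uncurry, enorm_mul]
    exact lintegral_const_mul _ (hΔ.comp measurable_prodMk_left).enorm
  simp_rw [h1]
  have h2 := ENNReal.lintegral_mul_le_Lp_mul_Lq volume Real.HolderConjugate.two_two
    hg.enorm.aemeasurable hm.aemeasurable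
  refine lt_of_le_of_lt h2 (ENNReal.mul_lt_top ?_ ?_)
  · have := hg2.2
    rw [eLpNorm_eq_lintegral_rpow_enorm_toReal two_ne_zero ENNReal.ofNat_ne_top] at this
    simpa using this
  · have := lt_of_le_of_lt h hK.lt_top
    rw [eLpNorm_eq_lintegral_rpow_enorm_toReal two_ne_zero ENNReal.ofNat_ne_top] at this
    simpa using this

end Kernel

variable {P : EuclideanSpace ℝ (Fin n)} {α κ : ℝ} {F : EuclideanSpace ℝ (Fin n) → ℂ} {C : ℝ≥0∞}

/-- Only ratios close to one need a genuine estimate. For `τ ≥ 1/2`, `τ⁻¹ - 1 ≤ 2(1-τ)` and `2^κ ≤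
2` give the term `2B`; for `τ < 1/2` the triangle inequality costs `2A`, and `1 ≤ 2(1-τ)^κ` costs
another factor two. -/
theorem RadialHolder.of_le (hn : 2 ≤ n) (hα1 : α < 1) (hκ0 : 0 < κ) (hκ1 : κ ≤ 1)
    (hF : Measurable F) {B A : ℝ≥0∞} (hA : eLpNorm (weighted P α F) 2 volume ≤ A)
    (hB : ∀ σ ∈ Set.Ioc (1 : ℝ) 2,
      eLpNorm (dilDiff P α F σ) 2 volume ≤ B * ENNReal.ofReal ((σ - 1) ^ κ)) :
    RadialHolder P α κ F (2 * B + 4 * A) where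
  measurable := hF
  weighted_le := hA.trans (le_add_left (le_mul_of_one_le_left zero_le (by norm_num)))
  dilDiff_le := by
    intro τ hτ
    have h1 : 0 < 1 - τ := sub_pos.2 hτ.2
    have h0 := hτ.1
    rcases le_or_gt (1 / 2) τ with h | h
    · have h2 : τ⁻¹ - 1 ≤ 2 * (1 - τ) := by
        rw [inv_eq_one_div, div_sub_one h0.ne', div_le_iff₀ h0]
        nlinarith
      have h3 : 1 < τ⁻¹ := (one_lt_inv₀ h0).2 hτ.2
      have h4 : τ⁻¹ ≤ 2 := by
        rw [inv_le_comm₀ h0 two_pos]; linarith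
      have h5 : (τ⁻¹ - 1) ^ κ ≤ 2 * (1 - τ) ^ κ := by
        calc (τ⁻¹ - 1) ^ κ ≤ (2 * (1 - τ)) ^ κ :=
              Real.rpow_le_rpow (by linarith) h2 hκ0.le
          _ = 2 ^ κ * (1 - τ) ^ κ := Real.mul_rpow (by norm_num) h1.le
          _ ≤ 2 ^ (1 : ℝ) * (1 - τ) ^ κ := by
              gcongr
              · norm_num
          _ = _ := by rw [Real.rpow_one]
      refine (hB _ ⟨h3, h4⟩).trans ?_
      calc B * ENNReal.ofReal ((τ⁻¹ - 1) ^ κ)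
          ≤ B * ENNReal.ofReal (2 * (1 - τ) ^ κ) := by gcongr
        _ = 2 * B * ENNReal.ofReal ((1 - τ) ^ κ) := by
            rw [ENNReal.ofReal_mul (by norm_num), ENNReal.ofReal_ofNat]; ring
        _ ≤ _ := by gcongr; exact le_self_add
    · have h3 : 1 ≤ τ⁻¹ := (one_le_inv₀ h0).2 hτ.2.le
      have h5 : (1 : ℝ) ≤ 2 * (1 - τ) ^ κ := by
        have : (1 - τ) ^ (1 : ℝ) ≤ (1 - τ) ^ κ :=
          Real.rpow_le_rpow_of_exponent_ge h1 (by linarith) hκ1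
        rw [Real.rpow_one] at this
        linarith
      have h6 : (1 : ℝ≥0∞) ≤ 2 * ENNReal.ofReal ((1 - τ) ^ κ) := by
        rw [← ENNReal.ofReal_one, ← ENNReal.ofReal_ofNat 2, ← ENNReal.ofReal_mul (by norm_num)]
        exact ENNReal.ofReal_le_ofReal h5
      calc eLpNorm (dilDiff P α F τ⁻¹) 2 volume ≤ 2 * A :=
            (eLpNorm_dilDiff_le hn hα1 h3 hF).trans (by gcongr)
        _ = 2 * A * 1 := by rw [mul_one]
        _ ≤ 2 * A * (2 * ENNReal.ofReal ((1 - τ) ^ κ)) := by gcongr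
        _ = 4 * A * ENNReal.ofReal ((1 - τ) ^ κ) := by ring
        _ ≤ _ := by gcongr; exact le_add_self

namespace RadialHolder

theorem measurable_leftIntegrand (h : RadialHolder P α κ F C) :
    Measurable (Function.uncurry (leftIntegrand P α F)) := by
  have h1 : Measurable fun q : EuclideanSpace ℝ (Fin n) × ℝ => (leftKernel n α q.2 : ℂ) :=
    Complex.measurable_ofReal.comp ((measurable_leftKernel n α).comp measurable_snd)
  have h2 := measurable_dilDiff_uncurry (P := P) (α := α) h.measurable (κ := fun τ => τ)
    measurable_id
  exact h1.mul h2

theorem measurable_rightIntegrand (h : RadialHolder P α κ F C) :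
    Measurable (Function.uncurry (rightIntegrand P α F)) := by
  have h1 : Measurable fun q : EuclideanSpace ℝ (Fin n) × ℝ => (rightKernel α q.2 : ℂ) :=
    Complex.measurable_ofReal.comp ((measurable_rightKernel α).comp measurable_snd)
  have h2 := measurable_dilDiff_uncurry (P := P) (α := α) h.measurable (κ := fun τ => τ⁻¹)
    measurable_inv
  exact h1.mul h2

/-- Minkowski's inequality reduces this to the kernel times `(1-τ)^κ`, a Beta integrand with
parameters `α` and `κ - α`. The condition `α < κ` makes it converge. -/
theorem eLpNorm_lintegral_right_le (h : RadialHolder P α κ F C) :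
    eLpNorm (fun x => ∫⁻ τ in Set.Ioo 0 1, ‖rightIntegrand P α F x τ‖ₑ) 2 volume ≤
      C * betaConst α κ := by
  refine (eLpNorm_lintegral_le volume (volume.restrict (Set.Ioo 0 1))
    (Δ := fun x τ => ‖rightIntegrand P α F x τ‖ₑ) h.measurable_rightIntegrand.enorm).trans ?_
  rw [betaConst, ← lintegral_const_mul _ (by fun_prop)]
  refine setLIntegral_mono' measurableSet_Ioo fun τ hτ => ?_
  have h1 : 0 < 1 - τ := sub_pos.2 hτ.2
  have h0 := hτ.1
  have hk := rightKernel_nonneg (α := α) hτ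
  rw [eLpNorm_enorm]
  have h2 := eLpNorm_const_smul (rightKernel α τ : ℂ) (dilDiff P α F τ⁻¹) 2 volume
  change eLpNorm (fun x => rightIntegrand P α F x τ) 2 volume = _ at h2
  have h3 : ‖(rightKernel α τ : ℂ)‖ₑ = ENNReal.ofReal (rightKernel α τ) := by
    rw [← ofReal_norm, Complex.norm_real, Real.norm_of_nonneg hk]
  rw [h2, h3]
  calc ENNReal.ofReal (rightKernel α τ) * eLpNorm (dilDiff P α F τ⁻¹) 2 volume
      ≤ ENNReal.ofReal (rightKernel α τ) * (C * ENNReal.ofReal ((1 - τ) ^ κ)) := by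
        gcongr; exact h.dilDiff_le τ hτ
    _ = C * ENNReal.ofReal (rightKernel α τ * (1 - τ) ^ κ) := by
        rw [ENNReal.ofReal_mul hk]; ring
    _ = _ := by
        rw [rightKernel, mul_assoc, ← Real.rpow_add h1]
        congr 4; ring

theorem eLpNorm_lintegral_left_le (hn : 2 ≤ n) (h : RadialHolder P α κ F C) :
    eLpNorm (fun x => ∫⁻ τ in Set.Ioo 0 1, ‖leftIntegrand P α F x τ‖ₑ) 2 volume ≤
      C * betaConst α κ := by
  have hn' : (2 : ℝ) ≤ n := by exact_mod_cast hn
  refine (eLpNorm_lintegral_le volume (volume.restrict (Set.Ioo 0 1))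
    (Δ := fun x τ => ‖leftIntegrand P α F x τ‖ₑ) h.measurable_leftIntegrand.enorm).trans ?_
  rw [betaConst, ← lintegral_const_mul _ (by fun_prop)]
  refine setLIntegral_mono' measurableSet_Ioo fun τ hτ => ?_
  have h1 : 0 < 1 - τ := sub_pos.2 hτ.2
  have h0 := hτ.1
  have hk := leftKernel_nonneg (n := n) (α := α) hτ
  rw [eLpNorm_enorm]
  have h2 := eLpNorm_const_smul (leftKernel n α τ : ℂ) (dilDiff P α F τ) 2 volume
  change eLpNorm (fun x => leftIntegrand P α F x τ) 2 volume = _ at h2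
  have h3 : ‖(leftKernel n α τ : ℂ)‖ₑ = ENNReal.ofReal (leftKernel n α τ) := by
    rw [← ofReal_norm, Complex.norm_real, Real.norm_of_nonneg hk]
  rw [h2, h3, eLpNorm_dilDiff_inv h0]
  calc ENNReal.ofReal (leftKernel n α τ) * (ENNReal.ofReal (τ ^ (α - (n : ℝ) / 2)) *
        eLpNorm (dilDiff P α F τ⁻¹) 2 volume)
      ≤ ENNReal.ofReal (leftKernel n α τ) * (ENNReal.ofReal (τ ^ (α - (n : ℝ) / 2)) *
        (C * ENNReal.ofReal ((1 - τ) ^ κ))) := by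
        gcongr; exact h.dilDiff_le τ hτ
    _ = C * ENNReal.ofReal (leftKernel n α τ * τ ^ (α - (n : ℝ) / 2) * (1 - τ) ^ κ) := by
        rw [ENNReal.ofReal_mul (by positivity), ENNReal.ofReal_mul hk]; ring
    _ ≤ _ := by
        refine mul_le_mul' le_rfl (ENNReal.ofReal_le_ofReal ?_)
        -- Passing from the ratio `τ` to `τ⁻¹` costs `τ^(α-n/2)`; the power `τ^(n-1)` of the left
        -- kernel compensates for it, so that the same Beta constant bounds both sides.
        have e1 : leftKernel n α τ * τ ^ (α - (n : ℝ) / 2) * (1 - τ) ^ κ =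
            τ ^ ((n : ℝ) / 2 + α - 1) * (1 - τ) ^ (κ - α - 1) := by
          rw [leftKernel, ← Real.rpow_natCast, Nat.cast_sub (by omega), Nat.cast_one,
            show τ ^ ((n : ℝ) - 1) * (1 - τ) ^ (-α - 1) * τ ^ (α - (n : ℝ) / 2) * (1 - τ) ^ κ =
              (τ ^ ((n : ℝ) - 1) * τ ^ (α - (n : ℝ) / 2)) * ((1 - τ) ^ (-α - 1) * (1 - τ) ^ κ) by
                ring, ← Real.rpow_add h0, ← Real.rpow_add h1]
          congr 2 <;> ring
        rw [e1]
        refine mul_le_mul_of_nonneg_right ?_ (by positivity)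
        exact Real.rpow_le_rpow_of_exponent_ge h0 hτ.2.le (by linarith)

theorem memLp_weighted (h : RadialHolder P α κ F C) (hC : C ≠ ⊤) :
    MemLp (weighted P α F) 2 volume :=
  ⟨(measurable_weighted h.measurable).aestronglyMeasurable,
    lt_of_le_of_lt h.weighted_le hC.lt_top⟩

theorem memLp_weighted_comp_dil (h : RadialHolder P α κ F C) (hC : C ≠ ⊤) {σ : ℝ} (hσ : 0 < σ) :
    MemLp (weighted P α fun x => F (dil P σ x)) 2 volume := by
  refine ⟨(measurable_weighted (h.measurable.comp
    (continuous_dil P σ).measurable)).aestronglyMeasurable, ?_⟩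
  rw [eLpNorm_weighted_comp_dil hσ]
  exact ENNReal.mul_lt_top ENNReal.ofReal_lt_top (h.memLp_weighted hC).2

/-- Fractional integration by parts. -/
theorem integral_mul_leftIntegral (hn : 2 ≤ n) (hα0 : 0 < α) {κ' : ℝ}
    {v g : EuclideanSpace ℝ (Fin n) → ℂ} {C' : ℝ≥0∞}
    (hv : RadialHolder P α κ v C) (hC : C ≠ ⊤) (hκ : α < κ) (hv2 : MemLp v 2 volume)
    (hg : RadialHolder P α κ' g C') (hC' : C' ≠ ⊤) (hκ' : α < κ') (hg2 : MemLp g 2 volume) :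
    (∫ x, g x * leftIntegral P α v x) +
        ((∫ τ in Set.Ioo (0 : ℝ) 1, (τ ^ (α - 1) - τ ^ (n - 1)) * (1 - τ) ^ (-α - 1) : ℝ) : ℂ) *
          ∫ x, g x * weighted P α v x =
      ∫ x, v x * rightIntegral P α g x := by
  have hI1 := integrable_mul_of_eLpNorm_lintegral hv.measurable_leftIntegrand
    (ENNReal.mul_ne_top hC (betaConst_ne_top hα0 hκ)) (hv.eLpNorm_lintegral_left_le hn)
    hg.measurable hg2
  have hI2 := integrable_mul_of_eLpNorm_lintegral hg.measurable_rightIntegrand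
    (ENNReal.mul_ne_top hC' (betaConst_ne_top hα0 hκ')) hg.eLpNorm_lintegral_right_le
    hv.measurable hv2
  have hL : ∫ x, g x * leftIntegral P α v x =
      ∫ τ in Set.Ioo (0 : ℝ) 1, ∫ x, g x * leftIntegrand P α v x τ := by
    rw [← integral_integral_swap hI1]
    simp_rw [integral_const_mul]
    rfl
  have hR : ∫ x, v x * rightIntegral P α g x =
      ∫ τ in Set.Ioo (0 : ℝ) 1, ∫ x, v x * rightIntegrand P α g x τ := by
    rw [← integral_integral_swap hI2]
    simp_rw [integral_const_mul]
    rfl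
  -- For fixed `τ` the cross terms of the two sides coincide after a dilation, and the diagonal
  -- terms differ by the difference of the kernels. The comparison is made before integrating in
  -- `τ`, because each kernel alone is not integrable at `1`.
  have key : ∀ τ ∈ Set.Ioo (0 : ℝ) 1, (∫ x, g x * leftIntegrand P α v x τ) -
      ∫ x, v x * rightIntegrand P α g x τ =
      -(((τ ^ (α - 1) - τ ^ (n - 1)) * (1 - τ) ^ (-α - 1) : ℝ) : ℂ) *
        ∫ x, g x * weighted P α v x := by
    intro τ hτ
    have h0 := hτ.1
    have hZ1 : Integrable (fun x => g x * weighted P α v x) volume :=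
      hg2.integrable_mul (hv.memLp_weighted hC)
    have hY1 : Integrable (fun x => g x * weighted P α (fun x => v (dil P τ x)) x) volume :=
      hg2.integrable_mul (hv.memLp_weighted_comp_dil hC h0)
    have hZ2 : Integrable (fun x => v x * weighted P α g x) volume :=
      hv2.integrable_mul (hg.memLp_weighted hC')
    have hY2 : Integrable (fun x => v x * weighted P α (fun x => g (dil P τ⁻¹ x)) x) volume :=
      hv2.integrable_mul (hg.memLp_weighted_comp_dil hC' (inv_pos.2 h0))
    have e1 : ∫ x, g x * leftIntegrand P α v x τ = (leftKernel n α τ : ℂ) *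
        ((∫ x, g x * weighted P α v x) -
          ∫ x, g x * weighted P α (fun x => v (dil P τ x)) x) := by
      rw [← integral_sub hZ1 hY1, ← integral_const_mul]
      refine integral_congr_ae (Eventually.of_forall fun x => ?_)
      simp only [leftIntegrand, dilDiff, weighted]
      ring
    have e2 : ∫ x, v x * rightIntegrand P α g x τ = (rightKernel α τ : ℂ) *
        ((∫ x, g x * weighted P α v x) -
          ∫ x, v x * weighted P α (fun x => g (dil P τ⁻¹ x)) x) := by
      have e3 : ∫ x, g x * weighted P α v x = ∫ x, v x * weighted P α g x := by
        refine integral_congr_ae (Eventually.of_forall fun x => ?_)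
        simp only [weighted]
        ring
      rw [e3, ← integral_sub hZ2 hY2, ← integral_const_mul]
      refine integral_congr_ae (Eventually.of_forall fun x => ?_)
      simp only [rightIntegrand, dilDiff, weighted]
      ring
    -- The dilation contributes `τ^n` from the volume and `τ^(-α)` from the weight; `τ^(n-α)` is
    -- exactly the quotient of the left kernel by the right one.
    have e4 : ∫ x, v x * weighted P α (fun x => g (dil P τ⁻¹ x)) x =
        ((τ ^ ((n : ℝ) - α) : ℝ) : ℂ) *
          ∫ x, g x * weighted P α (fun x => v (dil P τ x)) x := by
      have h5 := integral_comp_dil P (inv_pos.2 h0)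
        (fun y => g y * ((τ ^ (-α) : ℝ) * weighted P α (fun x => v (dil P τ x)) y))
      have h6 : ∫ x, v x * weighted P α (fun x => g (dil P τ⁻¹ x)) x =
          ∫ x, g (dil P τ⁻¹ x) * ((τ ^ (-α) : ℝ) *
            weighted P α (fun x => v (dil P τ x)) (dil P τ⁻¹ x)) := by
        refine integral_congr_ae (Eventually.of_forall fun x => ?_)
        simp only [weighted, dil_dil, mul_inv_cancel₀ h0.ne', dil_one,
          norm_dil_sub P (inv_pos.2 h0).le]
        rw [← mul_assoc ((τ ^ (-α) : ℝ) : ℂ), ← Complex.ofReal_mul,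
          ← Real.mul_rpow h0.le (by positivity), mul_inv_cancel_left₀ h0.ne']
        ring
      rw [h6, h5, ← integral_const_mul, Complex.real_smul, ← integral_const_mul]
      refine integral_congr_ae (Eventually.of_forall fun x => ?_)
      simp only
      have h7 : τ ^ ((n : ℝ) - α) = τ⁻¹ ^ (-(n : ℝ)) * τ ^ (-α) := by
        rw [Real.inv_rpow h0.le, ← Real.rpow_neg h0.le, neg_neg, ← Real.rpow_add h0]
        congr 1
      rw [h7]
      push_cast
      ring
    have e5 : rightKernel α τ * τ ^ ((n : ℝ) - α) = leftKernel n α τ := by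
      rw [rightKernel, leftKernel, mul_right_comm, ← Real.rpow_add h0, ← Real.rpow_natCast,
        Nat.cast_sub (by omega)]
      congr 2
      push_cast; ring
    rw [e1, e2, e4]
    have e6 : (leftKernel n α τ : ℂ) = (rightKernel α τ : ℂ) * ((τ ^ ((n : ℝ) - α) : ℝ) : ℂ) := by
      rw [← e5]; push_cast; rfl
    have e7 : (τ ^ (α - 1) - τ ^ (n - 1)) * (1 - τ) ^ (-α - 1) =
        rightKernel α τ - leftKernel n α τ := by
      rw [rightKernel, leftKernel]; ring
    rw [e7, Complex.ofReal_sub]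
    linear_combination (∫ x, g x * weighted P α (fun x => v (dil P τ x)) x) * (-e6)
  have h1 : (∫ x, g x * leftIntegral P α v x) - ∫ x, v x * rightIntegral P α g x =
      -((∫ τ in Set.Ioo (0 : ℝ) 1, (τ ^ (α - 1) - τ ^ (n - 1)) * (1 - τ) ^ (-α - 1) : ℝ) : ℂ) *
          ∫ x, g x * weighted P α v x := by
    rw [hL, hR]
    refine (integral_sub hI1.integral_prod_right hI2.integral_prod_right).symm.trans ?_
    refine (setIntegral_congr_fun measurableSet_Ioo key).trans ?_
    rw [integral_mul_const, integral_neg, integral_complex_ofReal]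
  linear_combination h1

end RadialHolder

end RadialHolder

/-! ### Weak derivatives and the spaces `H₀¹(Ω)` and `H²(Ω)` as linear subspaces -/

section SobolevBasics

variable {n : ℕ} {Ω : Set (EuclideanSpace ℝ (Fin n))}

theorem partialDeriv_conj {φ : EuclideanSpace ℝ (Fin n) → ℂ} (hφ : ContDiff ℝ ∞ φ) (i : Fin n)
    (x : EuclideanSpace ℝ (Fin n)) :
    partialDeriv i (fun y => conj (φ y)) x = conj (partialDeriv i φ x) := by
  have h1 : HasFDerivAt φ (fderiv ℝ φ x) x :=
    (hφ.differentiable (by simp)).differentiableAt.hasFDerivAt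
  have h2 := (Complex.conjCLE.toContinuousLinearMap.hasFDerivAt (x := φ x)).comp x h1
  have h3 : fderiv ℝ (fun y => conj (φ y)) x =
      Complex.conjCLE.toContinuousLinearMap.comp (fderiv ℝ φ x) := h2.fderiv
  simp [partialDeriv, h3]

theorem partialDeriv_add {φ ψ : EuclideanSpace ℝ (Fin n) → ℂ} (hφ : ContDiff ℝ ∞ φ)
    (hψ : ContDiff ℝ ∞ ψ) (i : Fin n) (x : EuclideanSpace ℝ (Fin n)) :
    partialDeriv i (fun y => φ y + ψ y) x = partialDeriv i φ x + partialDeriv i ψ x := by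
  simp only [partialDeriv]
  rw [fderiv_fun_add (hφ.differentiable (by simp)).differentiableAt
    (hψ.differentiable (by simp)).differentiableAt]
  rfl

theorem partialDeriv_const_mul {φ : EuclideanSpace ℝ (Fin n) → ℂ} (hφ : ContDiff ℝ ∞ φ) (c : ℂ)
    (i : Fin n) (x : EuclideanSpace ℝ (Fin n)) :
    partialDeriv i (fun y => c * φ y) x = c * partialDeriv i φ x := by
  simp only [partialDeriv]
  rw [fderiv_const_mul (hφ.differentiable (by simp)).differentiableAt]
  rfl

namespace IsTestFunction

variable {φ ψ : EuclideanSpace ℝ (Fin n) → ℂ}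

theorem eq_zero (h : IsTestFunction Ω φ) {x : EuclideanSpace ℝ (Fin n)} (hx : x ∉ Ω) : φ x = 0 :=
  image_eq_zero_of_notMem_tsupport fun hc => hx (h.2.2 hc)

theorem partialDeriv (h : IsTestFunction Ω φ) (i : Fin n) :
    IsTestFunction Ω (partialDeriv i φ) := by
  have hsub : tsupport (Kipriyanov.partialDeriv i φ) ⊆ tsupport φ :=
    closure_minimal (fun x hx => by_contra fun hc => hx (partialDeriv_eq_zero hc i))
      (isClosed_tsupport φ)
  refine ⟨?_, h.2.1.of_isClosed_subset (isClosed_tsupport _) hsub, hsub.trans h.2.2⟩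
  have h1 : ContDiff ℝ ∞ (fderiv ℝ φ) := h.1.fderiv_right (by simp)
  exact h1.clm_apply contDiff_const

theorem conjugate (h : IsTestFunction Ω φ) : IsTestFunction Ω fun x => conj (φ x) := by
  refine ⟨Complex.conjCLE.contDiff.comp h.1, h.2.1.comp_left (g := fun z : ℂ => conj z) (by simp),
    ?_⟩
  refine subset_trans (closure_mono ?_) h.2.2
  intro x hx hc
  exact hx (by simp [hc])

theorem add (h : IsTestFunction Ω φ) (h' : IsTestFunction Ω ψ) :
    IsTestFunction Ω fun x => φ x + ψ x :=
  ⟨h.1.add h'.1, h.2.1.add h'.2.1, (tsupport_add φ ψ).trans (Set.union_subset h.2.2 h'.2.2)⟩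

theorem smul (c : ℂ) (h : IsTestFunction Ω φ) : IsTestFunction Ω fun x => c * φ x := by
  refine ⟨contDiff_const.mul h.1, h.2.1.mul_left, subset_trans (closure_mono ?_) h.2.2⟩
  intro x hx hc
  exact hx (by simp [hc])

theorem memLp (h : IsTestFunction Ω φ) (p : ENNReal) : MemLp φ p (volume.restrict Ω) :=
  (h.1.continuous.memLp_of_hasCompactSupport h.2.1).restrict _

theorem hasWeakDeriv (h : IsTestFunction Ω φ) (i : Fin n) :
    HasWeakDeriv Ω i φ (Kipriyanov.partialDeriv i φ) := by
  intro ψ hψ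
  have hi : ∀ {f g : EuclideanSpace ℝ (Fin n) → ℂ}, IsTestFunction Ω f → IsTestFunction Ω g →
      Integrable (fun x => f x * g x) volume := fun hf hg =>
    (hf.1.continuous.mul hg.1.continuous).integrable_of_hasCompactSupport hf.2.1.mul_right
  rw [setIntegral_eq_integral_of_forall_compl_eq_zero fun x hx => by rw [h.eq_zero hx, zero_mul],
    setIntegral_eq_integral_of_forall_compl_eq_zero fun x hx => by rw [hψ.eq_zero hx, mul_zero]]
  exact integral_mul_fderiv_eq_neg_fderiv_mul_of_integrable (hi (h.partialDeriv i) hψ)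
    (hi h (hψ.partialDeriv i)) (hi h hψ)
    (fun x _ => (h.1.differentiable (by simp)).differentiableAt)
    (fun x _ => (hψ.1.differentiable (by simp)).differentiableAt)

end IsTestFunction

theorem inner_toLp_left {k : EuclideanSpace ℝ (Fin n) → ℂ} (hk : MemLp k 2 (volume.restrict Ω))
    (f : L2 Ω) : ⟪hk.toLp k, f⟫_ℂ = ∫ x in Ω, f x * conj (k x) := by
  rw [L2.inner_def]
  refine integral_congr_ae ?_
  filter_upwards [hk.coeFn_toLp] with x hx
  rw [hx, RCLike.inner_apply]

/-- Testing with complex conjugates turns the defining identity into inner products, where linearity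
and closedness of the relation are immediate. -/
theorem hasWeakDeriv_iff (i : Fin n) (f g : L2 Ω) :
    HasWeakDeriv Ω i f g ↔ ∀ (φ : EuclideanSpace ℝ (Fin n) → ℂ) (h : IsTestFunction Ω φ),
      ⟪((h.partialDeriv i).memLp 2).toLp, f⟫_ℂ = -⟪(h.memLp 2).toLp, g⟫_ℂ := by
  constructor
  · intro hw φ h
    rw [inner_toLp_left, inner_toLp_left]
    have := hw _ h.conjugate
    simp_rw [partialDeriv_conj h.1] at this
    exact this
  · intro hw φ h
    have := hw _ h.conjugate
    rw [inner_toLp_left, inner_toLp_left] at this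
    simpa [partialDeriv_conj h.1] using this

theorem HasWeakDeriv.congr {i : Fin n} {f g f' g' : EuclideanSpace ℝ (Fin n) → ℂ}
    (h : HasWeakDeriv Ω i f g) (hf : f =ᵐ[volume.restrict Ω] f')
    (hg : g =ᵐ[volume.restrict Ω] g') : HasWeakDeriv Ω i f' g' := by
  intro φ hφ
  rw [integral_congr_ae (g := fun x => f x * partialDeriv i φ x),
    integral_congr_ae (f := fun x => g' x * φ x) (g := fun x => g x * φ x), h φ hφ]
  · filter_upwards [hg] with x hx; rw [hx]
  · filter_upwards [hf] with x hx; rw [hx]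

theorem ae_eq_zero_of_test (hΩ : IsOpen Ω) [IsFiniteMeasure (volume.restrict Ω)]
    {w : EuclideanSpace ℝ (Fin n) → ℂ} (hw : MemLp w 2 (volume.restrict Ω))
    (h : ∀ φ, IsTestFunction Ω φ → ∫ x in Ω, w x * φ x = 0) : w =ᵐ[volume.restrict Ω] 0 := by
  have h1 : LocallyIntegrableOn w Ω volume :=
    IntegrableOn.locallyIntegrableOn (hw.integrable one_le_two)
  have h2 := hΩ.ae_eq_zero_of_integral_contDiff_smul_eq_zero h1 ?_
  · exact (ae_restrict_iff' hΩ.measurableSet).2 h2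
  · intro g hg hgc hgs
    have ht : IsTestFunction Ω fun x => (g x : ℂ) := by
      refine ⟨Complex.ofRealCLM.contDiff.comp hg,
        hgc.comp_left (g := fun r : ℝ => (r : ℂ)) (by simp), subset_trans (closure_mono ?_) hgs⟩
      intro x hx hc
      exact hx (by simp [hc])
    rw [← h _ ht, setIntegral_eq_integral_of_forall_compl_eq_zero fun x hx => by
      rw [ht.eq_zero hx, mul_zero]]
    refine integral_congr_ae (Eventually.of_forall fun x => ?_)
    simp [mul_comm]

theorem eq_zero_of_inner_test (hΩ : IsOpen Ω) [IsFiniteMeasure (volume.restrict Ω)] {w : L2 Ω}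
    (h : ∀ (φ : EuclideanSpace ℝ (Fin n) → ℂ) (hφ : IsTestFunction Ω φ),
      ⟪(hφ.memLp 2).toLp, w⟫_ℂ = 0) : w = 0 := by
  refine Lp.ext ((ae_eq_zero_of_test hΩ (Lp.memLp w) fun φ hφ => ?_).trans
    (Lp.coeFn_zero _ _ _).symm)
  have := h _ hφ.conjugate
  rw [inner_toLp_left] at this
  simpa using this

theorem hasWeakDeriv_unique (hΩ : IsOpen Ω) [IsFiniteMeasure (volume.restrict Ω)] {i : Fin n}
    {f : EuclideanSpace ℝ (Fin n) → ℂ} {g g' : L2 Ω} (h : HasWeakDeriv Ω i f g)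
    (h' : HasWeakDeriv Ω i f g') : g = g' := by
  rw [← sub_eq_zero]
  refine eq_zero_of_inner_test hΩ fun φ hφ => ?_
  rw [inner_sub_right, inner_toLp_left, inner_toLp_left]
  have h1 := h _ hφ.conjugate
  rw [h' _ hφ.conjugate, neg_inj] at h1
  rw [h1, sub_self]

theorem weakDeriv_spec {i : Fin n} {f : EuclideanSpace ℝ (Fin n) → ℂ}
    (h : ∃ g : L2 Ω, HasWeakDeriv Ω i f g) : HasWeakDeriv Ω i f (weakDeriv Ω i f) := by
  rw [weakDeriv, dif_pos h]
  exact h.choose_spec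

theorem weakDeriv_eq (hΩ : IsOpen Ω) [IsFiniteMeasure (volume.restrict Ω)] {i : Fin n}
    {f : EuclideanSpace ℝ (Fin n) → ℂ} {g : L2 Ω} (h : HasWeakDeriv Ω i f g) :
    weakDeriv Ω i f = g :=
  hasWeakDeriv_unique hΩ (weakDeriv_spec ⟨g, h⟩) h

theorem HasWeakDeriv.add {i : Fin n} {f f' g g' : L2 Ω} (h : HasWeakDeriv Ω i f g)
    (h' : HasWeakDeriv Ω i f' g') : HasWeakDeriv Ω i (f + f' : L2 Ω) (g + g' : L2 Ω) := by
  rw [hasWeakDeriv_iff] at *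
  intro φ hφ
  rw [inner_add_right, inner_add_right, h φ hφ, h' φ hφ]
  ring

theorem HasWeakDeriv.smul (c : ℂ) {i : Fin n} {f g : L2 Ω} (h : HasWeakDeriv Ω i f g) :
    HasWeakDeriv Ω i (c • f : L2 Ω) (c • g : L2 Ω) := by
  rw [hasWeakDeriv_iff] at *
  intro φ hφ
  rw [inner_smul_right, inner_smul_right, h φ hφ]
  ring

theorem HasWeakDeriv.zero (i : Fin n) : HasWeakDeriv Ω i (0 : L2 Ω) (0 : L2 Ω) := by
  rw [hasWeakDeriv_iff]
  intro φ hφ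
  simp

variable (Ω)

/-- The graph of the gradient on the test functions. -/
noncomputable def testGraph : Submodule ℂ (L2 Ω × (Fin n → L2 Ω)) where
  carrier := {p | ∃ φ, ∃ h : IsTestFunction Ω φ, p.1 = (h.memLp 2).toLp ∧
    ∀ i, p.2 i = ((h.partialDeriv i).memLp 2).toLp}
  add_mem' := by
    rintro p q ⟨φ, h, h1, h2⟩ ⟨ψ, h', h1', h2'⟩
    refine ⟨_, h.add h', ?_, fun i => ?_⟩
    · exact (congrArg₂ (· + ·) h1 h1').trans (MemLp.toLp_add (h.memLp 2) (h'.memLp 2)).symm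
    · refine ((congrArg₂ (· + ·) (h2 i) (h2' i)).trans
        (MemLp.toLp_add ((h.partialDeriv i).memLp 2) ((h'.partialDeriv i).memLp 2)).symm).trans
        (MemLp.toLp_congr _ _ (Eventually.of_forall fun x => ?_))
      exact (partialDeriv_add h.1 h'.1 i x).symm
  zero_mem' := by
    have h : IsTestFunction Ω fun _ => (0 : ℂ) :=
      ⟨contDiff_const, HasCompactSupport.zero, by simp [tsupport]⟩
    refine ⟨_, h, ?_, fun i => ?_⟩
    · exact (MemLp.toLp_zero (h.memLp 2)).symm
    · refine (Lp.eq_zero_iff_ae_eq_zero.2 ((MemLp.coeFn_toLp _).trans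
        (Eventually.of_forall fun x => ?_))).symm
      simp [partialDeriv]
  smul_mem' := by
    rintro c p ⟨φ, h, h1, h2⟩
    refine ⟨_, h.smul c, ?_, fun i => ?_⟩
    · exact (congrArg (c • ·) h1).trans (MemLp.toLp_const_smul c (h.memLp 2)).symm
    · refine ((congrArg (c • ·) (h2 i)).trans
        (MemLp.toLp_const_smul c ((h.partialDeriv i).memLp 2)).symm).trans
        (MemLp.toLp_congr _ _ (Eventually.of_forall fun x => ?_))
      exact (partialDeriv_const_mul h.1 c i x).symm

/-- The graph of the weak gradient. -/
noncomputable def weakGraph : Submodule ℂ (L2 Ω × (Fin n → L2 Ω)) where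
  carrier := {p | ∀ i, HasWeakDeriv Ω i p.1 (p.2 i)}
  add_mem' := fun hp hq i => (hp i).add (hq i)
  zero_mem' := fun i => HasWeakDeriv.zero i
  smul_mem' := fun c _ hp i => (hp i).smul c

theorem isClosed_weakGraph : IsClosed (weakGraph Ω : Set (L2 Ω × (Fin n → L2 Ω))) := by
  have h : (weakGraph Ω : Set (L2 Ω × (Fin n → L2 Ω))) =
      ⋂ (i : Fin n) (φ : EuclideanSpace ℝ (Fin n) → ℂ) (h : IsTestFunction Ω φ),
        {p | ⟪((h.partialDeriv i).memLp 2).toLp, p.1⟫_ℂ = -⟪(h.memLp 2).toLp, p.2 i⟫_ℂ} := by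
    ext p
    simp only [Set.mem_iInter, Set.mem_ofPred_eq]
    exact forall_congr' fun i => hasWeakDeriv_iff i _ _
  rw [h]
  refine isClosed_iInter fun i => isClosed_iInter fun φ => isClosed_iInter fun h =>
    isClosed_eq ?_ ?_
  · fun_prop
  · fun_prop

theorem testGraph_le_weakGraph : testGraph Ω ≤ weakGraph Ω := by
  rintro p ⟨φ, h, h1, h2⟩ i
  rw [h1, h2]
  exact (h.hasWeakDeriv i).congr (MemLp.coeFn_toLp _).symm (MemLp.coeFn_toLp _).symm

theorem testGraph_closure_le : (testGraph Ω).topologicalClosure ≤ weakGraph Ω :=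
  Submodule.topologicalClosure_minimal _ (testGraph_le_weakGraph Ω) (isClosed_weakGraph Ω)

/-- `H₀¹(Ω)` as a linear subspace of `L₂(Ω)`. -/
noncomputable def h10 : Submodule ℂ (L2 Ω) :=
  (testGraph Ω).topologicalClosure.map (LinearMap.fst ℂ _ _)

variable {Ω}

/-- Weak derivatives are unique, so a point of the closed graph is determined by its first
component. -/
theorem mem_closure_testGraph (hΩ : IsOpen Ω) [IsFiniteMeasure (volume.restrict Ω)] {u : L2 Ω}
    (hu : u ∈ h10 Ω) : (u, fun i => weakDeriv Ω i u) ∈ (testGraph Ω).topologicalClosure := by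
  obtain ⟨p, hp, rfl⟩ := hu
  have h1 : p.2 = fun i => weakDeriv Ω i p.1 := by
    funext i
    exact (weakDeriv_eq hΩ (testGraph_closure_le Ω hp i)).symm
  change (p.1, fun i => weakDeriv Ω i p.1) ∈ _
  rw [← h1]
  exact hp

theorem h10_hasWeakDeriv {u : L2 Ω} (hu : u ∈ h10 Ω) (i : Fin n) :
    HasWeakDeriv Ω i u (weakDeriv Ω i u) := by
  obtain ⟨p, hp, rfl⟩ := hu
  exact weakDeriv_spec ⟨p.2 i, testGraph_closure_le Ω hp i⟩

theorem toLp_mem_h10 {φ : EuclideanSpace ℝ (Fin n) → ℂ} (h : IsTestFunction Ω φ) :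
    (h.memLp 2).toLp ∈ h10 Ω :=
  ⟨((h.memLp 2).toLp, fun i => ((h.partialDeriv i).memLp 2).toLp),
    (testGraph Ω).le_topologicalClosure ⟨φ, h, rfl, fun _ => rfl⟩, rfl⟩

theorem weakDeriv_toLp (hΩ : IsOpen Ω) [IsFiniteMeasure (volume.restrict Ω)]
    {φ : EuclideanSpace ℝ (Fin n) → ℂ} (h : IsTestFunction Ω φ) (i : Fin n) :
    weakDeriv Ω i ((h.memLp 2).toLp : L2 Ω) = ((h.partialDeriv i).memLp 2).toLp :=
  weakDeriv_eq hΩ ((h.hasWeakDeriv i).congr (MemLp.coeFn_toLp _).symm (MemLp.coeFn_toLp _).symm)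

/-- Elements of `H₀¹(Ω)` are approximated by test functions. -/
theorem exists_seq_test (hΩ : IsOpen Ω) [IsFiniteMeasure (volume.restrict Ω)] {u : L2 Ω}
    (hu : u ∈ h10 Ω) : ∃ (φ : ℕ → EuclideanSpace ℝ (Fin n) → ℂ)
      (h : ∀ k, IsTestFunction Ω (φ k)),
      Tendsto (fun k => ((h k).memLp 2).toLp) atTop (𝓝 u) ∧
      ∀ i, Tendsto (fun k => (((h k).partialDeriv i).memLp 2).toLp) atTop
        (𝓝 (weakDeriv Ω i u)) := by
  have h1 := mem_closure_testGraph hΩ hu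
  rw [← SetLike.mem_coe, Submodule.topologicalClosure_coe, mem_closure_iff_seq_limit] at h1
  obtain ⟨p, hp, hlim⟩ := h1
  choose φ h h2 h3 using hp
  refine ⟨φ, h, ?_, fun i => ?_⟩
  · exact ((continuous_fst.tendsto _).comp hlim).congr h2
  · exact ((((continuous_apply i).comp continuous_snd).tendsto _).comp hlim).congr fun k => h3 k i

theorem tendsto_toLp_iff {φ : ℕ → EuclideanSpace ℝ (Fin n) → ℂ}
    (h : ∀ k, MemLp (φ k) 2 (volume.restrict Ω)) (u : L2 Ω) :
    Tendsto (fun k => (h k).toLp) atTop (𝓝 u) ↔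
      Tendsto (fun k => eLpNorm (fun x => φ k x - u x) 2 (volume.restrict Ω)) atTop (𝓝 0) := by
  have := Lp.tendsto_Lp_iff_tendsto_eLpNorm'' φ h u (Lp.memLp u) (fi := atTop)
  rw [Lp.toLp_coeFn] at this
  exact this

theorem coe_h10 (hΩ : IsOpen Ω) [IsFiniteMeasure (volume.restrict Ω)] :
    (h10 Ω : Set (L2 Ω)) = sobolevH10 Ω := by
  ext u
  constructor
  · intro hu
    obtain ⟨φ, h, h1, h2⟩ := exists_seq_test hΩ hu
    exact ⟨fun i => ⟨_, h10_hasWeakDeriv hu i⟩, φ, h, (tendsto_toLp_iff _ _).1 h1,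
      fun i => (tendsto_toLp_iff _ _).1 (h2 i)⟩
  · rintro ⟨-, φ, h, h1, h2⟩
    refine ⟨(u, fun i => weakDeriv Ω i u), ?_, rfl⟩
    rw [SetLike.mem_coe, ← SetLike.mem_coe, Submodule.topologicalClosure_coe,
      mem_closure_iff_seq_limit]
    refine ⟨fun k => (((h k).memLp 2).toLp, fun i => (((h k).partialDeriv i).memLp 2).toLp),
      fun k => ⟨φ k, h k, rfl, fun _ => rfl⟩, ?_⟩
    exact ((tendsto_toLp_iff (fun k => (h k).memLp 2) u).2 h1).prodMk_nhds
      (tendsto_pi_nhds.2 fun i => (tendsto_toLp_iff _ _).2 (h2 i))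

/-- The weak derivative as a linear map on `H₀¹(Ω)`. -/
noncomputable def gradLin (hΩ : IsOpen Ω) [IsFiniteMeasure (volume.restrict Ω)] (i : Fin n) :
    h10 Ω →ₗ[ℂ] L2 Ω where
  toFun u := weakDeriv Ω i (u : L2 Ω)
  map_add' u v := weakDeriv_eq hΩ ((h10_hasWeakDeriv u.2 i).add (h10_hasWeakDeriv v.2 i))
  map_smul' c u := weakDeriv_eq hΩ ((h10_hasWeakDeriv u.2 i).smul c)

/-- The norm of `H₀¹(Ω)`. -/
noncomputable def energyNorm (hΩ : IsOpen Ω) [IsFiniteMeasure (volume.restrict Ω)] :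
    Seminorm ℂ (h10 Ω) :=
  (normSeminorm ℂ (L2 Ω)).comp (h10 Ω).subtype +
    ∑ i, (normSeminorm ℂ (L2 Ω)).comp (gradLin hΩ i)

theorem energyNorm_apply (hΩ : IsOpen Ω) [IsFiniteMeasure (volume.restrict Ω)] (u : h10 Ω) :
    energyNorm hΩ u = ‖(u : L2 Ω)‖ + ∑ i, ‖gradLin hΩ i u‖ := by
  simp [energyNorm, Seminorm.comp_apply]

theorem tendsto_energyNorm (hΩ : IsOpen Ω) [IsFiniteMeasure (volume.restrict Ω)] {ι : Type*}
    {l : Filter ι} {s : ι → h10 Ω} {u : h10 Ω} (h : Tendsto (fun k => (s k : L2 Ω)) l (𝓝 u))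
    (h' : ∀ i, Tendsto (fun k => gradLin hΩ i (s k)) l (𝓝 (gradLin hΩ i u))) :
    Tendsto (fun k => energyNorm hΩ (s k - u)) l (𝓝 0) := by
  simp_rw [energyNorm_apply, map_sub]
  have h1 := tendsto_iff_norm_sub_tendsto_zero.1 h
  have h2 := tendsto_finsetSum Finset.univ fun i _ =>
    tendsto_iff_norm_sub_tendsto_zero.1 (h' i)
  simpa using h1.add h2

/-- Each derivative is Cauchy in `L₂(Ω)`; the limits belong to the closed graph of the gradient and
are therefore the weak derivatives of `u`. -/
theorem energyNorm_complete (hΩ : IsOpen Ω) [IsFiniteMeasure (volume.restrict Ω)]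
    (s : ℕ → h10 Ω) (u : L2 Ω) (h : Tendsto (fun k => (s k : L2 Ω)) atTop (𝓝 u))
    (h' : Tendsto (fun p : ℕ × ℕ => energyNorm hΩ (s p.1 - s p.2)) atTop (𝓝 0)) :
    ∃ hu : u ∈ h10 Ω, Tendsto (fun k => energyNorm hΩ (s k - ⟨u, hu⟩)) atTop (𝓝 0) := by
  have h1 : ∀ i, ∃ g, Tendsto (fun k => gradLin hΩ i (s k)) atTop (𝓝 g) := by
    intro i
    refine cauchySeq_tendsto_of_complete (cauchySeq_iff_tendsto_dist_atTop_0.2 ?_)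
    refine squeeze_zero (fun _ => dist_nonneg) (fun p => ?_) h'
    rw [dist_eq_norm, ← map_sub, energyNorm_apply]
    have h2 := Finset.single_le_sum (f := fun i => ‖gradLin hΩ i (s p.1 - s p.2)‖)
      (fun i _ => norm_nonneg _) (Finset.mem_univ i)
    have h3 := norm_nonneg ((s p.1 - s p.2 : h10 Ω) : L2 Ω)
    linarith
  choose g hg using h1
  have h2 : (u, g) ∈ (testGraph Ω).topologicalClosure := by
    refine (Submodule.isClosed_topologicalClosure _).mem_of_tendsto
      (h.prodMk_nhds (tendsto_pi_nhds.2 hg)) (Eventually.of_forall fun k => ?_)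
    exact mem_closure_testGraph hΩ (s k).2
  have hu : u ∈ h10 Ω := ⟨(u, g), h2, rfl⟩
  refine ⟨hu, tendsto_energyNorm hΩ h fun i => ?_⟩
  have h3 : gradLin hΩ i ⟨u, hu⟩ = g i := weakDeriv_eq hΩ (testGraph_closure_le Ω h2 i)
  rw [h3]
  exact hg i

/-- `H²(Ω)` as a linear subspace of `L₂(Ω)`. -/
noncomputable def h2 (Ω : Set (EuclideanSpace ℝ (Fin n))) : Submodule ℂ (L2 Ω) where
  carrier := sobolevH2 Ω
  add_mem' := by
    intro u v hu hv i
    obtain ⟨g, hg, hg'⟩ := hu i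
    obtain ⟨k, hk, hk'⟩ := hv i
    refine ⟨g + k, hg.add hk, fun j => ?_⟩
    obtain ⟨a, ha⟩ := hg' j
    obtain ⟨b, hb⟩ := hk' j
    exact ⟨a + b, ha.add hb⟩
  zero_mem' := fun i => ⟨0, HasWeakDeriv.zero i, fun j => ⟨0, HasWeakDeriv.zero j⟩⟩
  smul_mem' := by
    intro c u hu i
    obtain ⟨g, hg, hg'⟩ := hu i
    refine ⟨c • g, hg.smul c, fun j => ?_⟩
    obtain ⟨a, ha⟩ := hg' j
    exact ⟨c • a, ha.smul c⟩

theorem toLp_mem_h2 {φ : EuclideanSpace ℝ (Fin n) → ℂ} (h : IsTestFunction Ω φ) :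
    (h.memLp 2).toLp ∈ h2 Ω := fun i =>
  ⟨((h.partialDeriv i).memLp 2).toLp,
    (h.hasWeakDeriv i).congr (MemLp.coeFn_toLp _).symm (MemLp.coeFn_toLp _).symm, fun j =>
    ⟨(((h.partialDeriv i).partialDeriv j).memLp 2).toLp,
      ((h.partialDeriv i).hasWeakDeriv j).congr (MemLp.coeFn_toLp _).symm
        (MemLp.coeFn_toLp _).symm⟩⟩

theorem h2_hasWeakDeriv (hΩ : IsOpen Ω) [IsFiniteMeasure (volume.restrict Ω)] {u : L2 Ω}
    (hu : u ∈ h2 Ω) (i j : Fin n) : ∃ k : L2 Ω, HasWeakDeriv Ω j (weakDeriv Ω i u) k := by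
  obtain ⟨g, hg, hg'⟩ := hu i
  rw [weakDeriv_eq hΩ hg]
  exact hg' j

end SobolevBasics

/-! ### Zero extension of `H₀¹(Ω)` and its dilation estimates -/

section Extension

open scoped ENNReal

variable {n : ℕ} {Ω : Set (EuclideanSpace ℝ (Fin n))}

/-- The extension of an element of `L₂(Ω)` by zero. -/
noncomputable def extend (u : L2 Ω) : EuclideanSpace ℝ (Fin n) → ℂ := Ω.indicator u

theorem measurable_extend (hΩ : IsOpen Ω) (u : L2 Ω) : Measurable (extend u) :=
  (Lp.stronglyMeasurable u).measurable.indicator hΩ.measurableSet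

theorem eLpNorm_extend (hΩ : IsOpen Ω) (u : L2 Ω) :
    eLpNorm (extend u) 2 volume = eLpNorm u 2 (volume.restrict Ω) :=
  eLpNorm_indicator_eq_eLpNorm_restrict hΩ.measurableSet

theorem memLp_extend (hΩ : IsOpen Ω) (u : L2 Ω) : MemLp (extend u) 2 volume :=
  ⟨(measurable_extend hΩ u).aestronglyMeasurable, by
    rw [eLpNorm_extend hΩ]; exact (Lp.memLp u).2⟩

/-- The sum of the `L₂` norms of the first derivatives. -/
noncomputable def gradNorm (u : L2 Ω) : ℝ≥0∞ :=
  ∑ i, eLpNorm (weakDeriv Ω i u) 2 (volume.restrict Ω)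

theorem IsTestFunction.eLpNorm_eq (hΩ : IsOpen Ω) {φ : EuclideanSpace ℝ (Fin n) → ℂ}
    (h : IsTestFunction Ω φ) : eLpNorm φ 2 volume = eLpNorm φ 2 (volume.restrict Ω) := by
  rw [← eLpNorm_indicator_eq_eLpNorm_restrict hΩ.measurableSet]
  congr 1
  exact (Set.indicator_eq_self.2 fun x hx => by_contra fun hc => hx (h.eq_zero hc)).symm

theorem IsTestFunction.eLpNorm_gradSum_le (hΩ : IsOpen Ω) {φ : EuclideanSpace ℝ (Fin n) → ℂ}
    (h : IsTestFunction Ω φ) : eLpNorm (gradSum φ) 2 volume ≤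
      ∑ i, eLpNorm (Kipriyanov.partialDeriv i φ) 2 (volume.restrict Ω) := by
  have h1 : gradSum φ = ∑ i, fun x => ‖Kipriyanov.partialDeriv i φ x‖ := by
    funext x
    simp [gradSum]
  rw [h1]
  refine (eLpNorm_sum_le (fun i _ => (continuous_partialDeriv h.1 i).norm.aestronglyMeasurable)
    one_le_two).trans (Finset.sum_le_sum fun i _ => ?_)
  rw [eLpNorm_norm, (h.partialDeriv i).eLpNorm_eq hΩ]

/-- A subsequence that converges almost everywhere on the whole space, prepared for Fatou's lemma:
inequalities proved for test functions pass to the limit with the bounds `c k`. -/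
theorem exists_seq_test_ae (hΩ : IsOpen Ω) [IsFiniteMeasure (volume.restrict Ω)] {u : L2 Ω}
    (hu : u ∈ h10 Ω) : ∃ (φ : ℕ → EuclideanSpace ℝ (Fin n) → ℂ) (c : ℕ → ℝ≥0∞),
      (∀ k, IsTestFunction Ω (φ k)) ∧
      (∀ᵐ x, Tendsto (fun k => φ k x) atTop (𝓝 (extend u x))) ∧
      (∀ k, eLpNorm (gradSum (φ k)) 2 volume ≤ c k) ∧ Tendsto c atTop (𝓝 (gradNorm u)) := by
  obtain ⟨φ, h, h1, h2⟩ := exists_seq_test hΩ hu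
  have h3 : TendstoInMeasure volume φ atTop (extend u) := by
    refine tendstoInMeasure_of_tendsto_eLpNorm two_ne_zero
      (fun k => (h k).1.continuous.aestronglyMeasurable)
      (measurable_extend hΩ u).aestronglyMeasurable ?_
    refine ((tendsto_toLp_iff _ _).1 h1).congr fun k => ?_
    rw [← eLpNorm_indicator_eq_eLpNorm_restrict hΩ.measurableSet]
    congr 1
    funext x
    by_cases hx : x ∈ Ω
    · simp [hx, extend]
    · simp [hx, extend, (h k).eq_zero hx]
  obtain ⟨ns, hns, h4⟩ := h3.exists_seq_tendsto_ae
  refine ⟨fun k => φ (ns k),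
    fun k => ∑ i, eLpNorm (partialDeriv i (φ (ns k))) 2 (volume.restrict Ω),
    fun k => h _, h4, fun k => (h _).eLpNorm_gradSum_le hΩ, ?_⟩
  refine tendsto_finsetSum _ fun i _ => ?_
  have h5 := ((h2 i).comp hns.tendsto_atTop).enorm
  simp only [Lp.enorm_def] at h5
  refine h5.congr fun k => ?_
  exact eLpNorm_congr_ae (MemLp.coeFn_toLp (((h (ns k)).partialDeriv i).memLp 2))

theorem eLpNorm_le_of_tendsto {X : Type*} [MeasurableSpace X] {μ : Measure X} {f : ℕ → X → ℂ}
    {g : X → ℂ} {c : ℕ → ℝ≥0∞} {b : ℝ≥0∞} (hf : ∀ k, AEStronglyMeasurable (f k) μ)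
    (h : ∀ᵐ x ∂μ, Tendsto (fun k => f k x) atTop (𝓝 (g x))) (hc : ∀ k, eLpNorm (f k) 2 μ ≤ c k)
    (hb : Tendsto c atTop (𝓝 b)) : eLpNorm g 2 μ ≤ b := by
  refine (Lp.eLpNorm_lim_le_liminf_eLpNorm hf g h).trans ?_
  rw [← hb.liminf_eq]
  exact liminf_le_liminf (Eventually.of_forall hc)

variable {P : EuclideanSpace ℝ (Fin n)} {α : ℝ}

/-- The constant in the weighted Hardy inequality. -/
noncomputable def hardyConst (n : ℕ) (α R : ℝ) : ℝ≥0∞ :=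
  ENNReal.ofReal ((1 - 2 ^ (α - (n : ℝ) / 2))⁻¹) * ENNReal.ofReal (R ^ (1 - α))

/-- Hardy's inequality holds for test functions, since their support misses `P` and the weighted
norm is finite; Fatou's lemma extends it to `H₀¹(Ω)` and yields the finiteness there. -/
theorem eLpNorm_weighted_extend_le (hn : 2 ≤ n) (hα0 : 0 < α) (hα1 : α < 1) (hΩ : IsOpen Ω)
    [IsFiniteMeasure (volume.restrict Ω)] (hP : P ∉ Ω) {R : ℝ} (hR0 : 0 ≤ R)
    (hR : ∀ x ∈ Ω, ‖x - P‖ ≤ R) {u : L2 Ω} (hu : u ∈ h10 Ω) :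
    eLpNorm (weighted P α (extend u)) 2 volume ≤ hardyConst n α R * gradNorm u := by
  obtain ⟨φ, c, h1, h2, h3, h4⟩ := exists_seq_test_ae hΩ hu
  refine eLpNorm_le_of_tendsto (f := fun k => weighted P α (φ k))
    (c := fun k => hardyConst n α R * c k)
    (fun k => (measurable_weighted (h1 k).1.continuous.measurable).aestronglyMeasurable) ?_
    (fun k => ?_) (ENNReal.Tendsto.const_mul h4
      (Or.inr (ENNReal.mul_ne_top ENNReal.ofReal_ne_top ENNReal.ofReal_ne_top)))
  · filter_upwards [h2] with x hx
    exact hx.const_mul _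
  · refine (eLpNorm_weighted_le_dilDiff hn hα1 (h1 k).1.continuous.measurable
      (eLpNorm_weighted_ne_top hα0.le (h1 k).1.continuous (h1 k).2.1
        fun hc => hP ((h1 k).2.2 hc))).trans ?_
    rw [hardyConst, mul_assoc]
    gcongr
    refine (eLpNorm_dilDiff_le_of_contDiff (h1 k).1 hR0
      (fun x hx => hR x ((h1 k).2.2 hx)) hα1 one_le_two).trans ?_
    rw [show (2 : ℝ) - 1 = 1 by norm_num, mul_one]
    gcongr
    exact h3 k

theorem eLpNorm_dilDiff_extend_le (hα1 : α < 1) (hΩ : IsOpen Ω)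
    [IsFiniteMeasure (volume.restrict Ω)] {R : ℝ} (hR0 : 0 ≤ R)
    (hR : ∀ x ∈ Ω, ‖x - P‖ ≤ R) {u : L2 Ω} (hu : u ∈ h10 Ω) {σ : ℝ} (hσ : 1 ≤ σ) :
    eLpNorm (dilDiff P α (extend u) σ) 2 volume ≤
      ENNReal.ofReal (R ^ (1 - α) * (σ - 1)) * gradNorm u := by
  obtain ⟨φ, c, h1, h2, h3, h4⟩ := exists_seq_test_ae hΩ hu
  refine eLpNorm_le_of_tendsto (f := fun k => dilDiff P α (φ k) σ)
    (c := fun k => ENNReal.ofReal (R ^ (1 - α) * (σ - 1)) * c k)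
    (fun k => (measurable_dilDiff (h1 k).1.continuous.measurable σ).aestronglyMeasurable) ?_
    (fun k => ?_) (ENNReal.Tendsto.const_mul h4 (Or.inr ENNReal.ofReal_ne_top))
  · filter_upwards [h2, (quasiMeasurePreserving_dil P (σ := σ) (by linarith)).ae h2] with x hx hx'
    exact (hx.sub hx').const_mul _
  · refine (eLpNorm_dilDiff_le_of_contDiff (h1 k).1 hR0
      (fun x hx => hR x ((h1 k).2.2 hx)) hα1 hσ).trans ?_
    gcongr
    exact h3 k

/-- The constant that relates the radial Hölder condition to the gradient. -/
noncomputable def radialConst (n : ℕ) (α R : ℝ) : ℝ≥0∞ :=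
  2 * ENNReal.ofReal (R ^ (1 - α)) + 4 * hardyConst n α R

theorem radialConst_ne_top (n : ℕ) (α R : ℝ) : radialConst n α R ≠ ⊤ := by
  simp [radialConst, hardyConst, ENNReal.mul_ne_top]

theorem radialHolder_extend (hn : 2 ≤ n) (hα0 : 0 < α) (hα1 : α < 1) (hΩ : IsOpen Ω)
    [IsFiniteMeasure (volume.restrict Ω)] (hP : P ∉ Ω) {R : ℝ} (hR0 : 0 ≤ R)
    (hR : ∀ x ∈ Ω, ‖x - P‖ ≤ R) {u : L2 Ω} (hu : u ∈ h10 Ω) :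
    RadialHolder P α 1 (extend u) (radialConst n α R * gradNorm u) := by
  have h := RadialHolder.of_le (κ := 1) hn hα1 one_pos le_rfl (measurable_extend hΩ u)
    (eLpNorm_weighted_extend_le hn hα0 hα1 hΩ hP hR0 hR hu)
    (B := ENNReal.ofReal (R ^ (1 - α)) * gradNorm u) (fun σ hσ => by
      refine (eLpNorm_dilDiff_extend_le hα1 hΩ hR0 hR hu hσ.1.le).trans (le_of_eq ?_)
      rw [ENNReal.ofReal_mul (by positivity), Real.rpow_one]
      ring)
  convert h using 1
  rw [radialConst]
  ring

theorem gradNorm_ne_top (u : L2 Ω) : gradNorm u ≠ ⊤ :=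
  ENNReal.sum_ne_top.2 fun _ _ => (Lp.memLp _).2.ne

/-- By convexity the domain is star-shaped about the boundary point `P`. Contractions keep points
inside, so the left integral never sees the zero extension, and outward dilations keep outside
points outside. -/
theorem dil_mem (hΩ : IsOpen Ω) (hconv : Convex ℝ Ω) (hP : P ∈ closure Ω) {x : EuclideanSpace ℝ (Fin n)}
    (hx : x ∈ Ω) {τ : ℝ} (h0 : 0 < τ) (h1 : τ ≤ 1) : dil P τ x ∈ Ω := by
  have h2 := hconv.combo_closure_interior_mem_interior hP (by rwa [hΩ.interior_eq])
    (sub_nonneg.2 h1) h0 (by ring)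
  rw [hΩ.interior_eq] at h2
  convert h2 using 1
  simp only [dil]
  module

/-- The product of a Hölder continuous function and an element of `H₀¹(Ω)`. -/
theorem exists_radialHolder_mul (hn : 2 ≤ n) (hα0 : 0 < α) (hα1 : α < 1) (hΩ : IsOpen Ω)
    (hconv : Convex ℝ Ω) [IsFiniteMeasure (volume.restrict Ω)] (hP : P ∉ Ω) (hP' : P ∈ closure Ω)
    {R : ℝ} (hR0 : 0 ≤ R) (hR : ∀ x ∈ Ω, ‖x - P‖ ≤ R) {ρ : EuclideanSpace ℝ (Fin n) → ℝ}
    {lam M ρm : ℝ} (hlam : α < lam) (hlam1 : lam ≤ 1) (hρm : ∀ x ∈ Ω, |ρ x| ≤ ρm)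
    (hρc : ContinuousOn ρ Ω)
    (hρ : ∀ x ∈ Ω, ∀ y ∈ Ω, |ρ x - ρ y| ≤ M * ‖x - y‖ ^ lam) {u : L2 Ω} (hu : u ∈ h10 Ω) :
    ∃ C, C ≠ ⊤ ∧ RadialHolder P α lam (Ω.indicator fun x => (ρ x : ℂ) * u x) C := by
  classical
  have hlam0 : 0 < lam := hα0.trans hlam
  have hmul : (Ω.indicator fun x => (ρ x : ℂ) * u x) =
      fun x => ((Ω.indicator ρ x : ℝ) : ℂ) * extend u x := by
    funext x
    by_cases hx : x ∈ Ω <;> simp [hx, extend]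
  have hρmeas : Measurable (Ω.indicator ρ) := by
    have := hρc.measurable_piecewise (g := (0 : EuclideanSpace ℝ (Fin n) → ℝ))
      continuousOn_const hΩ.measurableSet
    rwa [Set.piecewise_eq_indicator] at this
  have hbd : ∀ x, |Ω.indicator ρ x| ≤ |ρm| := by
    intro x
    by_cases hx : x ∈ Ω
    · simpa [hx] using (hρm x hx).trans (le_abs_self _)
    · simp [hx]
  have hF : Measurable fun x => ((Ω.indicator ρ x : ℝ) : ℂ) * extend u x :=
    (Complex.measurable_ofReal.comp hρmeas).mul (measurable_extend hΩ u)
  rw [hmul]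
  have hA : eLpNorm (weighted P α fun x => ((Ω.indicator ρ x : ℝ) : ℂ) * extend u x) 2 volume ≤
      ENNReal.ofReal |ρm| * (hardyConst n α R * gradNorm u) := by
    refine (eLpNorm_le_mul_eLpNorm_of_ae_le_mul (g := weighted P α (extend u))
      (Eventually.of_forall fun x => ?_) 2).trans
      (mul_le_mul' le_rfl (eLpNorm_weighted_extend_le hn hα0 hα1 hΩ hP hR0 hR hu))
    rw [norm_weighted, norm_weighted, norm_mul, Complex.norm_real, Real.norm_eq_abs, mul_left_comm]
    exact mul_le_mul_of_nonneg_right (hbd x) (by positivity)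
  -- With `y` the dilated point, `ρ(x)u(x) - ρ(y)u(y) = ρ(x)(u(x)-u(y)) + (ρ(x)-ρ(y))u(y)`. Since
  -- `|x-y| = (σ-1)|x-P|`, the Hölder condition against the weight leaves `|x-P|^(λ-α) (σ-1)^λ`,
  -- which is bounded because `λ > α`.
  have hpt : ∀ σ ∈ Set.Ioc (1 : ℝ) 2, ∀ x,
      ‖dilDiff P α (fun x => ((Ω.indicator ρ x : ℝ) : ℂ) * extend u x) σ x‖ ≤
        ‖|ρm| * ‖dilDiff P α (extend u) σ x‖ +
          (|M| * R ^ (lam - α) * (σ - 1) ^ lam) * ‖extend u (dil P σ x)‖‖ := by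
    intro σ hσ x
    have hσ0 : 0 ≤ σ - 1 := by linarith [hσ.1]
    rw [Real.norm_of_nonneg (by positivity), norm_dilDiff, norm_dilDiff]
    by_cases hx : x ∈ Ω
    · have hr : 0 < ‖x - P‖ := norm_pos_iff.2 (sub_ne_zero.2 fun hc => hP (hc ▸ hx))
      have hρ' : ‖x - P‖ ^ (-α) * (|Ω.indicator ρ x - Ω.indicator ρ (dil P σ x)| *
          ‖extend u (dil P σ x)‖) ≤
          (|M| * R ^ (lam - α) * (σ - 1) ^ lam) * ‖extend u (dil P σ x)‖ := by
        by_cases hy : dil P σ x ∈ Ω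
        · rw [← mul_assoc]
          refine mul_le_mul_of_nonneg_right ?_ (norm_nonneg _)
          rw [Set.indicator_of_mem hx, Set.indicator_of_mem hy]
          have h1 : ‖x - dil P σ x‖ = (σ - 1) * ‖x - P‖ := by
            rw [show x - dil P σ x = -((σ - 1) • (x - P)) by simp only [dil]; module, norm_neg,
              norm_smul, Real.norm_of_nonneg hσ0]
          have h2 := hρ x hx _ hy
          rw [h1, Real.mul_rpow hσ0 hr.le] at h2
          calc ‖x - P‖ ^ (-α) * |ρ x - ρ (dil P σ x)|
              ≤ ‖x - P‖ ^ (-α) * (|M| * ((σ - 1) ^ lam * ‖x - P‖ ^ lam)) := by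
                refine mul_le_mul_of_nonneg_left (h2.trans ?_) (by positivity)
                exact mul_le_mul_of_nonneg_right (le_abs_self _) (by positivity)
            _ = |M| * (‖x - P‖ ^ (-α) * ‖x - P‖ ^ lam) * (σ - 1) ^ lam := by ring
            _ = |M| * ‖x - P‖ ^ (lam - α) * (σ - 1) ^ lam := by
                rw [← Real.rpow_add hr, neg_add_eq_sub]
            _ ≤ _ := by
                refine mul_le_mul_of_nonneg_right (mul_le_mul_of_nonneg_left ?_ (abs_nonneg _))
                  (by positivity)
                exact Real.rpow_le_rpow hr.le (hR x hx) (by linarith)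
        · simp [extend, hy]
      refine le_trans ?_ (add_le_add le_rfl hρ')
      have h3 : ((Ω.indicator ρ x : ℝ) : ℂ) * extend u x -
          ((Ω.indicator ρ (dil P σ x) : ℝ) : ℂ) * extend u (dil P σ x) =
          ((Ω.indicator ρ x : ℝ) : ℂ) * (extend u x - extend u (dil P σ x)) +
          ((Ω.indicator ρ x - Ω.indicator ρ (dil P σ x) : ℝ) : ℂ) * extend u (dil P σ x) := by
        push_cast; ring
      rw [h3]
      have h4 := norm_add_le (((Ω.indicator ρ x : ℝ) : ℂ) * (extend u x - extend u (dil P σ x)))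
        (((Ω.indicator ρ x - Ω.indicator ρ (dil P σ x) : ℝ) : ℂ) * extend u (dil P σ x))
      rw [norm_mul, norm_mul, Complex.norm_real, Complex.norm_real, Real.norm_eq_abs,
        Real.norm_eq_abs] at h4
      refine (mul_le_mul_of_nonneg_left h4 (by positivity)).trans ?_
      rw [mul_add, mul_left_comm]
      refine add_le_add (mul_le_mul_of_nonneg_right (hbd x) (by positivity)) le_rfl
    · have hy : dil P σ x ∉ Ω := by
        intro hc
        refine hx ?_
        have hσ1 : 0 < σ := by linarith [hσ.1]
        have := dil_mem hΩ hconv hP' hc (inv_pos.2 hσ1) (inv_le_one_of_one_le₀ hσ.1.le)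
        rwa [dil_dil, inv_mul_cancel₀ hσ1.ne', dil_one] at this
      simp [extend, hx, hy]
  refine ⟨_, ?_, RadialHolder.of_le hn hα1 hlam0 hlam1 hF hA
    (B := ENNReal.ofReal |ρm| * (ENNReal.ofReal (R ^ (1 - α)) * gradNorm u) +
      ENNReal.ofReal (|M| * R ^ (lam - α)) * eLpNorm (extend u) 2 volume) fun σ hσ => ?_⟩
  · have := gradNorm_ne_top u
    have h2 := (memLp_extend hΩ u).2.ne
    have h3 : hardyConst n α R ≠ ⊤ :=
      ENNReal.mul_ne_top ENNReal.ofReal_ne_top ENNReal.ofReal_ne_top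
    finiteness
  · have hσ0 : 0 ≤ σ - 1 := by linarith [hσ.1]
    have hσ1 : 0 < σ := by linarith [hσ.1]
    -- The gradient gives the first power of `σ - 1`; as `σ ≤ 2` and `λ ≤ 1`, it can be weakened to
    -- the power `λ` to match the contribution of `ρ`.
    have hle : σ - 1 ≤ (σ - 1) ^ lam := by
      conv_lhs => rw [← Real.rpow_one (σ - 1)]
      exact Real.rpow_le_rpow_of_exponent_ge (by linarith [hσ.1]) (by linarith [hσ.2]) hlam1
    have hm1 : Measurable fun x => |ρm| * ‖dilDiff P α (extend u) σ x‖ :=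
      (measurable_dilDiff (measurable_extend hΩ u) σ).norm.const_mul _
    have hm2 : Measurable fun x =>
        (|M| * R ^ (lam - α) * (σ - 1) ^ lam) * ‖extend u (dil P σ x)‖ :=
      ((measurable_extend hΩ u).comp (continuous_dil P σ).measurable).norm.const_mul _
    refine (eLpNorm_mono (hpt σ hσ)).trans ((eLpNorm_add_le hm1.aestronglyMeasurable
      hm2.aestronglyMeasurable one_le_two).trans ?_)
    have e1 : eLpNorm (fun x => |ρm| * ‖dilDiff P α (extend u) σ x‖) 2 volume =
        ENNReal.ofReal |ρm| * eLpNorm (dilDiff P α (extend u) σ) 2 volume := by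
      have := eLpNorm_const_smul |ρm| (fun x => ‖dilDiff P α (extend u) σ x‖) 2 volume
      rw [eLpNorm_norm, Real.enorm_of_nonneg (abs_nonneg _)] at this
      exact this
    have e2 : eLpNorm (fun x => (|M| * R ^ (lam - α) * (σ - 1) ^ lam) *
        ‖extend u (dil P σ x)‖) 2 volume =
        ENNReal.ofReal (|M| * R ^ (lam - α) * (σ - 1) ^ lam) *
          eLpNorm (fun x => extend u (dil P σ x)) 2 volume := by
      have := eLpNorm_const_smul (|M| * R ^ (lam - α) * (σ - 1) ^ lam)
        (fun x => ‖extend u (dil P σ x)‖) 2 volume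
      rw [eLpNorm_norm, Real.enorm_of_nonneg (by positivity)] at this
      exact this
    rw [e1, e2, add_mul, ENNReal.ofReal_mul (by positivity : 0 ≤ |M| * R ^ (lam - α)),
      eLpNorm_comp_dil P hσ1]
    refine add_le_add ?_ ?_
    · calc ENNReal.ofReal |ρm| * eLpNorm (dilDiff P α (extend u) σ) 2 volume
          ≤ ENNReal.ofReal |ρm| * (ENNReal.ofReal (R ^ (1 - α) * (σ - 1) ^ lam) * gradNorm u) := by
            gcongr
            refine (eLpNorm_dilDiff_extend_le hα1 hΩ hR0 hR hu hσ.1.le).trans ?_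
            gcongr
        _ = _ := by rw [ENNReal.ofReal_mul (by positivity)]; ring
    · have h5 : ENNReal.ofReal (σ ^ (-(n : ℝ) / 2)) ≤ 1 := by
        rw [← ENNReal.ofReal_one]
        refine ENNReal.ofReal_le_ofReal (Real.rpow_le_one_of_one_le_of_nonpos hσ.1.le ?_)
        have : (0 : ℝ) ≤ n := n.cast_nonneg
        linarith
      calc ENNReal.ofReal (|M| * R ^ (lam - α)) * ENNReal.ofReal ((σ - 1) ^ lam) *
            (ENNReal.ofReal (σ ^ (-(n : ℝ) / 2)) * eLpNorm (extend u) 2 volume)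
          ≤ ENNReal.ofReal (|M| * R ^ (lam - α)) * ENNReal.ofReal ((σ - 1) ^ lam) *
            (1 * eLpNorm (extend u) 2 volume) := by gcongr
        _ = _ := by ring

end Extension

/-! ### The fractional derivatives as integrals over dilation ratios -/

section RayFormulas

open scoped ENNReal

variable {n : ℕ} {Ω : Set (EuclideanSpace ℝ (Fin n))} {P : EuclideanSpace ℝ (Fin n)} {α : ℝ}

theorem rayPoint_eq_dil (P Q : EuclideanSpace ℝ (Fin n)) (t : ℝ) :
    rayPoint P Q t = dil P (t / ‖Q - P‖) Q := by
  simp [rayPoint, dil, smul_smul, div_eq_mul_inv]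

/-- Homogeneity in `|Q-P|`. The remaining factor `|Q-P|⁻¹` is cancelled by the Jacobian of `t =
|Q-P| τ`. -/
theorem kipriyanovIntegrand_scaled (hΩ : IsOpen Ω) (hconv : Convex ℝ Ω) (hP : P ∉ Ω)
    (hP' : P ∈ closure Ω) {f : EuclideanSpace ℝ (Fin n) → ℂ} {Q : EuclideanSpace ℝ (Fin n)}
    (hQ : Q ∈ Ω) {τ : ℝ} (hτ : τ ∈ Set.Ioo (0 : ℝ) 1) :
    kipriyanovIntegrand P α f Q (‖Q - P‖ * τ) =
      ((‖Q - P‖⁻¹ : ℝ) : ℂ) * leftIntegrand P α (Ω.indicator f) Q τ := by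
  have hr : 0 < ‖Q - P‖ := norm_pos_iff.2 (sub_ne_zero.2 fun hc => hP (hc ▸ hQ))
  have h1 : 0 < 1 - τ := sub_pos.2 hτ.2
  rw [kipriyanovIntegrand, rayPoint_eq_dil, mul_div_cancel_left₀ _ hr.ne', leftIntegrand, dilDiff,
    weighted, Set.indicator_of_mem hQ, Set.indicator_of_mem (dil_mem hΩ hconv hP' hQ hτ.1 hτ.2.le),
    leftKernel, show ‖Q - P‖ - ‖Q - P‖ * τ = ‖Q - P‖ * (1 - τ) by ring,
    Real.mul_rpow hr.le h1.le]
  have h2 : τ ^ (n - 1) / (‖Q - P‖ ^ (α + 1) * (1 - τ) ^ (α + 1)) =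
      ‖Q - P‖⁻¹ * (τ ^ (n - 1) * (1 - τ) ^ (-α - 1) * ‖Q - P‖ ^ (-α)) := by
    rw [show -α - 1 = -(α + 1) by ring, Real.rpow_neg h1.le, Real.rpow_neg hr.le,
      Real.rpow_add_one hr.ne']
    field_simp
  rw [h2]
  push_cast
  ring

theorem kipriyanov_eq (hΩ : IsOpen Ω) (hconv : Convex ℝ Ω) (hP : P ∉ Ω)
    (hP' : P ∈ closure Ω) {f : EuclideanSpace ℝ (Fin n) → ℂ} {Q : EuclideanSpace ℝ (Fin n)}
    (hQ : Q ∈ Ω) :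
    kipriyanov P α f Q =
      ((α / Real.Gamma (1 - α) : ℝ) : ℂ) * leftIntegral P α (Ω.indicator f) Q +
      (((n - 1).factorial / Real.Gamma (n - α) : ℝ) : ℂ) * weighted P α (Ω.indicator f) Q := by
  have hr : 0 < ‖Q - P‖ := norm_pos_iff.2 (sub_ne_zero.2 fun hc => hP (hc ▸ hQ))
  have h1 : ∫ t in (0 : ℝ)..‖Q - P‖, kipriyanovIntegrand P α f Q t =
      leftIntegral P α (Ω.indicator f) Q := by
    have h2 := intervalIntegral.smul_integral_comp_mul_left (a := 0) (b := 1)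
      (kipriyanovIntegrand P α f Q) ‖Q - P‖
    rw [mul_zero, mul_one] at h2
    rw [← h2, intervalIntegral.integral_of_le zero_le_one, integral_Ioc_eq_integral_Ioo,
      setIntegral_congr_fun measurableSet_Ioo fun τ hτ =>
        kipriyanovIntegrand_scaled hΩ hconv hP hP' hQ hτ, integral_const_mul, leftIntegral,
      Complex.real_smul, ← mul_assoc, ← Complex.ofReal_mul, mul_inv_cancel₀ hr.ne']
    simp
  rw [kipriyanov, h1, weighted, Set.indicator_of_mem hQ]
  push_cast
  ring

theorem intervalIntegrable_kipriyanovIntegrand (hΩ : IsOpen Ω) (hconv : Convex ℝ Ω) (hP : P ∉ Ω)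
    (hP' : P ∈ closure Ω) {f : EuclideanSpace ℝ (Fin n) → ℂ} {Q : EuclideanSpace ℝ (Fin n)}
    (hQ : Q ∈ Ω) (h : IntegrableOn (leftIntegrand P α (Ω.indicator f) Q) (Set.Ioo 0 1)) :
    IntervalIntegrable (kipriyanovIntegrand P α f Q) volume 0 ‖Q - P‖ := by
  have hr : 0 < ‖Q - P‖ := norm_pos_iff.2 (sub_ne_zero.2 fun hc => hP (hc ▸ hQ))
  have h1 : IntervalIntegrable (fun τ => kipriyanovIntegrand P α f Q (‖Q - P‖ * τ)) volume 0 1 := by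
    rw [intervalIntegrable_iff_integrableOn_Ioo_of_le zero_le_one]
    refine IntegrableOn.congr_fun (Integrable.const_mul h ((‖Q - P‖⁻¹ : ℝ) : ℂ))
      (fun τ hτ => ?_) measurableSet_Ioo
    exact (kipriyanovIntegrand_scaled hΩ hconv hP hP' hQ hτ).symm
  have h2 := h1.comp_mul_left (c := ‖Q - P‖⁻¹)
  simpa [mul_inv_cancel_left₀ hr.ne', hr.ne'] using h2

/-! ### The right-side derivative -/

/-- Without an upper bound the supremum in `rayLength` would take its default value. -/
theorem bddAbove_ray (hΩ : Bornology.IsBounded Ω) {Q : EuclideanSpace ℝ (Fin n)}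
    (hQ : 0 < ‖Q - P‖) : BddAbove {t : ℝ | 0 ≤ t ∧ rayPoint P Q t ∈ Ω} := by
  obtain ⟨R, hR⟩ := hΩ.subset_closedBall P
  refine ⟨R, fun t ht => ?_⟩
  have h1 := mem_closedBall_iff_norm.1 (hR ht.2)
  rwa [rayPoint_eq_dil, norm_dil_sub P (by have := ht.1; positivity), div_mul_cancel₀ _ hQ.ne'] at h1

theorem dil_notMem_of_rayLength_lt (hΩ : Bornology.IsBounded Ω) {Q : EuclideanSpace ℝ (Fin n)}
    (hQ : 0 < ‖Q - P‖) {σ : ℝ} (h0 : 0 ≤ σ) (h : rayLength Ω P Q < σ * ‖Q - P‖) :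
    dil P σ Q ∉ Ω := by
  intro hc
  refine h.not_ge (le_csSup (bddAbove_ray hΩ hQ) ⟨by positivity, ?_⟩)
  rwa [rayPoint_eq_dil, mul_div_cancel_right₀ _ hQ.ne']

theorem norm_lt_rayLength (hΩ : IsOpen Ω) (hb : Bornology.IsBounded Ω)
    {Q : EuclideanSpace ℝ (Fin n)} (hQ : Q ∈ Ω) (hr : 0 < ‖Q - P‖) :
    ‖Q - P‖ < rayLength Ω P Q := by
  have hc : Continuous fun σ : ℝ => dil P σ Q := by unfold dil; fun_prop
  have h1 : ∀ᶠ σ in 𝓝 (1 : ℝ), dil P σ Q ∈ Ω :=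
    hc.continuousAt.eventually (hΩ.mem_nhds (by simpa using hQ))
  obtain ⟨σ, h2, h3⟩ := (h1.filter_mono nhdsWithin_le_nhds |>.and
    (self_mem_nhdsWithin : Set.Ioi (1 : ℝ) ∈ 𝓝[>] 1)).exists
  have h4 : (1 : ℝ) < σ := h3
  by_contra hle
  have h5 : rayLength Ω P Q < σ * ‖Q - P‖ := by nlinarith
  exact dil_notMem_of_rayLength_lt hb hr (by linarith) h5 h2

theorem rayPoint_mem_of_lt (hΩ : IsOpen Ω) (hconv : Convex ℝ Ω) (hP' : P ∈ closure Ω)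
    {Q : EuclideanSpace ℝ (Fin n)} (hQ : Q ∈ Ω) (hr : 0 < ‖Q - P‖) {t : ℝ} (h0 : 0 < t)
    (h : t < rayLength Ω P Q) : rayPoint P Q t ∈ Ω := by
  have hne : {t : ℝ | 0 ≤ t ∧ rayPoint P Q t ∈ Ω}.Nonempty :=
    ⟨‖Q - P‖, hr.le, by rwa [rayPoint_eq_dil, div_self hr.ne', dil_one]⟩
  obtain ⟨s, hs, hts⟩ := exists_lt_of_lt_csSup hne h
  have hs0 : 0 < s := h0.trans hts
  have h1 := dil_mem hΩ hconv hP' hs.2 (div_pos h0 hs0) ((div_le_one hs0).2 hts.le)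
  rw [rayPoint_eq_dil, dil_dil] at h1
  rw [rayPoint_eq_dil]
  convert h1 using 2
  field_simp

theorem setIntegral_rightKernel (hα0 : 0 < α) {c : ℝ} (h0 : 0 < c) (h1 : c < 1) :
    ∫ τ in Set.Ioo 0 c, rightKernel α τ = (c / (1 - c)) ^ α / α := by
  set G : ℝ → ℝ := fun τ => τ ^ α * (1 - τ) ^ (-α) / α
  have hderiv : ∀ τ ∈ Set.Ioo 0 c, HasDerivAt G (rightKernel α τ) τ := by
    intro τ hτ
    have h2 : 0 < 1 - τ := by linarith [hτ.2]
    have d1 : HasDerivAt (fun τ : ℝ => τ ^ α) (α * τ ^ (α - 1)) τ :=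
      Real.hasDerivAt_rpow_const (Or.inl hτ.1.ne')
    have d3 : HasDerivAt (fun τ : ℝ => (1 - τ) ^ (-α)) (-1 * (-α) * (1 - τ) ^ (-α - 1)) τ :=
      ((hasDerivAt_id τ).const_sub 1).rpow_const (Or.inl h2.ne')
    refine HasDerivAt.congr_deriv (f := G) ((d1.mul d3).div_const α) ?_
    have e3 : τ ^ α = τ ^ (α - 1) * τ := by
      rw [← Real.rpow_add_one hτ.1.ne']; congr 1; ring
    have e5 : (1 - τ) ^ (-α) = (1 - τ) ^ (-α - 1) * (1 - τ) := (rpow_neg_sub_one h2).symm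
    rw [rightKernel, e3, e5]
    field_simp
    ring
  have hcont : ContinuousOn G (Set.Icc 0 c) := by
    intro τ hτ
    have h2 : 0 < 1 - τ := by linarith [hτ.2]
    refine ContinuousAt.continuousWithinAt (ContinuousAt.div_const (ContinuousAt.mul ?_ ?_) _)
    · exact Real.continuousAt_rpow_const _ _ (Or.inr hα0.le)
    · exact (continuousAt_const.sub continuousAt_id).rpow_const (Or.inl h2.ne')
  -- The kernel may be unbounded at `0`; its integrability follows from its sign and the continuity
  -- of the primitive.
  have hint := intervalIntegral.intervalIntegrable_deriv_of_nonneg (a := 0) (b := c)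
    (by rwa [Set.uIcc_of_le h0.le]) (g' := rightKernel α)
    (by simpa [h0.le] using hderiv)
    (fun τ hτ => by
      rw [min_eq_left h0.le, max_eq_right h0.le] at hτ
      exact rightKernel_nonneg ⟨hτ.1, hτ.2.trans h1⟩)
  rw [← integral_Ioc_eq_integral_Ioo, ← intervalIntegral.integral_of_le h0.le,
    intervalIntegral.integral_eq_sub_of_hasDerivAt_of_le h0.le hcont hderiv hint]
  have h2 : 0 < 1 - c := sub_pos.2 h1
  simp only [G, Real.zero_rpow hα0.ne', zero_mul, zero_div, sub_zero]
  rw [Real.div_rpow h0.le h2.le, Real.rpow_neg h2.le]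
  rfl

theorem setIntegral_inv_comp {r a b : ℝ} (hr : 0 < r) (ha : 0 < a) (hab : a < b) (g : ℝ → ℂ) :
    ∫ τ in Set.Ioo (r / b) (r / a), ((r * τ ^ (-2 : ℝ) : ℝ) : ℂ) * g (r / τ) =
      ∫ t in Set.Ioo a b, g t := by
  have hb : 0 < b := ha.trans hab
  set h : ℝ → ℂ := fun y => (r : ℂ) * (Set.Ioo a b).indicator g (r * y) with hh
  have h1 := integral_comp_rpow_Ioi h (p := -1) (by norm_num)
  have h2 : ∫ y in Set.Ioi (0 : ℝ), h y = ∫ t in Set.Ioo a b, g t := by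
    rw [hh, integral_const_mul, integral_comp_mul_left_Ioi (fun t => (Set.Ioo a b).indicator g t) 0 hr,
      mul_zero, setIntegral_indicator measurableSet_Ioo, Complex.real_smul, ← mul_assoc,
      ← Complex.ofReal_mul, mul_inv_cancel₀ hr.ne', Complex.ofReal_one, one_mul]
    congr 2
    ext t
    simp only [Set.mem_inter_iff, Set.mem_Ioi, Set.mem_Ioo]
    exact ⟨fun ht => ht.2, fun ht => ⟨ha.trans ht.1, ht⟩⟩
  rw [← h2, ← h1]
  have h3 : ∀ x ∈ Set.Ioi (0 : ℝ), (|(-1 : ℝ)| * x ^ ((-1 : ℝ) - 1)) • h (x ^ (-1 : ℝ)) =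
      (Set.Ioo (r / b) (r / a)).indicator
        (fun τ => ((r * τ ^ (-2 : ℝ) : ℝ) : ℂ) * g (r / τ)) x := by
    intro x hx
    have hx0 : 0 < x := hx
    have h4 : r * x ^ (-1 : ℝ) = r / x := by rw [Real.rpow_neg_one, div_eq_mul_inv]
    have h5 : r / x ∈ Set.Ioo a b ↔ x ∈ Set.Ioo (r / b) (r / a) := by
      simp only [Set.mem_Ioo]
      rw [lt_div_iff₀ hx0, div_lt_iff₀ hx0, div_lt_iff₀ hb, lt_div_iff₀ ha]
      constructor
      · rintro ⟨h6, h7⟩; constructor <;> linarith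
      · rintro ⟨h6, h7⟩; constructor <;> linarith
    simp only [hh, h4]
    by_cases h6 : x ∈ Set.Ioo (r / b) (r / a)
    · rw [Set.indicator_of_mem h6, Set.indicator_of_mem (h5.2 h6), Complex.real_smul]
      norm_num
      ring
    · rw [Set.indicator_of_notMem h6, Set.indicator_of_notMem (fun hc => h6 (h5.1 hc))]
      simp
  rw [setIntegral_congr_fun measurableSet_Ioi h3, setIntegral_indicator measurableSet_Ioo]
  congr 2
  ext t
  simp only [Set.mem_inter_iff, Set.mem_Ioi, Set.mem_Ioo]
  exact ⟨fun ht => ⟨(div_pos hr hb).trans ht.1, ht⟩, fun ht => ht.2⟩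

/-- For these ratios the point at distance `|Q-P|/τ` lies beyond the end of the ray, where the
extension vanishes, and only the kernel is integrated. This is the origin of the explicit terms in
the right-side derivative. -/
theorem setIntegral_rightIntegrand_of_outside (hα0 : 0 < α) (hb : Bornology.IsBounded Ω)
    {f : EuclideanSpace ℝ (Fin n) → ℂ} {Q : EuclideanSpace ℝ (Fin n)} (hQ : Q ∈ Ω)
    (hr : 0 < ‖Q - P‖) {c : ℝ} (h0 : 0 < c) (h1 : c < 1)
    (hc : c * rayLength Ω P Q ≤ ‖Q - P‖) :
    ∫ τ in Set.Ioo 0 c, rightIntegrand P α (Ω.indicator f) Q τ =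
      (((c / (1 - c)) ^ α / α * ‖Q - P‖ ^ (-α) : ℝ) : ℂ) * f Q := by
  have h2 : ∀ τ ∈ Set.Ioo 0 c, rightIntegrand P α (Ω.indicator f) Q τ =
      (rightKernel α τ : ℂ) * (((‖Q - P‖ ^ (-α) : ℝ) : ℂ) * f Q) := by
    intro τ hτ
    have h3 : dil P τ⁻¹ Q ∉ Ω := by
      refine dil_notMem_of_rayLength_lt hb hr (inv_pos.2 hτ.1).le ?_
      rw [← div_eq_inv_mul, lt_div_iff₀ hτ.1]
      refine lt_of_lt_of_le ?_ hc
      rw [mul_comm]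
      refine mul_lt_mul_of_pos_right hτ.2 ?_
      by_contra hneg
      refine (not_lt.2 (not_lt.1 hneg)) ?_
      refine lt_of_lt_of_le hr (le_csSup (bddAbove_ray hb hr) ⟨hr.le, ?_⟩)
      rwa [rayPoint_eq_dil, div_self hr.ne', dil_one]
    rw [rightIntegrand, dilDiff, weighted, Set.indicator_of_mem hQ, Set.indicator_of_notMem h3,
      sub_zero]
  rw [setIntegral_congr_fun measurableSet_Ioo h2, integral_mul_const, integral_complex_ofReal,
    setIntegral_rightKernel hα0 h0 h1]
  push_cast
  ring

/-- The condition `t > r + ε` means `τ < r/(r+ε)`. Both cases in the definition of `ψ_ε⁻`, together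
with the boundary term, describe the same integral of the zero extension truncated in this way. -/
theorem rightDerivTrunc_eq (hα0 : 0 < α) (hΩ : IsOpen Ω) (hconv : Convex ℝ Ω)
    (hb : Bornology.IsBounded Ω) (hP : P ∉ Ω) (hP' : P ∈ closure Ω)
    {f : EuclideanSpace ℝ (Fin n) → ℂ} {Q : EuclideanSpace ℝ (Fin n)} (hQ : Q ∈ Ω)
    (h : IntegrableOn (rightIntegrand P α (Ω.indicator f) Q) (Set.Ioo 0 1)) {ε : ℝ} (hε : 0 < ε) :
    rightDerivTrunc Ω P α ε f Q = ((α / Real.Gamma (1 - α) : ℝ) : ℂ) *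
      ∫ τ in Set.Ioo 0 (‖Q - P‖ / (‖Q - P‖ + ε)), rightIntegrand P α (Ω.indicator f) Q τ := by
  have hr : 0 < ‖Q - P‖ := norm_pos_iff.2 (sub_ne_zero.2 fun hc => hP (hc ▸ hQ))
  have hd := norm_lt_rayLength (P := P) hΩ hb hQ hr
  set r := ‖Q - P‖ with hrdef
  set d := rayLength Ω P Q with hddef
  have hd0 : 0 < d := hr.trans hd
  have hdr : 0 < d - r := sub_pos.2 hd
  have hrα : r ^ α * r ^ (-α) = 1 := by rw [← Real.rpow_add hr, add_neg_cancel, Real.rpow_zero]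
  rw [rightDerivTrunc, psiMinus]
  split_ifs with hcase
  · have hεd : r + ε ≤ d := by linarith
    -- The ratios split at `r/d`, which corresponds to the end of the ray: the part beyond it is the
    -- term `(d-r)^(-α)`, the rest is `ψ_ε⁻`.
    have e1 : ∫ τ in Set.Ioo 0 (r / d), rightIntegrand P α (Ω.indicator f) Q τ =
        (((d - r) ^ (-α) / α : ℝ) : ℂ) * f Q := by
      rw [setIntegral_rightIntegrand_of_outside hα0 hb hQ hr (div_pos hr hd0)
        ((div_lt_one hd0).2 hd) (le_of_eq (div_mul_cancel₀ _ hd0.ne'))]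
      congr 2
      rw [show r / d / (1 - r / d) = r / (d - r) by field_simp, Real.div_rpow hr.le hdr.le,
        Real.rpow_neg hdr.le, ← hrdef]
      have h3 : (0 : ℝ) < (d - r) ^ α := by positivity
      field_simp
      exact hrα
    have e2 : ∫ t in (r + ε)..d, (f Q - f (rayPoint P Q t)) / (((t - r) ^ (α + 1) : ℝ) : ℂ) =
        ∫ τ in Set.Ioo (r / d) (r / (r + ε)), rightIntegrand P α (Ω.indicator f) Q τ := by
      rcases hεd.eq_or_lt with heq | hlt
      · rw [heq]; simp
      rw [intervalIntegral.integral_of_le hεd, integral_Ioc_eq_integral_Ioo,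
        ← setIntegral_inv_comp hr (by linarith) hlt]
      refine setIntegral_congr_fun measurableSet_Ioo fun τ hτ => ?_
      have hτ0 : 0 < τ := (div_pos hr hd0).trans hτ.1
      have hτ1 : τ < 1 := hτ.2.trans ((div_lt_one (by linarith)).2 (by linarith))
      have h1τ : 0 < 1 - τ := sub_pos.2 hτ1
      have h3 : r / τ < d := by
        rw [div_lt_iff₀ hτ0]
        have := hτ.1
        rw [div_lt_iff₀ hd0] at this
        linarith
      have h4 := rayPoint_mem_of_lt hΩ hconv hP' hQ hr (div_pos hr hτ0) h3
      have h5 : rayPoint P Q (r / τ) = dil P τ⁻¹ Q := by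
        rw [rayPoint_eq_dil]
        congr 1
        rw [← hrdef]
        field_simp
      rw [h5] at h4 ⊢
      rw [rightIntegrand, dilDiff, weighted, Set.indicator_of_mem hQ, Set.indicator_of_mem h4,
        show r / τ - r = r * ((1 - τ) / τ) by field_simp, Real.mul_rpow hr.le (by positivity),
        Real.div_rpow h1τ.le hτ0.le]
      have h6 : r * τ ^ (-2 : ℝ) / (r ^ (α + 1) * ((1 - τ) ^ (α + 1) / τ ^ (α + 1))) =
          rightKernel α τ * r ^ (-α) := by
        have h7 : τ ^ (α - 1) = τ ^ (-2 : ℝ) * τ ^ (α + 1) := by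
          rw [← Real.rpow_add hτ0]; congr 1; ring
        have h8 : (1 - τ) ^ (-α - 1) = ((1 - τ) ^ (α + 1))⁻¹ := by
          rw [← Real.rpow_neg h1τ.le]; congr 1; ring
        have h9 : r ^ (α + 1) = r ^ α * r := Real.rpow_add_one hr.ne' α
        have h10 : r ^ (-α) = (r ^ α)⁻¹ := Real.rpow_neg hr.le α
        rw [rightKernel, h7, h8, h9, h10]
        have h11 : (0 : ℝ) < τ ^ (α + 1) := by positivity
        have h12 : (0 : ℝ) < (1 - τ) ^ (α + 1) := by positivity
        have h13 : (0 : ℝ) < r ^ α := by positivity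
        field_simp
      have h14 := congrArg (fun z : ℝ => (z : ℂ) * (f Q - f (dil P τ⁻¹ Q))) h6
      simp only [Complex.ofReal_mul, Complex.ofReal_div] at h14 ⊢
      rw [← hrdef, ← mul_assoc, ← h14]
      ring
    have e3 : ∫ τ in Set.Ioo 0 (r / (r + ε)), rightIntegrand P α (Ω.indicator f) Q τ =
        (∫ τ in Set.Ioo 0 (r / d), rightIntegrand P α (Ω.indicator f) Q τ) +
          ∫ τ in Set.Ioo (r / d) (r / (r + ε)), rightIntegrand P α (Ω.indicator f) Q τ := by
      have hle : r / d ≤ r / (r + ε) := div_le_div_of_nonneg_left hr.le (by linarith) hεd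
      have h1 : r / (r + ε) ≤ 1 := (div_le_one (by linarith)).2 (by linarith)
      rw [← integral_Ioc_eq_integral_Ioo, ← integral_Ioc_eq_integral_Ioo,
        ← integral_Ioc_eq_integral_Ioo, ← intervalIntegral.integral_of_le (by positivity),
        ← intervalIntegral.integral_of_le (by positivity),
        ← intervalIntegral.integral_of_le hle, intervalIntegral.integral_add_adjacent_intervals]
      · rw [intervalIntegrable_iff_integrableOn_Ioo_of_le (by positivity)]
        exact h.mono_set (Set.Ioo_subset_Ioo le_rfl (hle.trans h1))
      · rw [intervalIntegrable_iff_integrableOn_Ioo_of_le hle]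
        exact h.mono_set (Set.Ioo_subset_Ioo (by positivity) h1)
    rw [e3, e1, e2, ← hrdef, ← hddef]
    push_cast
    have hαc : (α : ℂ) ≠ 0 := by exact_mod_cast hα0.ne'
    field_simp
  -- Now all ratios concern points outside the domain. The integral equals `ε^(-α)/α` times `f(Q)`,
  -- and the powers of `d - r` in the definition cancel.
  · rw [not_le] at hcase
    have hrε : 0 < r + ε := by linarith
    rw [setIntegral_rightIntegrand_of_outside hα0 hb hQ hr (div_pos hr hrε)
      ((div_lt_one hrε).2 (by linarith))
      (by rw [div_mul_eq_mul_div, div_le_iff₀ hrε]; exact mul_le_mul_of_nonneg_left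
            (by rw [← hddef]; linarith) hr.le),
      show r / (r + ε) / (1 - r / (r + ε)) = r / ε by
        rw [one_sub_div hrε.ne', add_sub_cancel_left, div_div_div_cancel_right₀ hrε.ne'], ← hrdef,
      Real.div_rpow hr.le hε.le, Real.rpow_neg hdr.le]
    have h3 : r ^ α / ε ^ α / α * r ^ (-α) = 1 / ε ^ α / α := by
      have : (0 : ℝ) < ε ^ α := by positivity
      field_simp
      exact hrα
    rw [h3]
    push_cast
    have hαc : (α : ℂ) ≠ 0 := by exact_mod_cast hα0.ne'
    field_simp
    ring

end RayFormulas

/-! ### Existence of the right-side derivative as an `L₂` limit -/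

section RightDerivative

open scoped ENNReal

variable {n : ℕ} {Ω : Set (EuclideanSpace ℝ (Fin n))} {P : EuclideanSpace ℝ (Fin n)} {α κ : ℝ}
  {F : EuclideanSpace ℝ (Fin n) → ℂ} {C : ℝ≥0∞}

/-- The part of the integral of `|rightIntegrand|` that is omitted by the truncation. -/
noncomputable def rightTail (P : EuclideanSpace ℝ (Fin n)) (α : ℝ)
    (F : EuclideanSpace ℝ (Fin n) → ℂ) (ε : ℝ) (x : EuclideanSpace ℝ (Fin n)) : ℝ≥0∞ :=
  ∫⁻ τ in Set.Ioo 0 1, {q : EuclideanSpace ℝ (Fin n) × ℝ | ‖q.1 - P‖ / (‖q.1 - P‖ + ε) ≤ q.2}.indicator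
    (fun q => ‖rightIntegrand P α F q.1 q.2‖ₑ) (x, τ)

theorem measurable_rightTail_integrand (h : RadialHolder P α κ F C) (ε : ℝ) :
    Measurable ({q : EuclideanSpace ℝ (Fin n) × ℝ | ‖q.1 - P‖ / (‖q.1 - P‖ + ε) ≤ q.2}.indicator
      (fun q => ‖rightIntegrand P α F q.1 q.2‖ₑ)) :=
  h.measurable_rightIntegrand.enorm.indicator (measurableSet_le (by fun_prop) (by fun_prop))

theorem measurable_rightTail (h : RadialHolder P α κ F C) (ε : ℝ) :
    Measurable (rightTail P α F ε) :=
  (measurable_rightTail_integrand h ε).lintegral_prod_right'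

theorem rightTail_le (ε : ℝ) (x : EuclideanSpace ℝ (Fin n)) :
    rightTail P α F ε x ≤ ∫⁻ τ in Set.Ioo 0 1, ‖rightIntegrand P α F x τ‖ₑ :=
  lintegral_mono fun _ => Set.indicator_le_self _ _ _

/-- Dominated convergence in `τ`, as `r/(r+ε)` tends to `1`. At `x = P` this quotient is `0` and the
tail does not shrink, so the point is excluded. -/
theorem tendsto_rightTail (h : RadialHolder P α κ F C) {x : EuclideanSpace ℝ (Fin n)} (hx : x ≠ P)
    (hfin : ∫⁻ τ in Set.Ioo 0 1, ‖rightIntegrand P α F x τ‖ₑ ≠ ⊤) :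
    Tendsto (fun ε => rightTail P α F ε x) (𝓝[>] 0) (𝓝 0) := by
  have hr : 0 < ‖x - P‖ := norm_pos_iff.2 (sub_ne_zero.2 hx)
  have h0 : (0 : ℝ≥0∞) = ∫⁻ _ in Set.Ioo (0 : ℝ) 1, 0 := by simp
  rw [h0]
  refine tendsto_lintegral_filter_of_dominated_convergence _
    (Eventually.of_forall fun ε => (measurable_rightTail_integrand h ε).comp measurable_prodMk_left)
    (Eventually.of_forall fun ε => Eventually.of_forall fun τ => Set.indicator_le_self _ _ _)
    hfin ?_
  filter_upwards [ae_restrict_mem measurableSet_Ioo] with τ hτ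
  refine tendsto_const_nhds.congr' ?_
  have h1 : Tendsto (fun ε : ℝ => ‖x - P‖ / (‖x - P‖ + ε)) (𝓝[>] 0) (𝓝 1) := by
    have : ContinuousAt (fun ε : ℝ => ‖x - P‖ / (‖x - P‖ + ε)) 0 :=
      continuousAt_const.div (continuousAt_const.add continuousAt_id) (by simpa using hr.ne')
    have h2 := this.tendsto
    simp only [add_zero, div_self hr.ne'] at h2
    exact h2.mono_left nhdsWithin_le_nhds
  filter_upwards [h1.eventually (lt_mem_nhds hτ.2)] with ε hε
  rw [Set.indicator_of_notMem]
  simpa using hε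

/-- Dominated convergence once more, now in `x`: the complete absolute integral is square integrable
and dominates every tail. -/
theorem tendsto_eLpNorm_rightTail (h : RadialHolder P α κ F C) (hα0 : 0 < α) (hκ : α < κ)
    (hC : C ≠ ⊤) (hP : ∀ᵐ x : EuclideanSpace ℝ (Fin n), x ≠ P) :
    Tendsto (fun ε => eLpNorm (rightTail P α F ε) 2 volume) (𝓝[>] 0) (𝓝 0) := by
  have hA := ne_top_of_le_ne_top (ENNReal.mul_ne_top hC (betaConst_ne_top hα0 hκ))
    h.eLpNorm_lintegral_right_le
  have hAm : Measurable fun x => ∫⁻ τ in Set.Ioo 0 1, ‖rightIntegrand P α F x τ‖ₑ :=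
    h.measurable_rightIntegrand.enorm.lintegral_prod_right'
  have hA2 := ENNReal.pow_ne_top (n := 2) hA
  rw [eLpNorm_two_sq] at hA2
  simp only [enorm_eq_self] at hA2
  have hsq : Tendsto (fun ε => ∫⁻ x, rightTail P α F ε x ^ 2) (𝓝[>] 0)
      (𝓝 (∫⁻ _ : EuclideanSpace ℝ (Fin n), 0)) := by
    refine tendsto_lintegral_filter_of_dominated_convergence _
      (Eventually.of_forall fun ε => (measurable_rightTail h ε).pow_const 2)
      (Eventually.of_forall fun ε => Eventually.of_forall fun x =>
        pow_le_pow_left' (rightTail_le ε x) 2) hA2 ?_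
    filter_upwards [ae_lt_top (hAm.pow_const 2) hA2, hP] with x hx hxP
    have hx' : ∫⁻ τ in Set.Ioo 0 1, ‖rightIntegrand P α F x τ‖ₑ ≠ ⊤ := by
      intro hc
      rw [hc] at hx
      simp at hx
    have := ((ENNReal.continuous_pow 2).tendsto 0).comp (tendsto_rightTail h hxP hx')
    simpa [Function.comp_def] using this
  rw [lintegral_zero] at hsq
  have h1 := (ENNReal.continuous_rpow_const (y := 1 / 2)).tendsto 0 |>.comp hsq
  rw [ENNReal.zero_rpow_of_pos (by norm_num)] at h1
  refine h1.congr fun ε => ?_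
  have h2 := eLpNorm_two_sq volume (rightTail P α F ε)
  simp only [enorm_eq_self] at h2
  simp only [Function.comp_apply]
  rw [← h2, ← ENNReal.rpow_natCast, ← ENNReal.rpow_mul]
  norm_num

/-- The right-side derivative exists for functions that satisfy the radial Hölder condition. -/
theorem hasRightDeriv_of_radialHolder (hα0 : 0 < α) (hΩ : IsOpen Ω) (hconv : Convex ℝ Ω)
    (hb : Bornology.IsBounded Ω) (hP : P ∉ Ω) (hP' : P ∈ closure Ω) (hκ : α < κ)
    (hPae : ∀ᵐ x : EuclideanSpace ℝ (Fin n), x ≠ P)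
    {f g : EuclideanSpace ℝ (Fin n) → ℂ} (h : RadialHolder P α κ (Ω.indicator f) C) (hC : C ≠ ⊤)
    (hg : g =ᵐ[volume.restrict Ω] fun x =>
      ((α / Real.Gamma (1 - α) : ℝ) : ℂ) * rightIntegral P α (Ω.indicator f) x) :
    HasRightDeriv Ω P α f g := by
  have hint := ae_integrableOn_of_eLpNorm_lintegral h.measurable_rightIntegrand
    (ENNReal.mul_ne_top hC (betaConst_ne_top hα0 hκ)) h.eLpNorm_lintegral_right_le
  set c : ℂ := ((α / Real.Gamma (1 - α) : ℝ) : ℂ) with hc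
  have key : ∀ ε : ℝ, 0 < ε → eLpNorm (fun Q => rightDerivTrunc Ω P α ε f Q - g Q) 2
      (volume.restrict Ω) ≤ ‖c‖ₑ * eLpNorm (rightTail P α (Ω.indicator f) ε) 2 volume := by
    intro ε hε
    have h1 : ∀ᵐ x ∂(volume.restrict Ω), ‖rightDerivTrunc Ω P α ε f x - g x‖ₑ ≤
        (‖c‖₊ : ℝ≥0∞) * ‖rightTail P α (Ω.indicator f) ε x‖ₑ := by
      filter_upwards [ae_restrict_mem hΩ.measurableSet, hg, ae_restrict_of_ae hint] with x hx hgx hix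
      rw [rightDerivTrunc_eq hα0 hΩ hconv hb hP hP' hx hix hε, hgx, ← mul_sub, enorm_mul,
        enorm_eq_self, rightIntegral]
      refine mul_le_mul' le_rfl ?_
      set r := ‖x - P‖
      have hr : 0 ≤ r := norm_nonneg _
      have h2 : ∫ τ in Set.Ioo 0 (r / (r + ε)), rightIntegrand P α (Ω.indicator f) x τ =
          ∫ τ in Set.Ioo 0 1, (Set.Iio (r / (r + ε))).indicator
            (rightIntegrand P α (Ω.indicator f) x) τ := by
        rw [setIntegral_indicator measurableSet_Iio]
        congr 2
        ext τ
        have h3 : r / (r + ε) ≤ 1 := (div_le_one (by linarith)).2 (by linarith)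
        simp only [Set.mem_Ioo, Set.mem_inter_iff, Set.mem_Iio]
        constructor
        · rintro ⟨h4, h5⟩; exact ⟨⟨h4, by linarith⟩, h5⟩
        · rintro ⟨⟨h4, _⟩, h5⟩; exact ⟨h4, h5⟩
      rw [h2, ← integral_sub (hix.indicator measurableSet_Iio) hix, rightTail]
      refine (enorm_integral_le_lintegral_enorm _).trans (lintegral_mono fun τ => ?_)
      by_cases hτ : τ < r / (r + ε)
      · rw [Set.indicator_of_mem (show τ ∈ Set.Iio (r / (r + ε)) from hτ)]
        simp
      · rw [Set.indicator_of_notMem (show τ ∉ Set.Iio (r / (r + ε)) from hτ),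
          Set.indicator_of_mem]
        · simp
        · exact not_lt.1 hτ
    refine (eLpNorm_le_nnreal_smul_eLpNorm_of_ae_le_mul' h1 2).trans ?_
    rw [ENNReal.smul_def, smul_eq_mul]
    exact mul_le_mul' le_rfl (eLpNorm_mono_measure _ Measure.restrict_le_self)
  have h2 := ENNReal.Tendsto.const_mul (a := ‖c‖ₑ)
    (tendsto_eLpNorm_rightTail h hα0 hκ hC hPae) (Or.inr enorm_ne_top)
  rw [mul_zero] at h2
  refine tendsto_of_tendsto_of_tendsto_of_le_of_le' tendsto_const_nhds h2
    (Eventually.of_forall fun _ => zero_le) ?_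
  filter_upwards [self_mem_nhdsWithin] with ε hε
  exact key ε hε

end RightDerivative

/-! ### Products of `C¹` coefficients and weakly differentiable functions -/

section ProductRule

variable {n : ℕ} {Ω : Set (EuclideanSpace ℝ (Fin n))}

/-- Approximation of `C¹` functions with compact support by test functions. -/
theorem exists_isTestFunction_near (hΩ : IsOpen Ω) {ψ : EuclideanSpace ℝ (Fin n) → ℂ}
    (hψ : ContDiff ℝ 1 ψ) (hc : HasCompactSupport ψ) (hs : tsupport ψ ⊆ Ω) {ε : ℝ} (hε : 0 < ε) :
    ∃ φ, IsTestFunction Ω φ ∧ (∀ x, ‖φ x - ψ x‖ ≤ ε) ∧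
      ∀ i x, ‖partialDeriv i φ x - partialDeriv i ψ x‖ ≤ ε := by
  obtain ⟨δ₀, hδ₀, hthick⟩ := hc.isCompact.exists_cthickening_subset_open hΩ hs
  have hu1 := Metric.uniformContinuous_iff.1 (hc.uniformContinuous_of_continuous hψ.continuous)
    ε hε
  have hd : Continuous (fderiv ℝ ψ) := hψ.continuous_fderiv one_ne_zero
  have hu2 := Metric.uniformContinuous_iff.1
    ((hc.fderiv ℝ).uniformContinuous_of_continuous hd) ε hε
  obtain ⟨δ₁, hδ₁, h1⟩ := hu1
  obtain ⟨δ₂, hδ₂, h2⟩ := hu2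
  -- The mollification radius must keep the support inside the domain and be within the moduli of
  -- uniform continuity of both `ψ` and its derivative.
  set δ := min δ₀ (min δ₁ δ₂) with hδdef
  have hδ : 0 < δ := lt_min hδ₀ (lt_min hδ₁ hδ₂)
  let b : ContDiffBump (0 : EuclideanSpace ℝ (Fin n)) := ⟨δ / 2, δ, by linarith, by linarith⟩
  set φ := convolution (b.normed volume) ψ (ContinuousLinearMap.lsmul ℝ ℝ) volume with hφ
  have hbi : LocallyIntegrable (b.normed volume) volume :=
    (b.contDiff_normed (n := 0)).continuous.locallyIntegrable
  have hsm : ContDiff ℝ ∞ φ := b.hasCompactSupport_normed.contDiff_convolution_left (n := ⊤) _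
    b.contDiff_normed hψ.continuous.locallyIntegrable
  have hsupp : tsupport φ ⊆ Metric.cthickening δ₀ (tsupport ψ) := by
    refine closure_minimal ?_ Metric.isClosed_cthickening
    refine (support_convolution_subset _).trans ?_
    rw [b.support_normed_eq]
    rintro _ ⟨y, hy, z, hz, rfl⟩
    refine Metric.mem_cthickening_of_dist_le _ z _ _ (subset_tsupport ψ hz) ?_
    have h3 : ‖y‖ < δ := by simpa using hy
    rw [dist_eq_norm, add_sub_cancel_right]
    exact h3.le.trans (min_le_left _ _)
  refine ⟨φ, ⟨hsm, HasCompactSupport.convolution _ b.hasCompactSupport_normed hc,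
    hsupp.trans hthick⟩, fun x => ?_, fun i x => ?_⟩
  · rw [← dist_eq_norm]
    refine b.dist_normed_convolution_le hψ.continuous.aestronglyMeasurable fun y hy => ?_
    exact (h1 (lt_of_lt_of_le (Metric.mem_ball.1 hy)
      ((min_le_right _ _).trans (min_le_left _ _)))).le
  · have h3 := hc.hasFDerivAt_convolution_right (ContinuousLinearMap.lsmul ℝ ℝ) hbi hψ x
    have h4 : convolution (b.normed volume) (fderiv ℝ ψ)
        (ContinuousLinearMap.precompR (EuclideanSpace ℝ (Fin n)) (ContinuousLinearMap.lsmul ℝ ℝ))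
          volume x =
        convolution (b.normed volume) (fderiv ℝ ψ) (ContinuousLinearMap.lsmul ℝ ℝ) volume x := by
      unfold convolution
      refine integral_congr_ae (Eventually.of_forall fun y => ?_)
      ext v
      simp [ContinuousLinearMap.precompR_apply]
    rw [h4] at h3
    have h5 : dist (convolution (b.normed volume) (fderiv ℝ ψ) (ContinuousLinearMap.lsmul ℝ ℝ)
        volume x) (fderiv ℝ ψ x) ≤ ε := by
      refine b.dist_normed_convolution_le hd.aestronglyMeasurable fun y hy => ?_
      exact (h2 (lt_of_lt_of_le (Metric.mem_ball.1 hy)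
        ((min_le_right _ _).trans (min_le_right _ _)))).le
    simp only [partialDeriv]
    rw [h3.fderiv, ← sub_apply]
    refine (ContinuousLinearMap.le_opNorm _ _).trans ?_
    rw [PiLp.norm_single, norm_one, mul_one, ← dist_eq_norm]
    exact h5

theorem norm_setIntegral_mul_sub_le {f φ ψ : EuclideanSpace ℝ (Fin n) → ℂ}
    (hf : IntegrableOn f Ω) (hφ : Continuous φ) (hψ : Continuous ψ) (hφc : HasCompactSupport φ)
    (hψc : HasCompactSupport ψ) {ε : ℝ} (h : ∀ x, ‖φ x - ψ x‖ ≤ ε) :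
    ‖(∫ x in Ω, f x * φ x) - ∫ x in Ω, f x * ψ x‖ ≤ ε * ∫ x in Ω, ‖f x‖ := by
  have hi : ∀ {χ : EuclideanSpace ℝ (Fin n) → ℂ}, Continuous χ → HasCompactSupport χ →
      IntegrableOn (fun x => f x * χ x) Ω := by
    intro χ hχ hχc
    obtain ⟨C, hC⟩ := hχ.bounded_above_of_compact_support hχc
    exact Integrable.mul_bdd hf hχ.aestronglyMeasurable (Eventually.of_forall hC)
  rw [← integral_sub (hi hφ hφc) (hi hψ hψc), ← integral_const_mul]
  refine norm_integral_le_of_norm_le (hf.norm.const_mul ε) (Eventually.of_forall fun x => ?_)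
  rw [← mul_sub, norm_mul, mul_comm]
  exact mul_le_mul_of_nonneg_right (h x) (norm_nonneg _)

/-- Weak derivatives may be tested with `C¹` functions. -/
theorem HasWeakDeriv.integral_contDiff_one (hΩ : IsOpen Ω) {i : Fin n}
    {f g : EuclideanSpace ℝ (Fin n) → ℂ} (h : HasWeakDeriv Ω i f g) (hf : IntegrableOn f Ω)
    (hg : IntegrableOn g Ω) {ψ : EuclideanSpace ℝ (Fin n) → ℂ}
    (hψ : ContDiff ℝ 1 ψ) (hc : HasCompactSupport ψ) (hs : tsupport ψ ⊆ Ω) :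
    ∫ x in Ω, f x * partialDeriv i ψ x = -∫ x in Ω, g x * ψ x := by
  have hd : Continuous (partialDeriv i ψ) := by
    have := hψ.continuous_fderiv one_ne_zero
    unfold partialDeriv
    fun_prop
  have hdc : HasCompactSupport (partialDeriv i ψ) := hc.fderiv_apply (𝕜 := ℝ) _
  have key : ∀ ε : ℝ, 0 < ε → ‖(∫ x in Ω, f x * partialDeriv i ψ x) + ∫ x in Ω, g x * ψ x‖ ≤
      ((∫ x in Ω, ‖f x‖) + ∫ x in Ω, ‖g x‖) * ε := by
    intro ε hε
    obtain ⟨φ, hφ, h1, h2⟩ := exists_isTestFunction_near hΩ hψ hc hs hε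
    have h3 := norm_setIntegral_mul_sub_le hf (continuous_partialDeriv hφ.1 i) hd
      (hφ.partialDeriv i).2.1 hdc (h2 i)
    have h4 := norm_setIntegral_mul_sub_le hg hφ.1.continuous hψ.continuous hφ.2.1 hc h1
    have h5 : (∫ x in Ω, f x * partialDeriv i ψ x) + ∫ x in Ω, g x * ψ x =
        -(((∫ x in Ω, f x * partialDeriv i φ x) - ∫ x in Ω, f x * partialDeriv i ψ x) +
          ((∫ x in Ω, g x * φ x) - ∫ x in Ω, g x * ψ x)) := by
      rw [h φ hφ]; ring
    rw [h5, norm_neg]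
    refine (norm_add_le _ _).trans ((add_le_add h3 h4).trans (le_of_eq (by ring)))
  have h6 : ‖(∫ x in Ω, f x * partialDeriv i ψ x) + ∫ x in Ω, g x * ψ x‖ ≤ 0 := by
    have h7 : Tendsto (fun ε : ℝ => ((∫ x in Ω, ‖f x‖) + ∫ x in Ω, ‖g x‖) * ε) (𝓝[>] 0)
        (𝓝 0) := by
      have : Continuous fun ε : ℝ => ((∫ x in Ω, ‖f x‖) + ∫ x in Ω, ‖g x‖) * ε := by fun_prop
      have h8 := this.tendsto 0
      rw [mul_zero] at h8
      exact h8.mono_left nhdsWithin_le_nhds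
    refine ge_of_tendsto h7 ?_
    filter_upwards [self_mem_nhdsWithin] with ε hε
    exact key ε hε
  exact eq_neg_of_add_eq_zero_left (norm_le_zero_iff.1 h6)

theorem memLp_top_of_continuousOn (hΩ : IsOpen Ω) (hb : Bornology.IsBounded Ω)
    {a : EuclideanSpace ℝ (Fin n) → ℝ} (ha : ContinuousOn a (closure Ω)) :
    MemLp (fun x => (a x : ℂ)) ⊤ (volume.restrict Ω) := by
  obtain ⟨C, hC⟩ := hb.isCompact_closure.exists_bound_of_continuousOn ha
  refine memLp_top_of_bound (C := C) ?_ ?_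
  · exact ((Complex.continuous_ofReal.comp_continuousOn (ha.mono subset_closure))).aestronglyMeasurable
      hΩ.measurableSet
  · filter_upwards [ae_restrict_mem hΩ.measurableSet] with x hx
    rw [Complex.norm_real]
    exact hC x (subset_closure hx)

theorem memLp_ofReal_mul (hΩ : IsOpen Ω) (hb : Bornology.IsBounded Ω)
    {a : EuclideanSpace ℝ (Fin n) → ℝ} (ha : ContinuousOn a (closure Ω))
    {f : EuclideanSpace ℝ (Fin n) → ℂ} (hf : MemLp f 2 (volume.restrict Ω)) :
    MemLp (fun x => (a x : ℂ) * f x) 2 (volume.restrict Ω) :=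
  hf.mul (memLp_top_of_continuousOn hΩ hb ha)

/-- The product rule for the product of a `C¹` function and a weakly differentiable function. -/
theorem exists_hasWeakDeriv_mul (hΩ : IsOpen Ω) (hb : Bornology.IsBounded Ω)
    [IsFiniteMeasure (volume.restrict Ω)] {a : EuclideanSpace ℝ (Fin n) → ℝ}
    (ha : IsC1Closure Ω a) {j : Fin n} {f g : L2 Ω} (h : HasWeakDeriv Ω j f g) :
    ∃ k : L2 Ω, HasWeakDeriv Ω j (fun x => (a x : ℂ) * f x) k := by
  obtain ⟨hac, a', ha'c, ha'⟩ := ha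
  have hf := Lp.memLp f
  have hg := Lp.memLp g
  have hb' : ContinuousOn (fun x => a' x (EuclideanSpace.single j 1)) (closure Ω) :=
    ha'c.clm_apply continuousOn_const
  have hm1 := memLp_ofReal_mul hΩ hb hac hg
  have hm2 := memLp_ofReal_mul hΩ hb hb' hf
  have hk : MemLp (fun x => (a x : ℂ) * g x +
      ((a' x (EuclideanSpace.single j 1) : ℝ) : ℂ) * f x) 2 (volume.restrict Ω) := hm1.add hm2
  refine ⟨hk.toLp, HasWeakDeriv.congr ?_ (EventuallyEq.refl _ _) hk.coeFn_toLp.symm⟩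
  intro φ hφ
  -- The product rule is obtained by moving `a` onto the test function. The product is only `C¹`,
  -- hence the need to test weak derivatives with `C¹` functions.
  set ψ : EuclideanSpace ℝ (Fin n) → ℂ := fun x => (a x : ℂ) * φ x with hψdef
  have hder : ∀ x ∈ Ω, HasFDerivAt ψ
      ((a x : ℂ) • fderiv ℝ φ x + φ x • Complex.ofRealCLM.comp (a' x)) x := by
    intro x hx
    have h1 : HasFDerivAt (fun x => (a x : ℂ)) (Complex.ofRealCLM.comp (a' x)) x :=
      Complex.ofRealCLM.hasFDerivAt.comp x (ha' x hx)
    have h2 : HasFDerivAt φ (fderiv ℝ φ x) x :=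
      (hφ.1.differentiable (by simp)).differentiableAt.hasFDerivAt
    exact h1.mul h2
  have hsub : tsupport ψ ⊆ tsupport φ := closure_mono fun x hx hc => hx (by simp [hψdef, hc])
  have hψ1 : ContDiff ℝ 1 ψ := by
    rw [contDiff_iff_contDiffAt]
    intro x
    by_cases hx : x ∈ Ω
    · refine contDiffAt_one_iff.2 ⟨_, Ω, hΩ.mem_nhds hx, ?_, hder⟩
      have h1 := hφ.1.continuous_fderiv (by simp)
      have h2 := hφ.1.continuous
      have h3 := hac.mono subset_closure
      have h4 := ha'c.mono subset_closure
      exact ((Complex.continuous_ofReal.comp_continuousOn h3).smul h1.continuousOn).add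
        (h2.continuousOn.smul (continuousOn_const.clm_comp h4))
    -- Outside the domain `a` may be irregular, but `φ` vanishes in a neighbourhood.
    · have h1 : ψ =ᶠ[𝓝 x] fun _ => 0 := by
        filter_upwards [(isClosed_tsupport φ).isOpen_compl.mem_nhds fun hc => hx (hφ.2.2 hc)]
          with y hy
        simp [hψdef, image_eq_zero_of_notMem_tsupport hy]
      exact contDiffAt_const.congr_of_eventuallyEq h1
  have hψc : HasCompactSupport ψ := hφ.2.1.of_isClosed_subset (isClosed_tsupport _) hsub
  have hw := h.integral_contDiff_one hΩ (hf.integrable one_le_two) (hg.integrable one_le_two)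
    hψ1 hψc (hsub.trans hφ.2.2)
  have hpd : ∀ x ∈ Ω, partialDeriv j ψ x = (a x : ℂ) * partialDeriv j φ x +
      φ x * ((a' x (EuclideanSpace.single j 1) : ℝ) : ℂ) := by
    intro x hx
    simp [partialDeriv, (hder x hx).fderiv]
  have hi : ∀ {u : EuclideanSpace ℝ (Fin n) → ℂ} {χ : EuclideanSpace ℝ (Fin n) → ℂ},
      MemLp u 2 (volume.restrict Ω) → IsTestFunction Ω χ →
      IntegrableOn (fun x => u x * χ x) Ω := fun hu hχ => hu.integrable_mul (hχ.memLp 2)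
  have e1 : ∫ x in Ω, f x * partialDeriv j ψ x =
      (∫ x in Ω, ((a x : ℂ) * f x) * partialDeriv j φ x) +
        ∫ x in Ω, (((a' x (EuclideanSpace.single j 1) : ℝ) : ℂ) * f x) * φ x := by
    rw [← integral_add (hi (memLp_ofReal_mul hΩ hb hac hf) (hφ.partialDeriv j)) (hi hm2 hφ)]
    refine setIntegral_congr_fun hΩ.measurableSet fun x hx => ?_
    simp only [hpd x hx]
    ring
  have e2 : ∫ x in Ω, ((a x : ℂ) * g x + ((a' x (EuclideanSpace.single j 1) : ℝ) : ℂ) * f x) * φ x =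
      (∫ x in Ω, g x * ψ x) +
        ∫ x in Ω, (((a' x (EuclideanSpace.single j 1) : ℝ) : ℂ) * f x) * φ x := by
    have e3 : ∫ x in Ω, g x * ψ x = ∫ x in Ω, ((a x : ℂ) * g x) * φ x := by
      refine integral_congr_ae (Eventually.of_forall fun x => ?_)
      simp only [hψdef]
      ring
    rw [e3, ← integral_add (hi hm1 hφ) (hi hm2 hφ)]
    refine integral_congr_ae (Eventually.of_forall fun x => ?_)
    simp only
    ring
  rw [e2]
  rw [e1] at hw
  linear_combination hw

end ProductRule

/-! ### Linearity, conjugation and almost everywhere invariance of the fractional integrals -/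

section Linearity

open scoped ENNReal

variable {n : ℕ} {P : EuclideanSpace ℝ (Fin n)} {α κ : ℝ} {F G : EuclideanSpace ℝ (Fin n) → ℂ}
  {C : ℝ≥0∞}

theorem weighted_congr_ae (h : F =ᵐ[volume] G) :
    weighted P α F =ᵐ[volume] weighted P α G := by
  filter_upwards [h] with x hx
  simp only [weighted, hx]

/-- The fractional integrals sample a function along rays, which are null sets. By Fubini a change
on a null set affects almost no ratio on almost every ray, so the integrals make sense for classes
in `L₂`. -/
theorem ae_dilDiff_congr (h : F =ᵐ[volume] G) {σ : ℝ → ℝ} (hσ : Measurable σ)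
    (hpos : ∀ τ ∈ Set.Ioo (0 : ℝ) 1, 0 < σ τ) :
    ∀ᵐ x, ∀ᵐ τ ∂(volume.restrict (Set.Ioo (0 : ℝ) 1)),
      dilDiff P α F (σ τ) x = dilDiff P α G (σ τ) x := by
  filter_upwards [h, ae_ae_dil P h hσ measurableSet_Ioo hpos] with x hx hx'
  filter_upwards [hx'] with τ hτ
  simp only [dilDiff, weighted, hx, hτ]

theorem leftIntegral_congr_ae (h : F =ᵐ[volume] G) :
    leftIntegral P α F =ᵐ[volume] leftIntegral P α G := by
  filter_upwards [ae_dilDiff_congr (P := P) (α := α) h (σ := fun τ => τ) measurable_id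
    fun τ hτ => hτ.1] with x hx
  refine integral_congr_ae ?_
  filter_upwards [hx] with τ hτ
  simp only [leftIntegrand, hτ]

theorem rightIntegral_congr_ae (h : F =ᵐ[volume] G) :
    rightIntegral P α F =ᵐ[volume] rightIntegral P α G := by
  filter_upwards [ae_dilDiff_congr (P := P) (α := α) h (σ := fun τ => τ⁻¹) measurable_inv
    fun τ hτ => inv_pos.2 hτ.1] with x hx
  refine integral_congr_ae ?_
  filter_upwards [hx] with τ hτ
  simp only [rightIntegrand, hτ]

theorem weighted_add (x : EuclideanSpace ℝ (Fin n)) :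
    weighted P α (fun y => F y + G y) x = weighted P α F x + weighted P α G x := by
  simp only [weighted]; ring

theorem weighted_const_mul (c : ℂ) (x : EuclideanSpace ℝ (Fin n)) :
    weighted P α (fun y => c * F y) x = c * weighted P α F x := by
  simp only [weighted]; ring

theorem dilDiff_add (σ : ℝ) (x : EuclideanSpace ℝ (Fin n)) :
    dilDiff P α (fun y => F y + G y) σ x = dilDiff P α F σ x + dilDiff P α G σ x := by
  simp only [dilDiff, weighted]; ring

theorem dilDiff_const_mul (c : ℂ) (σ : ℝ) (x : EuclideanSpace ℝ (Fin n)) :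
    dilDiff P α (fun y => c * F y) σ x = c * dilDiff P α F σ x := by
  simp only [dilDiff, weighted]; ring

theorem leftIntegral_add {x : EuclideanSpace ℝ (Fin n)}
    (hF : IntegrableOn (leftIntegrand P α F x) (Set.Ioo 0 1))
    (hG : IntegrableOn (leftIntegrand P α G x) (Set.Ioo 0 1)) :
    leftIntegral P α (fun y => F y + G y) x = leftIntegral P α F x + leftIntegral P α G x := by
  simp only [leftIntegral]
  rw [← integral_add hF hG]
  simp only [leftIntegrand, dilDiff_add, mul_add]

theorem rightIntegral_add {x : EuclideanSpace ℝ (Fin n)}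
    (hF : IntegrableOn (rightIntegrand P α F x) (Set.Ioo 0 1))
    (hG : IntegrableOn (rightIntegrand P α G x) (Set.Ioo 0 1)) :
    rightIntegral P α (fun y => F y + G y) x = rightIntegral P α F x + rightIntegral P α G x := by
  simp only [rightIntegral]
  rw [← integral_add hF hG]
  simp only [rightIntegrand, dilDiff_add, mul_add]

theorem leftIntegral_const_mul (c : ℂ) (x : EuclideanSpace ℝ (Fin n)) :
    leftIntegral P α (fun y => c * F y) x = c * leftIntegral P α F x := by
  simp only [leftIntegral]
  rw [← integral_const_mul]
  simp only [leftIntegrand, dilDiff_const_mul, mul_left_comm]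

theorem rightIntegral_const_mul (c : ℂ) (x : EuclideanSpace ℝ (Fin n)) :
    rightIntegral P α (fun y => c * F y) x = c * rightIntegral P α F x := by
  simp only [rightIntegral]
  rw [← integral_const_mul]
  simp only [rightIntegrand, dilDiff_const_mul, mul_left_comm]

theorem weighted_conj (x : EuclideanSpace ℝ (Fin n)) :
    weighted P α (fun y => conj (F y)) x = conj (weighted P α F x) := by
  simp [weighted]

theorem dilDiff_conj (σ : ℝ) (x : EuclideanSpace ℝ (Fin n)) :
    dilDiff P α (fun y => conj (F y)) σ x = conj (dilDiff P α F σ x) := by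
  simp [dilDiff, weighted]

theorem leftIntegral_conj (x : EuclideanSpace ℝ (Fin n)) :
    leftIntegral P α (fun y => conj (F y)) x = conj (leftIntegral P α F x) := by
  simp only [leftIntegral]
  rw [← integral_conj]
  simp only [leftIntegrand, dilDiff_conj, map_mul, Complex.conj_ofReal]

theorem RadialHolder.conjugate (h : RadialHolder P α κ F C) :
    RadialHolder P α κ (fun x => conj (F x)) C where
  measurable := Complex.continuous_conj.measurable.comp h.measurable
  weighted_le := by
    refine le_trans (eLpNorm_mono fun x => ?_) h.weighted_le
    rw [weighted_conj, RCLike.norm_conj]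
  dilDiff_le τ hτ := by
    refine le_trans (eLpNorm_mono fun x => ?_) (h.dilDiff_le τ hτ)
    rw [dilDiff_conj, RCLike.norm_conj]

theorem RadialHolder.ae_integrableOn_left (hn : 2 ≤ n) (hα0 : 0 < α) (hκ : α < κ)
    (h : RadialHolder P α κ F C) (hC : C ≠ ⊤) :
    ∀ᵐ x, IntegrableOn (leftIntegrand P α F x) (Set.Ioo 0 1) :=
  ae_integrableOn_of_eLpNorm_lintegral h.measurable_leftIntegrand
    (ENNReal.mul_ne_top hC (betaConst_ne_top hα0 hκ)) (h.eLpNorm_lintegral_left_le hn)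

theorem RadialHolder.ae_integrableOn_right (hα0 : 0 < α) (hκ : α < κ)
    (h : RadialHolder P α κ F C) (hC : C ≠ ⊤) :
    ∀ᵐ x, IntegrableOn (rightIntegrand P α F x) (Set.Ioo 0 1) :=
  ae_integrableOn_of_eLpNorm_lintegral h.measurable_rightIntegrand
    (ENNReal.mul_ne_top hC (betaConst_ne_top hα0 hκ)) h.eLpNorm_lintegral_right_le

theorem RadialHolder.memLp_leftIntegral (hn : 2 ≤ n) (hα0 : 0 < α) (hκ : α < κ)
    (h : RadialHolder P α κ F C) (hC : C ≠ ⊤) :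
    MemLp (leftIntegral P α F) 2 volume ∧
      eLpNorm (leftIntegral P α F) 2 volume ≤ C * betaConst α κ :=
  memLp_integral_of_eLpNorm_lintegral h.measurable_leftIntegrand
    (ENNReal.mul_ne_top hC (betaConst_ne_top hα0 hκ)) (h.eLpNorm_lintegral_left_le hn)

theorem RadialHolder.memLp_rightIntegral (hα0 : 0 < α) (hκ : α < κ)
    (h : RadialHolder P α κ F C) (hC : C ≠ ⊤) : MemLp (rightIntegral P α F) 2 volume :=
  (memLp_integral_of_eLpNorm_lintegral h.measurable_rightIntegrand
    (ENNReal.mul_ne_top hC (betaConst_ne_top hα0 hκ)) h.eLpNorm_lintegral_right_le).1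

variable {Ω : Set (EuclideanSpace ℝ (Fin n))}

theorem indicator_congr_ae (hΩ : IsOpen Ω) {f g : EuclideanSpace ℝ (Fin n) → ℂ}
    (h : f =ᵐ[volume.restrict Ω] g) : Ω.indicator f =ᵐ[volume] Ω.indicator g :=
  (ae_eq_restrict_iff_indicator_ae_eq hΩ.measurableSet).1 h

end Linearity

/-! ### The fractional derivatives as linear maps on `H₀¹(Ω)` -/

section FractionalOperators

open scoped ENNReal

variable {n : ℕ} {Ω : Set (EuclideanSpace ℝ (Fin n))} {P : EuclideanSpace ℝ (Fin n)} {α : ℝ}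

/-- A bounded convex domain with a boundary point `P`, and an order `α` between `0` and `1`. -/
structure IsConvexSetting (Ω : Set (EuclideanSpace ℝ (Fin n))) (P : EuclideanSpace ℝ (Fin n))
    (α : ℝ) : Prop where
  two_le : 2 ≤ n
  pos : 0 < α
  lt_one : α < 1
  isOpen : IsOpen Ω
  convex : Convex ℝ Ω
  bounded : Bornology.IsBounded Ω
  notMem : P ∉ Ω
  mem_closure : P ∈ closure Ω

namespace IsConvexSetting

theorem exists_radius (S : IsConvexSetting Ω P α) : ∃ R : ℝ, 0 ≤ R ∧ ∀ x ∈ Ω, ‖x - P‖ ≤ R := by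
  obtain ⟨R, hR⟩ := S.bounded.subset_closedBall P
  exact ⟨max R 0, le_max_right _ _, fun x hx =>
    (mem_closedBall_iff_norm.1 (hR hx)).trans (le_max_left _ _)⟩

theorem ae_ne (S : IsConvexSetting Ω P α) : ∀ᵐ x : EuclideanSpace ℝ (Fin n), x ≠ P := by
  have : Nonempty (Fin n) := ⟨⟨0, by have := S.two_le; omega⟩⟩
  have : Nontrivial (EuclideanSpace ℝ (Fin n)) := inferInstance
  exact Measure.ae_ne volume P

theorem exists_radialHolder (S : IsConvexSetting Ω P α)
    [IsFiniteMeasure (volume.restrict Ω)] :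
    ∃ c : ℝ≥0∞, c ≠ ⊤ ∧ ∀ u ∈ h10 Ω, RadialHolder P α 1 (extend u) (c * gradNorm u) := by
  obtain ⟨R, hR0, hR⟩ := S.exists_radius
  exact ⟨_, radialConst_ne_top n α R, fun u hu =>
    radialHolder_extend S.two_le S.pos S.lt_one S.isOpen S.notMem hR0 hR hu⟩

end IsConvexSetting

theorem extend_add (hΩ : IsOpen Ω) (u v : L2 Ω) :
    extend (u + v) =ᵐ[volume] fun x => extend u x + extend v x := by
  refine (indicator_congr_ae hΩ (Lp.coeFn_add u v)).trans (Eventually.of_forall fun x => ?_)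
  by_cases hx : x ∈ Ω <;> simp [extend, hx]

theorem extend_smul (hΩ : IsOpen Ω) (c : ℂ) (u : L2 Ω) :
    extend (c • u) =ᵐ[volume] fun x => c * extend u x := by
  refine (indicator_congr_ae hΩ (Lp.coeFn_smul c u)).trans (Eventually.of_forall fun x => ?_)
  by_cases hx : x ∈ Ω <;> simp [extend, hx]

theorem toReal_gradNorm (hΩ : IsOpen Ω) [IsFiniteMeasure (volume.restrict Ω)] (u : h10 Ω) :
    (gradNorm (u : L2 Ω)).toReal = ∑ i, ‖gradLin hΩ i u‖ := by
  rw [gradNorm, ENNReal.toReal_sum fun i _ => (Lp.memLp _).2.ne]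
  rfl

/-- The Kipriyanov derivative in terms of the dilation integral. -/
noncomputable def dilDeriv (P : EuclideanSpace ℝ (Fin n)) (α : ℝ)
    (F : EuclideanSpace ℝ (Fin n) → ℂ) (x : EuclideanSpace ℝ (Fin n)) : ℂ :=
  ((α / Real.Gamma (1 - α) : ℝ) : ℂ) * leftIntegral P α F x +
    (((n - 1).factorial / Real.Gamma (n - α) : ℝ) : ℂ) * weighted P α F x

theorem memLp_dilDeriv (hn : 2 ≤ n) {κ : ℝ} (hα0 : 0 < α) (hκ : α < κ) :
    ∃ c : ℝ≥0∞, c ≠ ⊤ ∧ ∀ {F : EuclideanSpace ℝ (Fin n) → ℂ} {C : ℝ≥0∞},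
      RadialHolder P α κ F C → C ≠ ⊤ →
      MemLp (dilDeriv P α F) 2 volume ∧ eLpNorm (dilDeriv P α F) 2 volume ≤ c * C := by
  refine ⟨‖((α / Real.Gamma (1 - α) : ℝ) : ℂ)‖ₑ * betaConst α κ +
    ‖(((n - 1).factorial / Real.Gamma (n - α) : ℝ) : ℂ)‖ₑ,
    ENNReal.add_ne_top.2 ⟨ENNReal.mul_ne_top enorm_ne_top (betaConst_ne_top hα0 hκ),
      enorm_ne_top⟩, fun {F C} h hC => ?_⟩
  obtain ⟨h1, h2⟩ := h.memLp_leftIntegral hn hα0 hκ hC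
  have h3 := h1.const_mul ((α / Real.Gamma (1 - α) : ℝ) : ℂ)
  have h4 := (h.memLp_weighted hC).const_mul
    (((n - 1).factorial / Real.Gamma (n - α) : ℝ) : ℂ)
  refine ⟨h3.add h4, (eLpNorm_add_le h3.1 h4.1 one_le_two).trans ?_⟩
  rw [add_mul, mul_assoc, mul_comm (betaConst α κ)]
  refine add_le_add ?_ ?_
  · exact (eLpNorm_const_smul_le (c := ((α / Real.Gamma (1 - α) : ℝ) : ℂ))).trans (by gcongr)
  · exact (eLpNorm_const_smul_le
      (c := (((n - 1).factorial / Real.Gamma (n - α) : ℝ) : ℂ))).trans (by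
        gcongr; exact h.weighted_le)

namespace IsConvexSetting

theorem kipriyanov_ae (S : IsConvexSetting Ω P α) (u : L2 Ω) :
    kipriyanov P α u =ᵐ[volume.restrict Ω] dilDeriv P α (extend u) := by
  filter_upwards [ae_restrict_mem S.isOpen.measurableSet] with x hx
  exact kipriyanov_eq S.isOpen S.convex S.notMem S.mem_closure hx

variable [IsFiniteMeasure (volume.restrict Ω)]

/-- The Kipriyanov derivative on `H₀¹(Ω)` as a linear map. -/
theorem exists_kipriyanovLin (S : IsConvexSetting Ω P α) :
    ∃ (K : h10 Ω →ₗ[ℂ] L2 Ω) (C : ℝ), 0 ≤ C ∧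
      (∀ u : h10 Ω, K u =ᵐ[volume.restrict Ω] kipriyanov P α (u : L2 Ω)) ∧
      ∀ u, ‖K u‖ ≤ C * energyNorm S.isOpen u := by
  obtain ⟨c, hc, hr⟩ := S.exists_radialHolder
  obtain ⟨d, hd, hm⟩ := memLp_dilDeriv (P := P) S.two_le S.pos S.lt_one
  have hC : ∀ u : h10 Ω, c * gradNorm (u : L2 Ω) ≠ ⊤ := fun u =>
    ENNReal.mul_ne_top hc (gradNorm_ne_top _)
  have hmem : ∀ u : h10 Ω, MemLp (dilDeriv P α (extend (u : L2 Ω))) 2 (volume.restrict Ω) :=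
    fun u => (hm (hr u u.2) (hC u)).1.restrict Ω
  have hint : ∀ u : h10 Ω, ∀ᵐ x, IntegrableOn (leftIntegrand P α (extend (u : L2 Ω)) x)
      (Set.Ioo 0 1) := fun u =>
    (hr u u.2).ae_integrableOn_left S.two_le S.pos S.lt_one (hC u)
  have hadd : ∀ u v : h10 Ω, dilDeriv P α (extend ((u + v : h10 Ω) : L2 Ω)) =ᵐ[volume] fun x =>
      dilDeriv P α (extend (u : L2 Ω)) x + dilDeriv P α (extend (v : L2 Ω)) x := by
    intro u v
    have h1 := extend_add S.isOpen (u : L2 Ω) v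
    filter_upwards [leftIntegral_congr_ae (P := P) (α := α) h1,
      weighted_congr_ae (P := P) (α := α) h1, hint u, hint v] with x h2 h3 h4 h5
    simp only [dilDeriv]
    rw [Submodule.coe_add, h2, h3, leftIntegral_add h4 h5, weighted_add]
    ring
  have hsmul : ∀ (c : ℂ) (u : h10 Ω), dilDeriv P α (extend ((c • u : h10 Ω) : L2 Ω)) =ᵐ[volume]
      fun x => c * dilDeriv P α (extend (u : L2 Ω)) x := by
    intro c u
    have h1 := extend_smul S.isOpen c (u : L2 Ω)
    filter_upwards [leftIntegral_congr_ae (P := P) (α := α) h1,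
      weighted_congr_ae (P := P) (α := α) h1] with x h2 h3
    simp only [dilDeriv]
    rw [Submodule.coe_smul, h2, h3, leftIntegral_const_mul, weighted_const_mul]
    ring
  refine ⟨{ toFun := fun u => (hmem u).toLp
            map_add' := fun u v => ?_
            map_smul' := fun c u => ?_ }, (d * c).toReal, ENNReal.toReal_nonneg,
            fun u => (hmem u).coeFn_toLp.trans (S.kipriyanov_ae _).symm, fun u => ?_⟩
  · rw [← MemLp.toLp_add]
    exact MemLp.toLp_congr _ _ (ae_restrict_of_ae (hadd u v))
  · rw [← MemLp.toLp_const_smul]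
    exact MemLp.toLp_congr _ _ (ae_restrict_of_ae (hsmul c u))
  · have h1 : ‖(hmem u).toLp‖ ≤ (d * (c * gradNorm (u : L2 Ω))).toReal := by
      rw [Lp.norm_toLp]
      exact ENNReal.toReal_mono (ENNReal.mul_ne_top hd (hC u))
        ((eLpNorm_mono_measure _ Measure.restrict_le_self).trans (hm (hr u u.2) (hC u)).2)
    refine h1.trans ?_
    rw [← mul_assoc, ENNReal.toReal_mul, toReal_gradNorm S.isOpen, energyNorm_apply]
    gcongr
    exact le_add_of_nonneg_left (norm_nonneg _)

theorem ae_intervalIntegrable (S : IsConvexSetting Ω P α) (u : h10 Ω) :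
    ∀ᵐ Q ∂(volume.restrict Ω), IntervalIntegrable
      (kipriyanovIntegrand P α (u : L2 Ω) Q) volume 0 ‖Q - P‖ := by
  obtain ⟨c, hc, hr⟩ := S.exists_radialHolder
  filter_upwards [ae_restrict_mem S.isOpen.measurableSet, ae_restrict_of_ae
    ((hr u u.2).ae_integrableOn_left S.two_le S.pos S.lt_one
      (ENNReal.mul_ne_top hc (gradNorm_ne_top _)))] with Q hQ h
  exact intervalIntegrable_kipriyanovIntegrand S.isOpen S.convex S.notMem S.mem_closure hQ h

end IsConvexSetting

/-- A weight that is Hölder continuous with an exponent larger than `α`. -/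
structure IsHolderWeight (Ω : Set (EuclideanSpace ℝ (Fin n))) (α lam M : ℝ)
    (ρ : EuclideanSpace ℝ (Fin n) → ℝ) : Prop where
  lt : α < lam
  le_one : lam ≤ 1
  le : ∀ x ∈ closure Ω, ∀ y ∈ closure Ω, |ρ x - ρ y| ≤ M * ‖x - y‖ ^ lam

section Weight

variable {lam M : ℝ} {ρ : EuclideanSpace ℝ (Fin n) → ℝ}

theorem IsHolderWeight.continuousOn (h : IsHolderWeight Ω α lam M ρ) (hα0 : 0 < α) :
    ContinuousOn ρ (closure Ω) := by
  have hlam0 : 0 < lam := hα0.trans h.lt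
  intro x hx
  rw [ContinuousWithinAt, tendsto_iff_norm_sub_tendsto_zero]
  have h1 : Tendsto (fun y => M * ‖y - x‖ ^ lam) (𝓝[closure Ω] x) (𝓝 0) := by
    have hc : Continuous fun y : EuclideanSpace ℝ (Fin n) => M * ‖y - x‖ ^ lam :=
      continuous_const.mul ((by fun_prop : Continuous fun y => ‖y - x‖).rpow_const
        fun _ => Or.inr hlam0.le)
    have := hc.tendsto x
    rw [sub_self, norm_zero, Real.zero_rpow hlam0.ne', mul_zero] at this
    exact this.mono_left nhdsWithin_le_nhds
  refine squeeze_zero' (Eventually.of_forall fun _ => norm_nonneg _) ?_ h1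
  filter_upwards [self_mem_nhdsWithin] with y hy
  exact h.le y hy x hx

variable [IsFiniteMeasure (volume.restrict Ω)]

theorem IsConvexSetting.exists_radialHolder_weight (S : IsConvexSetting Ω P α)
    (h : IsHolderWeight Ω α lam M ρ) {u : L2 Ω} (hu : u ∈ h10 Ω) :
    ∃ C, C ≠ ⊤ ∧ RadialHolder P α lam (Ω.indicator fun x => (ρ x : ℂ) * u x) C := by
  obtain ⟨R, hR0, hR⟩ := S.exists_radius
  have hc := h.continuousOn S.pos
  obtain ⟨ρm, hρm⟩ := S.bounded.isCompact_closure.exists_bound_of_continuousOn hc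
  exact exists_radialHolder_mul S.two_le S.pos S.lt_one S.isOpen S.convex S.notMem S.mem_closure
    hR0 hR h.lt h.le_one (fun x hx => hρm x (subset_closure hx)) (hc.mono subset_closure)
    (fun x hx y hy => h.le x (subset_closure hx) y (subset_closure hy)) hu

/-- The right-side derivative of the products with the weight, as a linear map on `H₀¹(Ω)`. -/
theorem IsConvexSetting.exists_rightLin (S : IsConvexSetting Ω P α)
    (h : IsHolderWeight Ω α lam M ρ) :
    ∃ W : h10 Ω →ₗ[ℂ] L2 Ω, ∀ u : h10 Ω, W u =ᵐ[volume.restrict Ω] fun x =>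
      ((α / Real.Gamma (1 - α) : ℝ) : ℂ) *
        rightIntegral P α (Ω.indicator fun x => (ρ x : ℂ) * (u : L2 Ω) x) x := by
  choose C hC hr using fun u : h10 Ω => S.exists_radialHolder_weight h u.2
  have hmem : ∀ u : h10 Ω, MemLp (fun x => ((α / Real.Gamma (1 - α) : ℝ) : ℂ) *
        rightIntegral P α (Ω.indicator fun x => (ρ x : ℂ) * (u : L2 Ω) x) x) 2
      (volume.restrict Ω) :=
    fun u => (((hr u).memLp_rightIntegral S.pos h.lt (hC u)).const_mul _).restrict Ω
  have hint := fun u : h10 Ω => (hr u).ae_integrableOn_right S.pos h.lt (hC u)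
  refine ⟨{ toFun := fun u => (hmem u).toLp
            map_add' := fun u v => ?_
            map_smul' := fun c u => ?_ }, fun u => (hmem u).coeFn_toLp⟩
  · rw [← MemLp.toLp_add]
    refine MemLp.toLp_congr _ _ (ae_restrict_of_ae ?_)
    have h1 : (Ω.indicator fun x => (ρ x : ℂ) * ((u + v : h10 Ω) : L2 Ω) x) =ᵐ[volume] fun x =>
        (Ω.indicator fun x => (ρ x : ℂ) * (u : L2 Ω) x) x +
          (Ω.indicator fun x => (ρ x : ℂ) * (v : L2 Ω) x) x := by
      rw [← Set.indicator_add]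
      refine indicator_congr_ae S.isOpen ?_
      filter_upwards [Lp.coeFn_add (u : L2 Ω) v] with x hx
      rw [Submodule.coe_add, hx, Pi.add_apply, mul_add]
    filter_upwards [rightIntegral_congr_ae (P := P) (α := α) h1, hint u, hint v] with x h2 h3 h4
    rw [h2, rightIntegral_add h3 h4, Pi.add_apply, mul_add]
  · rw [← MemLp.toLp_const_smul]
    refine MemLp.toLp_congr _ _ (ae_restrict_of_ae ?_)
    have h1 : (Ω.indicator fun x => (ρ x : ℂ) * ((c • u : h10 Ω) : L2 Ω) x) =ᵐ[volume] fun x =>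
        c * (Ω.indicator fun x => (ρ x : ℂ) * (u : L2 Ω) x) x := by
      have h2 : (fun x => (ρ x : ℂ) * ((c • u : h10 Ω) : L2 Ω) x) =ᵐ[volume.restrict Ω] fun x =>
          c * ((ρ x : ℂ) * (u : L2 Ω) x) := by
        filter_upwards [Lp.coeFn_smul c (u : L2 Ω)] with x hx
        rw [Submodule.coe_smul, hx, Pi.smul_apply, smul_eq_mul, mul_left_comm]
      refine (indicator_congr_ae S.isOpen h2).trans (Eventually.of_forall fun x => ?_)
      by_cases hx : x ∈ Ω <;> simp [hx]
    filter_upwards [rightIntegral_congr_ae (P := P) (α := α) h1] with x h2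
    rw [h2, rightIntegral_const_mul, Pi.smul_apply, smul_eq_mul, RingHom.id_apply, mul_left_comm]

theorem IsConvexSetting.hasRightDeriv (S : IsConvexSetting Ω P α)
    (h : IsHolderWeight Ω α lam M ρ) (u : h10 Ω) {w : EuclideanSpace ℝ (Fin n) → ℂ}
    (hw : w =ᵐ[volume.restrict Ω] fun x => ((α / Real.Gamma (1 - α) : ℝ) : ℂ) *
        rightIntegral P α (Ω.indicator fun x => (ρ x : ℂ) * (u : L2 Ω) x) x) :
    HasRightDeriv Ω P α (fun x => (ρ x : ℂ) * (u : L2 Ω) x) w := by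
  obtain ⟨C, hC, hr⟩ := S.exists_radialHolder_weight h u.2
  exact hasRightDeriv_of_radialHolder S.pos S.isOpen S.convex S.bounded S.notMem S.mem_closure
    h.lt S.ae_ne hr hC hw

/-- The right-side derivative is the adjoint of the Kipriyanov derivative. -/
theorem IsConvexSetting.integral_conj_kipriyanov (S : IsConvexSetting Ω P α)
    (h : IsHolderWeight Ω α lam M ρ) (u v : h10 Ω) :
    ∫ x in Ω, conj (kipriyanov P α (v : L2 Ω) x) * ((ρ x : ℂ) * (u : L2 Ω) x) =
      ∫ x in Ω, conj ((v : L2 Ω) x) * (((α / Real.Gamma (1 - α) : ℝ) : ℂ) *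
        rightIntegral P α (Ω.indicator fun x => (ρ x : ℂ) * (u : L2 Ω) x) x) := by
  obtain ⟨C', hC', hg⟩ := S.exists_radialHolder_weight h u.2
  obtain ⟨c, hc, hr⟩ := S.exists_radialHolder
  have hC : c * gradNorm (v : L2 Ω) ≠ ⊤ := ENNReal.mul_ne_top hc (gradNorm_ne_top _)
  set g := Ω.indicator fun x => (ρ x : ℂ) * (u : L2 Ω) x with hgdef
  have hv := hr v v.2
  have hg2 : MemLp g 2 volume := by
    rw [hgdef, memLp_indicator_iff_restrict S.isOpen.measurableSet]
    exact memLp_ofReal_mul S.isOpen S.bounded (h.continuousOn S.pos) (Lp.memLp _)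
  -- The left derivative falls on the conjugate of `v`, with exponent `1`, and the right one on `ρ
  -- u`, with exponent `λ`; both exceed `α`.
  have key := hv.conjugate.integral_mul_leftIntegral S.two_le S.pos hC S.lt_one
    (memLp_extend S.isOpen _).star hg hC' h.lt hg2
  have h1 : 1 ≤ n - 1 := by have := S.two_le; omega
  have hΓ : Real.Gamma (1 - α) ≠ 0 := (Real.Gamma_pos_of_pos (by linarith [S.lt_one])).ne'
  -- The diagonal term of the integration by parts is exactly the term `(n-1)!/Γ(n-α) |Q-P|^(-α)` of
  -- the Kipriyanov derivative.
  have hconst : α / Real.Gamma (1 - α) *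
      (∫ τ in Set.Ioo (0 : ℝ) 1, (τ ^ (α - 1) - τ ^ (n - 1)) * (1 - τ) ^ (-α - 1)) =
        (n - 1).factorial / Real.Gamma (n - α) := by
    have h2 := setIntegral_compensated S.pos S.lt_one h1
    rw [h2]
    have h3 : ((n - 1 : ℕ) : ℝ) + 1 - α = n - α := by
      rw [Nat.cast_sub (by omega)]; push_cast; ring
    rw [h3]
    have := S.pos.ne'
    field_simp
  have e1 : ∫ x in Ω, conj (kipriyanov P α (v : L2 Ω) x) * ((ρ x : ℂ) * (u : L2 Ω) x) =
      ∫ x, g x * conj (dilDeriv P α (extend (v : L2 Ω)) x) := by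
    rw [← integral_indicator S.isOpen.measurableSet]
    refine integral_congr_ae (Eventually.of_forall fun x => ?_)
    by_cases hx : x ∈ Ω
    · simp only [hgdef, Set.indicator_of_mem hx]
      rw [kipriyanov_eq S.isOpen S.convex S.notMem S.mem_closure hx, mul_comm]
      rfl
    · simp [hgdef, hx]
  have e2 : ∫ x in Ω, conj ((v : L2 Ω) x) * (((α / Real.Gamma (1 - α) : ℝ) : ℂ) *
        rightIntegral P α g x) =
      ((α / Real.Gamma (1 - α) : ℝ) : ℂ) *
        ∫ x, conj (extend (v : L2 Ω) x) * rightIntegral P α g x := by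
    rw [← integral_indicator S.isOpen.measurableSet, ← integral_const_mul]
    refine integral_congr_ae (Eventually.of_forall fun x => ?_)
    by_cases hx : x ∈ Ω
    · simp only [extend, Set.indicator_of_mem hx]
      ring
    · simp [extend, hx]
  have i1 : Integrable fun x => g x *
      leftIntegral P α (fun y => conj (extend (v : L2 Ω) y)) x :=
    hg2.integrable_mul (hv.conjugate.memLp_leftIntegral S.two_le S.pos S.lt_one hC).1
  have i2 : Integrable fun x => g x * weighted P α (fun y => conj (extend (v : L2 Ω) y)) x :=
    hg2.integrable_mul (hv.conjugate.memLp_weighted hC)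
  rw [e1, e2, ← key, mul_add, ← mul_assoc, ← Complex.ofReal_mul, hconst, ← integral_const_mul,
    ← integral_const_mul, ← integral_add (i1.const_mul _) (i2.const_mul _)]
  refine integral_congr_ae (Eventually.of_forall fun x => ?_)
  simp only [dilDeriv, leftIntegral_conj, weighted_conj, map_add, map_mul, Complex.conj_ofReal]
  ring

end Weight

end FractionalOperators

/-! ### The form on `H₀¹(Ω)`: boundedness, coercivity and integration by parts -/

section EnergyForm

variable {n : ℕ} {Ω : Set (EuclideanSpace ℝ (Fin n))}

/-- Multiplication by a continuous function as a bounded operator. -/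
theorem exists_mulCLM (hΩ : IsOpen Ω) (hb : Bornology.IsBounded Ω)
    {a : EuclideanSpace ℝ (Fin n) → ℝ} (ha : ContinuousOn a (closure Ω)) :
    ∃ A : L2 Ω →L[ℂ] L2 Ω, ∀ f : L2 Ω, A f =ᵐ[volume.restrict Ω] fun x => (a x : ℂ) * f x := by
  obtain ⟨C, hC⟩ := hb.isCompact_closure.exists_bound_of_continuousOn ha
  have hm := fun f : L2 Ω => memLp_ofReal_mul hΩ hb ha (Lp.memLp f)
  refine ⟨LinearMap.mkContinuous
    { toFun := fun f => (hm f).toLp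
      map_add' := fun f g => ?_
      map_smul' := fun c f => ?_ } C fun f => ?_, fun f => (hm f).coeFn_toLp⟩
  · rw [← MemLp.toLp_add]
    refine MemLp.toLp_congr _ _ ?_
    filter_upwards [Lp.coeFn_add f g] with x hx
    rw [hx, Pi.add_apply, Pi.add_apply, mul_add]
  · rw [← MemLp.toLp_const_smul]
    refine MemLp.toLp_congr _ _ ?_
    filter_upwards [Lp.coeFn_smul c f] with x hx
    rw [hx, Pi.smul_apply, Pi.smul_apply, smul_eq_mul, smul_eq_mul, RingHom.id_apply, mul_left_comm]
  · refine Lp.norm_le_mul_norm_of_ae_le_mul ?_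
    filter_upwards [(hm f).coeFn_toLp, ae_restrict_mem hΩ.measurableSet] with x hx hxΩ
    change ‖(hm f).toLp _ x‖ ≤ _
    rw [hx, norm_mul, Complex.norm_real]
    exact mul_le_mul_of_nonneg_right (hC x (subset_closure hxΩ)) (norm_nonneg _)

section Multiplication

variable {a : EuclideanSpace ℝ (Fin n) → ℝ}

theorem inner_mul_ae {A : L2 Ω →L[ℂ] L2 Ω}
    (hA : ∀ f : L2 Ω, A f =ᵐ[volume.restrict Ω] fun x => (a x : ℂ) * f x) (f g : L2 Ω) :
    (fun x => ⟪f x, A g x⟫_ℂ) =ᵐ[volume.restrict Ω] fun x => (a x : ℂ) * g x * conj (f x) := by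
  filter_upwards [hA g] with x hx
  rw [hx, RCLike.inner_apply]

theorem inner_mul_comm {A : L2 Ω →L[ℂ] L2 Ω}
    (hA : ∀ f : L2 Ω, A f =ᵐ[volume.restrict Ω] fun x => (a x : ℂ) * f x) (f g : L2 Ω) :
    ⟪A f, g⟫_ℂ = ⟪f, A g⟫_ℂ := by
  rw [L2.inner_def, L2.inner_def]
  refine integral_congr_ae ?_
  filter_upwards [hA f, hA g] with x h1 h2
  rw [h1, h2, RCLike.inner_apply, RCLike.inner_apply, map_mul, Complex.conj_ofReal]
  ring

end Multiplication

/-- Real ellipticity is applied to the real and imaginary parts of `z`. As the coefficients are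
real, the mixed terms are purely imaginary even without symmetry. -/
theorem elliptic_complex {a : Fin n → Fin n → ℝ} {a₀ : ℝ}
    (h : ∀ ξ : EuclideanSpace ℝ (Fin n), a₀ * ‖ξ‖ ^ 2 ≤ ∑ i, ∑ j, a i j * ξ i * ξ j)
    (z : Fin n → ℂ) :
    a₀ * ∑ i, ‖z i‖ ^ 2 ≤ (∑ i, ∑ j, (a i j : ℂ) * z i * conj (z j)).re := by
  have h1 := h (WithLp.toLp 2 fun i => (z i).re)
  have h2 := h (WithLp.toLp 2 fun i => (z i).im)
  rw [EuclideanSpace.real_norm_sq_eq] at h1 h2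
  simp only at h1 h2
  have h3 : a₀ * ∑ i, ‖z i‖ ^ 2 = a₀ * ∑ i, (z i).re ^ 2 + a₀ * ∑ i, (z i).im ^ 2 := by
    rw [← mul_add, ← Finset.sum_add_distrib]
    congr 1
    refine Finset.sum_congr rfl fun i _ => ?_
    rw [Complex.sq_norm, Complex.normSq_apply]
    ring
  have h4 : (∑ i, ∑ j, (a i j : ℂ) * z i * conj (z j)).re =
      (∑ i, ∑ j, a i j * (z i).re * (z j).re) + ∑ i, ∑ j, a i j * (z i).im * (z j).im := by
    simp only [Complex.re_sum, ← Finset.sum_add_distrib]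
    refine Finset.sum_congr rfl fun i _ => Finset.sum_congr rfl fun j _ => ?_
    simp
  rw [h3, h4]
  exact add_le_add h1 h2

/-- Strong ellipticity in the integrated form. -/
theorem elliptic_inner (hΩ : IsOpen Ω) {a : Fin n → Fin n → EuclideanSpace ℝ (Fin n) → ℝ} {a₀ : ℝ}
    (h : ∀ x ∈ Ω, ∀ ξ : EuclideanSpace ℝ (Fin n),
      a₀ * ‖ξ‖ ^ 2 ≤ ∑ i, ∑ j, a i j x * ξ i * ξ j) {A : Fin n → Fin n → L2 Ω →L[ℂ] L2 Ω}
    (hA : ∀ i j, ∀ f : L2 Ω, A i j f =ᵐ[volume.restrict Ω] fun x => (a i j x : ℂ) * f x)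
    (ξ : Fin n → L2 Ω) :
    a₀ * ∑ i, ‖ξ i‖ ^ 2 ≤ (∑ i, ∑ j, ⟪ξ j, A i j (ξ i)⟫_ℂ).re := by
  have hi : ∀ i j, Integrable (fun x => ⟪ξ j x, A i j (ξ i) x⟫_ℂ) (volume.restrict Ω) :=
    fun i j => L2.integrable_inner _ _
  have hn : ∀ i, Integrable (fun x => ‖ξ i x‖ ^ 2) (volume.restrict Ω) := fun i =>
    (memLp_two_iff_integrable_sq_norm (Lp.aestronglyMeasurable _)).1 (Lp.memLp _)
  have h1 : ∀ i, ‖ξ i‖ ^ 2 = ∫ x in Ω, ‖ξ i x‖ ^ 2 := by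
    intro i
    rw [← inner_self_eq_norm_sq (𝕜 := ℂ), L2.inner_def, ← integral_re (L2.integrable_inner _ _)]
    simp only [inner_self_eq_norm_sq]
  have h2 : ∑ i, ∑ j, ⟪ξ j, A i j (ξ i)⟫_ℂ = ∫ x in Ω, ∑ i, ∑ j, ⟪ξ j x, A i j (ξ i) x⟫_ℂ := by
    rw [integral_finsetSum _ fun i _ => integrable_finsetSum _ fun j _ => hi i j]
    refine Finset.sum_congr rfl fun i _ => ?_
    rw [integral_finsetSum _ fun j _ => hi i j]
    simp only [L2.inner_def]
  have h3 := integral_re (𝕜 := ℂ) (μ := volume.restrict Ω)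
    (f := fun x => ∑ i, ∑ j, ⟪ξ j x, A i j (ξ i) x⟫_ℂ)
    (integrable_finsetSum _ fun i _ => integrable_finsetSum _ fun j _ => hi i j)
  simp only [h1]
  rw [h2, ← integral_finsetSum _ fun i _ => hn i, ← integral_const_mul]
  refine le_trans ?_ (le_of_eq h3)
  refine integral_mono_ae ((integrable_finsetSum _ fun i _ => hn i).const_mul _)
    (integrable_finsetSum _ fun i _ => integrable_finsetSum _ fun j _ => hi i j).re ?_
  have h4 : ∀ᵐ x ∂(volume.restrict Ω), ∀ i j,
      ⟪ξ j x, A i j (ξ i) x⟫_ℂ = (a i j x : ℂ) * ξ i x * conj (ξ j x) := by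
    rw [ae_all_iff]; intro i
    rw [ae_all_iff]; intro j
    exact inner_mul_ae (hA i j) _ _
  filter_upwards [h4, ae_restrict_mem hΩ.measurableSet] with x hx hxΩ
  simp only [hx]
  exact elliptic_complex (h x hxΩ) fun i => ξ i x

variable [IsFiniteMeasure (volume.restrict Ω)]

/-- The form with the senior coefficients `A` and the lower order term `T`. -/
noncomputable def energyForm (hΩ : IsOpen Ω) (A : Fin n → Fin n → L2 Ω →L[ℂ] L2 Ω)
    (T : h10 Ω →ₗ[ℂ] L2 Ω) : SesqForm (L2 Ω) where
  domain := h10 Ω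
  toFun := LinearMap.mk₂'ₛₗ (RingHom.id ℂ) (starRingEnd ℂ)
    (fun u v => (∑ i, ∑ j, ⟪gradLin hΩ j v, A i j (gradLin hΩ i u)⟫_ℂ) + ⟪(v : L2 Ω), T u⟫_ℂ)
    (by
      intro u u' v
      simp only [map_add, inner_add_right, Finset.sum_add_distrib]
      ring)
    (by
      intro c u v
      simp only [map_smul, inner_smul_right, ← Finset.mul_sum, ← mul_add, RingHom.id_apply,
        smul_eq_mul])
    (by
      intro u v v'
      simp only [map_add, Submodule.coe_add, inner_add_left, Finset.sum_add_distrib]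
      ring)
    (by
      intro c u v
      simp only [map_smul, Submodule.coe_smul, inner_smul_left, ← Finset.mul_sum, ← mul_add,
        smul_eq_mul])

theorem energyForm_apply (hΩ : IsOpen Ω) (A : Fin n → Fin n → L2 Ω →L[ℂ] L2 Ω)
    (T : h10 Ω →ₗ[ℂ] L2 Ω) (u v : h10 Ω) :
    (energyForm hΩ A T).toFun u v =
      (∑ i, ∑ j, ⟪gradLin hΩ j v, A i j (gradLin hΩ i u)⟫_ℂ) + ⟪(v : L2 Ω), T u⟫_ℂ := rfl

theorem norm_le_energyNorm (hΩ : IsOpen Ω) (u : h10 Ω) : ‖(u : L2 Ω)‖ ≤ energyNorm hΩ u := by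
  rw [energyNorm_apply]
  exact le_add_of_nonneg_right (Finset.sum_nonneg fun _ _ => norm_nonneg _)

theorem gradLin_le_energyNorm (hΩ : IsOpen Ω) (i : Fin n) (u : h10 Ω) :
    ‖gradLin hΩ i u‖ ≤ energyNorm hΩ u := by
  rw [energyNorm_apply]
  have h1 := Finset.single_le_sum (f := fun i => ‖gradLin hΩ i u‖)
    (fun i _ => norm_nonneg _) (Finset.mem_univ i)
  exact h1.trans (le_add_of_nonneg_left (norm_nonneg _))

/-- Here `m` is the `L₂` norm and `G` the gradient norm. The lower order term `C N m` is of first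
degree in `N`, so Young's inequality absorbs it at the price of a multiple of `m²`. -/
theorem coercive_of_le {e C G m N q : ℝ} (he : 0 < e) (hN : N = m + G)
    (h : e * G ^ 2 ≤ q + C * N * m) :
    e / 4 * N ^ 2 ≤ q + (e + C ^ 2 / e) * m ^ 2 := by
  have h1 : e / 2 * N ^ 2 ≤ e * G ^ 2 + e * m ^ 2 := by
    subst hN
    nlinarith [sq_nonneg (m - G)]
  have h2 : C * N * m ≤ e / 4 * N ^ 2 + C ^ 2 / e * m ^ 2 := by
    have h3 : e / 4 * N ^ 2 + C ^ 2 / e * m ^ 2 - C * N * m = e * (N / 2 - C / e * m) ^ 2 := by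
      field_simp
      ring
    have h4 : 0 ≤ e * (N / 2 - C / e * m) ^ 2 := by positivity
    linarith
  linarith

theorem isEnergy_energyForm (hΩ : IsOpen Ω) (hn : 0 < n) {A : Fin n → Fin n → L2 Ω →L[ℂ] L2 Ω}
    {T : h10 Ω →ₗ[ℂ] L2 Ω} {a₀ : ℝ} (ha₀ : 0 < a₀)
    (hA : ∀ ξ : Fin n → L2 Ω, a₀ * ∑ i, ‖ξ i‖ ^ 2 ≤ (∑ i, ∑ j, ⟪ξ j, A i j (ξ i)⟫_ℂ).re)
    {C : ℝ} (hC0 : 0 ≤ C) (hT : ∀ u, ‖T u‖ ≤ C * energyNorm hΩ u) :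
    (energyForm hΩ A T).IsEnergy (energyNorm hΩ) where
  norm_le := norm_le_energyNorm hΩ
  bound := by
    refine ⟨(∑ i, ∑ j, ‖A i j‖) + C, by positivity, ?_⟩
    suffices h : ∀ u v : h10 Ω,
        ‖(∑ i, ∑ j, ⟪gradLin hΩ j v, A i j (gradLin hΩ i u)⟫_ℂ) + ⟪(v : L2 Ω), T u⟫_ℂ‖ ≤
          ((∑ i, ∑ j, ‖A i j‖) + C) * energyNorm hΩ u * energyNorm hΩ v from h
    intro u v
    have h1 : ‖∑ i, ∑ j, ⟪gradLin hΩ j v, A i j (gradLin hΩ i u)⟫_ℂ‖ ≤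
        (∑ i, ∑ j, ‖A i j‖) * (energyNorm hΩ u * energyNorm hΩ v) := by
      simp only [Finset.sum_mul]
      refine norm_sum_le_of_le _ fun i _ => norm_sum_le_of_le _ fun j _ => ?_
      have h2 := norm_inner_le_norm (𝕜 := ℂ) (gradLin hΩ j v) (A i j (gradLin hΩ i u))
      have h3 := (A i j).le_opNorm (gradLin hΩ i u)
      have h4 := gradLin_le_energyNorm hΩ i u
      have h5 := gradLin_le_energyNorm hΩ j v
      calc _ ≤ ‖gradLin hΩ j v‖ * ‖A i j (gradLin hΩ i u)‖ := h2
        _ ≤ energyNorm hΩ v * (‖A i j‖ * energyNorm hΩ u) := by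
            gcongr
            exact h3.trans (by gcongr)
        _ = _ := by ring
    have h6 : ‖⟪(v : L2 Ω), T u⟫_ℂ‖ ≤ C * (energyNorm hΩ u * energyNorm hΩ v) := by
      have h2 := norm_inner_le_norm (𝕜 := ℂ) (v : L2 Ω) (T u)
      calc _ ≤ ‖(v : L2 Ω)‖ * ‖T u‖ := h2
        _ ≤ energyNorm hΩ v * (C * energyNorm hΩ u) := by
            gcongr
            · exact norm_le_energyNorm hΩ v
            · exact hT u
        _ = _ := by ring
    refine (norm_add_le _ _).trans ((add_le_add h1 h6).trans (le_of_eq ?_))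
    ring
  coercive := by
    have hn' : (0 : ℝ) < n := by exact_mod_cast hn
    -- Ellipticity controls the sum of squares of the derivatives, the energy norm contains the sum
    -- of their norms; Cauchy-Schwarz between the two costs the factor `n`.
    have he : 0 < a₀ / n := by positivity
    refine ⟨a₀ / n / 4, a₀ / n + C ^ 2 / (a₀ / n), by positivity, by positivity, ?_⟩
    suffices h : ∀ u : h10 Ω, a₀ / n / 4 * energyNorm hΩ u ^ 2 ≤
        ((∑ i, ∑ j, ⟪gradLin hΩ j u, A i j (gradLin hΩ i u)⟫_ℂ) + ⟪(u : L2 Ω), T u⟫_ℂ).re +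
          (a₀ / n + C ^ 2 / (a₀ / n)) * ‖(u : L2 Ω)‖ ^ 2 from h
    intro u
    refine coercive_of_le he (energyNorm_apply hΩ u) ?_
    rw [Complex.add_re]
    have h1 := hA fun i => gradLin hΩ i u
    have h2 : (∑ i, ‖gradLin hΩ i u‖) ^ 2 ≤ n * ∑ i, ‖gradLin hΩ i u‖ ^ 2 := by
      have := sq_sum_le_card_mul_sum_sq (s := Finset.univ) (f := fun i => ‖gradLin hΩ i u‖)
      simpa using this
    have h3 : a₀ / n * (∑ i, ‖gradLin hΩ i u‖) ^ 2 ≤ a₀ * ∑ i, ‖gradLin hΩ i u‖ ^ 2 := by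
      refine (mul_le_mul_of_nonneg_left h2 he.le).trans (le_of_eq ?_)
      field_simp
    have h4 : -(C * energyNorm hΩ u * ‖(u : L2 Ω)‖) ≤ (⟪(u : L2 Ω), T u⟫_ℂ).re := by
      have h5 := Complex.abs_re_le_norm ⟪(u : L2 Ω), T u⟫_ℂ
      have h6 := norm_inner_le_norm (𝕜 := ℂ) (u : L2 Ω) (T u)
      have h7 := mul_le_mul_of_nonneg_left (hT u) (norm_nonneg (u : L2 Ω))
      have h8 := neg_abs_le (⟪(u : L2 Ω), T u⟫_ℂ).re
      linarith
    linarith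
  complete := energyNorm_complete hΩ

/-- Test functions are dense in the domain of the form. -/
theorem exists_seq_core (hΩ : IsOpen Ω) (v : h10 Ω) : ∃ s : ℕ → h10 Ω,
    (∀ k, (s k : L2 Ω) ∈ h2 Ω) ∧ Tendsto (fun k => energyNorm hΩ (s k - v)) atTop (𝓝 0) := by
  obtain ⟨φ, h, h1, h2⟩ := exists_seq_test hΩ v.2
  refine ⟨fun k => ⟨((h k).memLp 2).toLp, toLp_mem_h10 (h k)⟩, fun k => toLp_mem_h2 (h k),
    tendsto_energyNorm hΩ h1 fun i => ?_⟩
  have h3 : ∀ k, gradLin hΩ i ⟨((h k).memLp 2).toLp, toLp_mem_h10 (h k)⟩ =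
      (((h k).partialDeriv i).memLp 2).toLp := fun k => weakDeriv_toLp hΩ (h k) i
  simp only [h3]
  exact h2 i

/-- Integration by parts against `H₀¹(Ω)`. -/
theorem inner_gradLin (hΩ : IsOpen Ω) {j : Fin n} {f k : L2 Ω} (h : HasWeakDeriv Ω j f k)
    (v : h10 Ω) : ⟪gradLin hΩ j v, f⟫_ℂ = -⟪(v : L2 Ω), k⟫_ℂ := by
  obtain ⟨φ, hφ, h1, h2⟩ := exists_seq_test hΩ v.2
  have h3 := (h2 j).inner (𝕜 := ℂ) (tendsto_const_nhds (x := f))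
  have h4 := (h1.inner (𝕜 := ℂ) (tendsto_const_nhds (x := k))).neg
  simp only [(hasWeakDeriv_iff j f k).1 h _ (hφ _)] at h3
  exact tendsto_nhds_unique h3 h4

/-- The senior term as a linear map on `H²(Ω) ∩ H₀¹(Ω)`. -/
theorem exists_seniorLin (hΩ : IsOpen Ω) (hb : Bornology.IsBounded Ω)
    {a : Fin n → Fin n → EuclideanSpace ℝ (Fin n) → ℝ} (ha : ∀ i j, IsC1Closure Ω (a i j))
    {A : Fin n → Fin n → L2 Ω →L[ℂ] L2 Ω}
    (hA : ∀ i j, ∀ f : L2 Ω, A i j f =ᵐ[volume.restrict Ω] fun x => (a i j x : ℂ) * f x) :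
    ∃ Λ : ↥(h2 Ω ⊓ h10 Ω) →ₗ[ℂ] L2 Ω,
      (∀ u, Λ u =ᵐ[volume.restrict Ω] seniorTerm Ω a (u : L2 Ω)) ∧
      ∀ (u : ↥(h2 Ω ⊓ h10 Ω)) (v : h10 Ω), ⟪(v : L2 Ω), Λ u⟫_ℂ =
        ∑ i, ∑ j, ⟪gradLin hΩ j v, A i j (gradLin hΩ i (Submodule.inclusion inf_le_right u))⟫_ℂ := by
  obtain ⟨k, hk⟩ : ∃ k : Fin n → Fin n → ↥(h2 Ω ⊓ h10 Ω) → L2 Ω, ∀ i j u, k i j u =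
      weakDeriv Ω j (fun y => (a i j y : ℂ) * weakDeriv Ω i (u : L2 Ω) y) :=
    ⟨_, fun _ _ _ => rfl⟩
  have hspec : ∀ i j u, HasWeakDeriv Ω j
      (A i j (gradLin hΩ i (Submodule.inclusion inf_le_right u))) (k i j u) := by
    intro i j u
    obtain ⟨g, hg⟩ := h2_hasWeakDeriv hΩ u.2.1 i j
    rw [hk]
    exact (weakDeriv_spec (exists_hasWeakDeriv_mul hΩ hb (ha i j) hg)).congr (hA i j _).symm
      (EventuallyEq.refl _ _)
  -- The derivatives in the senior term are obtained by choice; their uniqueness makes the choice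
  -- linear in `u`.
  have huniq : ∀ i j u g, HasWeakDeriv Ω j
      (A i j (gradLin hΩ i (Submodule.inclusion inf_le_right u))) (g : L2 Ω) → k i j u = g :=
    fun i j u g hg => (hk i j u).trans <| weakDeriv_eq hΩ (hg.congr (hA i j _) (EventuallyEq.refl _ _))
  have hadd : ∀ i j u v, k i j (u + v) = k i j u + k i j v := by
    intro i j u v
    refine huniq i j _ _ ?_
    simp only [map_add]
    exact (hspec i j u).add (hspec i j v)
  have hsmul : ∀ i j (c : ℂ) u, k i j (c • u) = c • k i j u := by
    intro i j c u
    refine huniq i j _ _ ?_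
    simp only [map_smul]
    exact (hspec i j u).smul c
  have hlin : IsLinearMap ℂ fun u : ↥(h2 Ω ⊓ h10 Ω) => -∑ i, ∑ j, k i j u := by
    constructor
    · intro u v
      simp only [hadd, Finset.sum_add_distrib, neg_add]
    · intro c u
      simp only [hsmul, Finset.smul_sum, smul_neg]
  refine ⟨hlin.mk', fun u => ?_, fun u v => ?_⟩
  · change (-∑ i, ∑ j, k i j u : L2 Ω) =ᵐ[volume.restrict Ω] _
    have h1 : ∀ᵐ x ∂(volume.restrict Ω), ∀ i, (∑ j, k i j u : L2 Ω) x = ∑ j, k i j u x := by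
      rw [ae_all_iff]
      intro i
      filter_upwards [Lp.coeFn_finsetSum Finset.univ fun j => k i j u] with x hx
      rw [hx, Finset.sum_apply]
    filter_upwards [Lp.coeFn_neg (∑ i, ∑ j, k i j u : L2 Ω),
      Lp.coeFn_finsetSum Finset.univ fun i => ∑ j, k i j u, h1] with x h2 h3 h4
    rw [h2, Pi.neg_apply, h3, Finset.sum_apply]
    simp only [h4]
    simp only [hk, seniorTerm]
  · change ⟪(v : L2 Ω), -∑ i, ∑ j, k i j u⟫_ℂ = _
    have h1 : ∀ f : Fin n → L2 Ω, ⟪(v : L2 Ω), ∑ i, f i⟫_ℂ = ∑ i, ⟪(v : L2 Ω), f i⟫_ℂ :=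
      fun f => map_sum (innerSL ℂ (v : L2 Ω)) f Finset.univ
    have h2 : ∀ i j, ⟪gradLin hΩ j v, A i j (gradLin hΩ i (Submodule.inclusion inf_le_right u))⟫_ℂ =
        -⟪(v : L2 Ω), k i j u⟫_ℂ := fun i j => inner_gradLin hΩ (hspec i j u) v
    simp only [h2, Finset.sum_neg_distrib, h1, inner_neg_right]

end EnergyForm

/-! ### The operators represent the form and its real part -/

section Representation

variable {n : ℕ} {Ω : Set (EuclideanSpace ℝ (Fin n))} {P : EuclideanSpace ℝ (Fin n)}
  {α lam M : ℝ} {a : Fin n → Fin n → EuclideanSpace ℝ (Fin n) → ℝ}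
  {ρ : EuclideanSpace ℝ (Fin n) → ℝ} {A : Fin n → Fin n → L2 Ω →L[ℂ] L2 Ω}
  {R : L2 Ω →L[ℂ] L2 Ω} {K : h10 Ω →ₗ[ℂ] L2 Ω}

theorem fracIntegrand_ae
    (hR : ∀ f : L2 Ω, R f =ᵐ[volume.restrict Ω] fun x => (ρ x : ℂ) * f x)
    (hK : ∀ u : h10 Ω, K u =ᵐ[volume.restrict Ω] kipriyanov P α (u : L2 Ω)) (u v : h10 Ω) :
    (fun x => ⟪(v : L2 Ω) x, R (K u) x⟫_ℂ) =ᵐ[volume.restrict Ω]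
      fracIntegrand Ω P α ρ (u : L2 Ω) (v : L2 Ω) := by
  filter_upwards [inner_mul_ae hR (v : L2 Ω) (K u), hK u] with x h1 h2
  rw [h1, h2]
  rfl

variable [IsFiniteMeasure (volume.restrict Ω)]

theorem gradIntegrand_ae (hΩ : IsOpen Ω)
    (hA : ∀ i j, ∀ f : L2 Ω, A i j f =ᵐ[volume.restrict Ω] fun x => (a i j x : ℂ) * f x)
    (u v : h10 Ω) :
    (fun x => ∑ i, ∑ j, ⟪gradLin hΩ j v x, A i j (gradLin hΩ i u) x⟫_ℂ) =ᵐ[volume.restrict Ω]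
      gradIntegrand Ω a (u : L2 Ω) (v : L2 Ω) := by
  have h : ∀ᵐ x ∂(volume.restrict Ω), ∀ i j, ⟪gradLin hΩ j v x, A i j (gradLin hΩ i u) x⟫_ℂ =
      (a i j x : ℂ) * gradLin hΩ i u x * conj (gradLin hΩ j v x) := by
    rw [ae_all_iff]; intro i
    rw [ae_all_iff]; intro j
    exact inner_mul_ae (hA i j) _ _
  filter_upwards [h] with x hx
  simp only [hx]
  rfl

theorem isFormT_energyForm (hΩ : IsOpen Ω)
    (hA : ∀ i j, ∀ f : L2 Ω, A i j f =ᵐ[volume.restrict Ω] fun x => (a i j x : ℂ) * f x)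
    (hR : ∀ f : L2 Ω, R f =ᵐ[volume.restrict Ω] fun x => (ρ x : ℂ) * f x)
    (hK : ∀ u : h10 Ω, K u =ᵐ[volume.restrict Ω] kipriyanov P α (u : L2 Ω)) :
    IsFormT Ω P α a ρ (energyForm hΩ A (R.toLinearMap ∘ₗ K)) := by
  have hi : ∀ (u v : h10 Ω) i j, Integrable
      (fun x => ⟪gradLin hΩ j v x, A i j (gradLin hΩ i u) x⟫_ℂ) (volume.restrict Ω) :=
    fun u v i j => L2.integrable_inner _ _
  refine ⟨coe_h10 hΩ, fun u v => ?_, fun u v => ?_, fun u v => ?_⟩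
  · exact (integrable_finsetSum _ fun i _ => integrable_finsetSum _ fun j _ =>
      hi u v i j).congr (gradIntegrand_ae hΩ hA u v)
  · exact (L2.integrable_inner _ _).congr (fracIntegrand_ae hR hK u v)
  · refine (energyForm_apply hΩ A _ u v).trans (congrArg₂ _ ?_ ?_)
    · rw [← integral_congr_ae (gradIntegrand_ae hΩ hA u v),
        integral_finsetSum _ fun i _ => integrable_finsetSum _ fun j _ => hi u v i j]
      refine Finset.sum_congr rfl fun i _ => ?_
      rw [integral_finsetSum _ fun j _ => hi u v i j]
      rfl
    · rw [← integral_congr_ae (fracIntegrand_ae hR hK u v)]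
      rfl

/-- An operator on `H²(Ω) ∩ H₀¹(Ω)`. -/
noncomputable def strongOperator (Λ : ↥(h2 Ω ⊓ h10 Ω) →ₗ[ℂ] L2 Ω) (T : h10 Ω →ₗ[ℂ] L2 Ω) :
    L2 Ω →ₗ.[ℂ] L2 Ω :=
  ⟨h2 Ω ⊓ h10 Ω, Λ + T ∘ₗ Submodule.inclusion inf_le_right⟩

theorem coe_strongOperator_domain (hΩ : IsOpen Ω) (Λ : ↥(h2 Ω ⊓ h10 Ω) →ₗ[ℂ] L2 Ω)
    (T : h10 Ω →ₗ[ℂ] L2 Ω) :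
    ((strongOperator Λ T).domain : Set (L2 Ω)) = sobolevH2 Ω ∩ sobolevH10 Ω := by
  rw [← coe_h10 hΩ]
  rfl

theorem isOperatorL_strongOperator (hΩ : IsOpen Ω) {Λ : ↥(h2 Ω ⊓ h10 Ω) →ₗ[ℂ] L2 Ω}
    (hΛ : ∀ u, Λ u =ᵐ[volume.restrict Ω] seniorTerm Ω a (u : L2 Ω))
    (hR : ∀ f : L2 Ω, R f =ᵐ[volume.restrict Ω] fun x => (ρ x : ℂ) * f x)
    (hK : ∀ u : h10 Ω, K u =ᵐ[volume.restrict Ω] kipriyanov P α (u : L2 Ω)) :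
    IsOperatorL Ω P α a ρ (strongOperator Λ (R.toLinearMap ∘ₗ K)) := by
  refine ⟨coe_strongOperator_domain hΩ _ _, fun (u : ↥(h2 Ω ⊓ h10 Ω)) => ?_⟩
  have h1 := Lp.coeFn_add (Λ u) (R (K (Submodule.inclusion inf_le_right u)))
  filter_upwards [h1, hΛ u, hR (K (Submodule.inclusion inf_le_right u)),
    hK (Submodule.inclusion inf_le_right u)] with x h1 h2 h3 h4
  refine h1.trans ?_
  rw [Pi.add_apply, h2, h3, h4]
  rfl

theorem IsConvexSetting.isOperatorLplus_strongOperator (S : IsConvexSetting Ω P α)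
    (h : IsHolderWeight Ω α lam M ρ) {Λ : ↥(h2 Ω ⊓ h10 Ω) →ₗ[ℂ] L2 Ω}
    (hΛ : ∀ u, Λ u =ᵐ[volume.restrict Ω] seniorTerm Ω (fun i j => a j i) (u : L2 Ω))
    {W : h10 Ω →ₗ[ℂ] L2 Ω} (hW : ∀ u : h10 Ω, W u =ᵐ[volume.restrict Ω] fun x =>
      ((α / Real.Gamma (1 - α) : ℝ) : ℂ) *
        rightIntegral P α (Ω.indicator fun x => (ρ x : ℂ) * (u : L2 Ω) x) x) :
    IsOperatorLplus Ω P α a ρ (strongOperator Λ W) := by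
  refine ⟨coe_strongOperator_domain S.isOpen _ _, fun (u : ↥(h2 Ω ⊓ h10 Ω)) => ?_⟩
  have hd := S.hasRightDeriv h (Submodule.inclusion inf_le_right u)
    (hW (Submodule.inclusion inf_le_right u))
  have h1 := Lp.coeFn_add (Λ u) (W (Submodule.inclusion inf_le_right u))
  refine ⟨W (Submodule.inclusion inf_le_right u), hd, ?_⟩
  filter_upwards [h1, hΛ u] with x h1 h2
  refine h1.trans ?_
  rw [Pi.add_apply, h2]

/-- The operator `W` is adjoint to `ρ 𝔇^α`. -/
theorem IsConvexSetting.inner_rightLin (S : IsConvexSetting Ω P α)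
    (h : IsHolderWeight Ω α lam M ρ)
    (hR : ∀ f : L2 Ω, R f =ᵐ[volume.restrict Ω] fun x => (ρ x : ℂ) * f x)
    (hK : ∀ u : h10 Ω, K u =ᵐ[volume.restrict Ω] kipriyanov P α (u : L2 Ω))
    {W : h10 Ω →ₗ[ℂ] L2 Ω} (hW : ∀ u : h10 Ω, W u =ᵐ[volume.restrict Ω] fun x =>
      ((α / Real.Gamma (1 - α) : ℝ) : ℂ) *
        rightIntegral P α (Ω.indicator fun x => (ρ x : ℂ) * (u : L2 Ω) x) x) (u v : h10 Ω) :
    ⟪(v : L2 Ω), W u⟫_ℂ = ⟪R (K v), (u : L2 Ω)⟫_ℂ := by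
  rw [inner_mul_comm hR, L2.inner_def, L2.inner_def]
  have h1 : ∫ x in Ω, ⟪(v : L2 Ω) x, W u x⟫_ℂ =
      ∫ x in Ω, conj ((v : L2 Ω) x) * (((α / Real.Gamma (1 - α) : ℝ) : ℂ) *
        rightIntegral P α (Ω.indicator fun x => (ρ x : ℂ) * (u : L2 Ω) x) x) := by
    refine integral_congr_ae ?_
    filter_upwards [hW u] with x hx
    rw [hx, RCLike.inner_apply, mul_comm]
  rw [h1, ← S.integral_conj_kipriyanov h u v]
  refine integral_congr_ae ?_
  filter_upwards [hK v, hR (u : L2 Ω)] with x h2 h3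
  rw [h2, h3, RCLike.inner_apply, mul_comm]

theorem isRepresentedOn_strongOperator (hΩ : IsOpen Ω) {Λ : ↥(h2 Ω ⊓ h10 Ω) →ₗ[ℂ] L2 Ω}
    (hΛ : ∀ (u : ↥(h2 Ω ⊓ h10 Ω)) (v : h10 Ω), ⟪(v : L2 Ω), Λ u⟫_ℂ =
      ∑ i, ∑ j, ⟪gradLin hΩ j v, A i j (gradLin hΩ i (Submodule.inclusion inf_le_right u))⟫_ℂ)
    (T : h10 Ω →ₗ[ℂ] L2 Ω) :
    (energyForm hΩ A T).IsRepresentedOn (energyNorm hΩ) (strongOperator Λ T) where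
  domain_le := inf_le_right
  inner_eq := by
    suffices h : ∀ (u : ↥(h2 Ω ⊓ h10 Ω)) (v : h10 Ω),
        ⟪(v : L2 Ω), Λ u + T (Submodule.inclusion inf_le_right u)⟫_ℂ =
          (energyForm hΩ A T).toFun (Submodule.inclusion inf_le_right u : h10 Ω) v from h
    intro u v
    rw [energyForm_apply, inner_add_right, hΛ]
  core v := by
    obtain ⟨s, h1, h2⟩ := exists_seq_core hΩ v
    exact ⟨fun k => ⟨(s k : L2 Ω), h1 k, (s k).2⟩, h2⟩

/-- Conjugation exchanges the two gradients and hence transposes the coefficient matrix, which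
accounts for the order of indices in the senior term of `L⁺`. -/
theorem energyForm_adjoint (hΩ : IsOpen Ω)
    (hA : ∀ i j (f g : L2 Ω), ⟪A i j f, g⟫_ℂ = ⟪f, A i j g⟫_ℂ) (T : h10 Ω →ₗ[ℂ] L2 Ω)
    (u v : h10 Ω) : conj ((energyForm hΩ A T).toFun v u) =
      (∑ i, ∑ j, ⟪gradLin hΩ j v, A j i (gradLin hΩ i u)⟫_ℂ) + ⟪T v, (u : L2 Ω)⟫_ℂ := by
  have h1 : ∀ i j, conj ⟪gradLin hΩ j u, A i j (gradLin hΩ i v)⟫_ℂ =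
      ⟪gradLin hΩ i v, A i j (gradLin hΩ j u)⟫_ℂ := fun i j => by
    rw [inner_conj_symm, hA]
  rw [energyForm_apply, map_add, inner_conj_symm, map_sum, Finset.sum_comm]
  congr 1
  refine Finset.sum_congr rfl fun i _ => ?_
  rw [map_sum]
  exact Finset.sum_congr rfl fun j _ => h1 i j

theorem inner_half_smul {H : Type*} [NormedAddCommGroup H] [InnerProductSpace ℂ H]
    (v x y x' y' : H) : ⟪v, (1 / 2 : ℂ) • ((x + y) + (x' + y'))⟫_ℂ =
      (1 / 2 : ℂ) * ((⟪v, x⟫_ℂ + ⟪v, y⟫_ℂ) + (⟪v, x'⟫_ℂ + ⟪v, y'⟫_ℂ)) := by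
  simp only [inner_smul_right, inner_add_right]

/-- The first operator represents `t[u,v]` and the second the conjugate of `t[v,u]`, by
transposition of the coefficients and by `hW`; their half-sum represents the real part. -/
theorem realPart_isRepresentedOn (hΩ : IsOpen Ω) {Λ Λ' : ↥(h2 Ω ⊓ h10 Ω) →ₗ[ℂ] L2 Ω}
    (hA : ∀ i j (f g : L2 Ω), ⟪A i j f, g⟫_ℂ = ⟪f, A i j g⟫_ℂ)
    (hΛ : ∀ (u : ↥(h2 Ω ⊓ h10 Ω)) (v : h10 Ω), ⟪(v : L2 Ω), Λ u⟫_ℂ =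
      ∑ i, ∑ j, ⟪gradLin hΩ j v, A i j (gradLin hΩ i (Submodule.inclusion inf_le_right u))⟫_ℂ)
    (hΛ' : ∀ (u : ↥(h2 Ω ⊓ h10 Ω)) (v : h10 Ω), ⟪(v : L2 Ω), Λ' u⟫_ℂ =
      ∑ i, ∑ j, ⟪gradLin hΩ j v, A j i (gradLin hΩ i (Submodule.inclusion inf_le_right u))⟫_ℂ)
    {T W : h10 Ω →ₗ[ℂ] L2 Ω} (hW : ∀ u v : h10 Ω, ⟪(v : L2 Ω), W u⟫_ℂ = ⟪T v, (u : L2 Ω)⟫_ℂ) :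
    (energyForm hΩ A T).realPart.IsRepresentedOn (energyNorm hΩ : Seminorm ℂ (h10 Ω))
      ((1 / 2 : ℂ) • (strongOperator Λ T + strongOperator Λ' W)) where
  -- The domain of a sum of partial operators is the intersection of their domains, here two copies
  -- of `H² ∩ H₀¹`.
  domain_le := fun _ hu => hu.1.2
  inner_eq := by
    have key : ∀ (u : ↥(h2 Ω ⊓ h10 Ω)) (v : h10 Ω),
        ⟪(v : L2 Ω), (1 / 2 : ℂ) • ((Λ u + T (Submodule.inclusion inf_le_right u)) +
          (Λ' u + W (Submodule.inclusion inf_le_right u)))⟫_ℂ =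
        (1 / 2 : ℂ) * ((energyForm hΩ A T).toFun (Submodule.inclusion inf_le_right u : h10 Ω) v +
          conj ((energyForm hΩ A T).toFun v (Submodule.inclusion inf_le_right u : h10 Ω))) := by
      intro u v
      have h1 := energyForm_adjoint hΩ hA T (Submodule.inclusion inf_le_right u) v
      have h2 := energyForm_apply hΩ A T (Submodule.inclusion inf_le_right u) v
      have h3 := hW (Submodule.inclusion inf_le_right u) v
      refine (inner_half_smul _ _ _ _ _).trans (congrArg _ (congrArg₂ _ ?_ ?_))
      · exact (congrArg (· + _) (hΛ u v)).trans h2.symm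
      · exact (congrArg₂ (· + ·) (hΛ' u v) h3).trans h1.symm
    intro u v
    exact key ⟨u, u.2.1⟩ v
  core := by
    suffices h : ∀ v : h10 Ω, ∃ s : ℕ → ↥((h2 Ω ⊓ h10 Ω) ⊓ (h2 Ω ⊓ h10 Ω)),
        Tendsto (fun k => energyNorm hΩ (⟨(s k : L2 Ω), (s k).2.1.2⟩ - v)) atTop (𝓝 0) from h
    intro v
    obtain ⟨s, h1, h2⟩ := exists_seq_core hΩ v
    exact ⟨fun k => ⟨(s k : L2 Ω), ⟨h1 k, (s k).2⟩, ⟨h1 k, (s k).2⟩⟩, h2⟩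

end Representation

end Kipriyanov

/-! ### The theorem -/

theorem lemma5p1 {n : ℕ} (hn : 2 ≤ n)
    (Ω : Set (EuclideanSpace ℝ (Fin n)))
    (hΩ_open : IsOpen Ω) (hΩ_convex : Convex ℝ Ω) (hΩ_bdd : Bornology.IsBounded Ω)
    (P : EuclideanSpace ℝ (Fin n)) (hP : P ∈ frontier Ω)
    (α : ℝ) (hα0 : 0 < α) (hα1 : α < 1)
    (a : Fin n → Fin n → EuclideanSpace ℝ (Fin n) → ℝ)
    (ha : ∀ i j, Kipriyanov.IsC1Closure Ω (a i j))
    (a₀ : ℝ) (ha₀ : 0 < a₀)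
    (hell : ∀ x ∈ Ω, ∀ ξ : EuclideanSpace ℝ (Fin n),
      a₀ * ‖ξ‖ ^ 2 ≤ ∑ i, ∑ j, a i j x * ξ i * ξ j)
    (ρ : EuclideanSpace ℝ (Fin n) → ℝ) (hρ_pos : ∀ x ∈ Ω, 0 < ρ x)
    (lam M : ℝ) (hlam : α < lam) (hlam1 : lam ≤ 1)
    (hρ_lip : ∀ x ∈ closure Ω, ∀ y ∈ closure Ω, |ρ x - ρ y| ≤ M * ‖x - y‖ ^ lam) :
    -- the Kipriyanov derivative is well defined on `H₀¹(Ω)`, with values in `L₂(Ω)`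
    (∀ u ∈ Kipriyanov.sobolevH10 Ω,
      (∀ᵐ Q ∂(volume.restrict Ω), IntervalIntegrable
        (Kipriyanov.kipriyanovIntegrand P α u Q) volume 0 ‖Q - P‖) ∧
      MemLp (Kipriyanov.kipriyanov P α u) 2 (volume.restrict Ω)) ∧
    ∃ (t : Kipriyanov.SesqForm (Kipriyanov.L2 Ω))
      (L Lplus : Kipriyanov.L2 Ω →ₗ.[ℂ] Kipriyanov.L2 Ω),
      Kipriyanov.IsFormT Ω P α a ρ t ∧
      Kipriyanov.IsOperatorL Ω P α a ρ L ∧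
      Kipriyanov.IsOperatorLplus Ω P α a ρ Lplus ∧
      -- the form `t` and the closure of `L`
      t.IsSectorial ∧ t.IsClosed ∧
      L.IsClosable ∧
      t.IsClosureOf (Kipriyanov.operatorForm L.closure) ∧
      -- the real part of `t` and the closure of `H = ½ (L + L⁺)`
      t.realPart.IsSymmetric ∧ t.realPart.IsSectorial ∧ t.realPart.IsClosed ∧
      ((1 / 2 : ℂ) • (L + Lplus)).IsClosable ∧
      t.realPart.IsClosureOf
        (Kipriyanov.operatorForm ((1 / 2 : ℂ) • (L + Lplus)).closure) := by
  have hfin : IsFiniteMeasure (volume.restrict Ω) :=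
    ⟨by rw [Measure.restrict_apply_univ]; exact hΩ_bdd.measure_lt_top⟩
  have S : Kipriyanov.IsConvexSetting Ω P α :=
    ⟨hn, hα0, hα1, hΩ_open, hΩ_convex, hΩ_bdd, by
      rw [hΩ_open.frontier_eq] at hP; exact hP.2, frontier_subset_closure hP⟩
  have hρ : Kipriyanov.IsHolderWeight Ω α lam M ρ := ⟨hlam, hlam1, hρ_lip⟩
  choose A hA using fun i j => Kipriyanov.exists_mulCLM hΩ_open hΩ_bdd (ha i j).1
  obtain ⟨R, hR⟩ := Kipriyanov.exists_mulCLM hΩ_open hΩ_bdd (hρ.continuousOn hα0)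
  obtain ⟨K, C, hC0, hK, hKC⟩ := S.exists_kipriyanovLin
  obtain ⟨W, hW⟩ := S.exists_rightLin hρ
  obtain ⟨Λ, hΛ, hΛi⟩ := Kipriyanov.exists_seniorLin hΩ_open hΩ_bdd ha hA
  obtain ⟨Λ', hΛ', hΛi'⟩ := Kipriyanov.exists_seniorLin hΩ_open hΩ_bdd
    (fun i j => ha j i) (fun i j => hA j i)
  have hT : ∀ u, ‖(R.toLinearMap ∘ₗ K) u‖ ≤ (‖R‖ * C) * Kipriyanov.energyNorm S.isOpen u := by
    intro u
    rw [mul_assoc]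
    exact (R.le_opNorm _).trans (mul_le_mul_of_nonneg_left (hKC u) (norm_nonneg _))
  have hE := Kipriyanov.isEnergy_energyForm hΩ_open (by omega) ha₀
    (Kipriyanov.elliptic_inner hΩ_open hell hA) (by positivity) hT
  have hrep := Kipriyanov.isRepresentedOn_strongOperator hΩ_open hΛi (R.toLinearMap ∘ₗ K)
  have hrep' := Kipriyanov.realPart_isRepresentedOn hΩ_open
    (fun i j => Kipriyanov.inner_mul_comm (hA i j)) hΛi hΛi' (T := R.toLinearMap ∘ₗ K) (W := W)
    (fun u v => S.inner_rightLin hρ hR hK hW u v)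
  -- Density of `H₀¹(Ω)` in `L₂(Ω)`, tested on smooth functions of compact support; both closability
  -- statements use it.
  have hd : ∀ w : Kipriyanov.L2 Ω, (∀ v : Kipriyanov.h10 Ω,
      ⟪(v : Kipriyanov.L2 Ω), w⟫_ℂ = 0) → w = 0 := fun w hw =>
    Kipriyanov.eq_zero_of_inner_test hΩ_open fun φ hφ => hw ⟨_, Kipriyanov.toLp_mem_h10 hφ⟩
  have hcl := hrep.isClosable hE hd
  have hcl' := hrep'.isClosable hE.realPart hd
  refine ⟨fun u hu => ?_, _, _, _, Kipriyanov.isFormT_energyForm hΩ_open hA hR hK,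
    Kipriyanov.isOperatorL_strongOperator hΩ_open hΛ hR hK,
    S.isOperatorLplus_strongOperator hρ hΛ' hW, hE.isSectorial, hE.isClosed, hcl,
    hrep.isClosureOf hE hcl, Kipriyanov.SesqForm.realPart_isSymmetric _, hE.realPart.isSectorial,
    hE.realPart.isClosed, hcl', hrep'.isClosureOf hE.realPart hcl'⟩
  rw [← Kipriyanov.coe_h10 hΩ_open] at hu
  exact ⟨S.ae_intervalIntegrable ⟨u, hu⟩, (memLp_congr_ae (hK ⟨u, hu⟩)).1 (Lp.memLp _)⟩
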